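/- Let $\mu_1,\mu_2>0$, $\epsilon_1,\epsilon_2\in\{1,-1\}$ and $c\in\mathbb R$. Write $[n]_\mu=n+(1-(-1)^n)\mu$, and for $\mu>0$, $\epsilon=\pm1$ let $(\mu,\epsilon)$ be the positive discrete series representation of $\mathfrak{osp}(1|2)$ on $\ell^2(\mathbb Z_+)$ with orthonormal basis $e_n^{(\mu,\epsilon)}$, $n\ge 0$: \[ J_0e_n=(n+\mu+\tfrac12)e_n,\quad Re_n=\epsilon(-1)^ne_n,\quad J_+e_n=[n+1]_\mu^{1/2}e_{n+1},\quad J_-e_n=[n]_\mu^{1/2}e_{n-1}. \] The algebra acts on the tensor product $(\mu_1,\epsilon_1)\otimes(\mu_2,\epsilon_2)$ by $\Delta(J_0)=J_0\otimes1+1\otimes J_0$, $\Delta(R)=R\otimes R$, $\Delta(J_\pm)=J_\pm\otimes R+1\otimes J_\pm$. For $j=0,1,2,\dots$ put $\mu_{12}=\mu_1+\mu_2+j+\tfrac12$ and $\epsilon_{12}=\epsilon_1\epsilon_2(-1)^j$. There is a unique orthonormal basis $e_N^{(\mu_{12},\epsilon_{12})}$ ($j,N\ge0$) of $\ell^2(\mathbb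 Z_+)\otimes\ell^2(\mathbb Z_+)$, consisting of finite linear combinations of the vectors $e_{n_1}^{(\mu_1,\epsilon_1)}\otimes e_{n_2}^{(\mu_2,\epsilon_2)}$ (the coupled basis), such that for each $j$ the generators act through $\Delta$ on $(e_N^{(\mu_{12},\epsilon_{12})})_{N\ge0}$ as in the representation $(\mu_{12},\epsilon_{12})$, and the coefficient of $e_0^{(\mu_1,\epsilon_1)}\otimes e_j^{(\mu_2,\epsilon_2)}$ in $e_0^{(\mu_{12},\epsilon_{12})}$ is $(-1)^{j(j+1)/2}$ times a positive number. Let $P_n(\lambda;\mu,\gamma)$ be the Specialized Chihara polynomials, defined by $P_{-1}=0$, $P_0=1$ and $\lambda P_n=[n+1]_\mu^{1/2}P_{n+1}+\gamma(-1)^nP_n+[n]_\mu^{1/2}P_{n-1}$, let \[ W(\lambda,\mu,\gamma)=\frac{\operatorname{sign}(\lambda)(\lambda+\gamma)}{2\Gamma(\mu+\frac12)}\Big(\frac{\lambda^2-\gamma^2}{2}\Big)^{\mu-\frac12}e^{-(\lambda^2-\gamma^2)/2}, \] and $G=\{(\lambda_1,\lambda_2)\in\mathbb R^2: |\lambda_2|>|\lambda_1|>|c|\}$.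 There is a unique unitary map \[ \Upsilon:\ \ell^2(\mathbb Z_+)\otimes\ell^2(\mathbb Z_+)\to L^2\big(G,\,W(\lambda_1,\mu_1,c\epsilon_1)W(\lambda_2,\mu_2,\lambda_1\epsilon_2)\,d\lambda_1d\lambda_2\big) \] with $\Upsilon(e_{n_1}^{(\mu_1,\epsilon_1)}\otimes e_{n_2}^{(\mu_2,\epsilon_2)})=P_{n_1}(\lambda_1;\mu_1,c\epsilon_1)P_{n_2}(\lambda_2;\mu_2,\lambda_1\epsilon_2)$ for all $n_1,n_2\ge 0$. In this $L^2$ space one has, for all $j,N\ge0$, \[ \Upsilon e_N^{(\mu_{12},\epsilon_{12})}(\lambda_1,\lambda_2)=P_N(\lambda_2;\mu_{12},c\epsilon_{12})\,\Upsilon e_0^{(\mu_{12},\epsilon_{12})}(\lambda_1,\lambda_2), \] \[ \Upsilon e_0^{(\mu_{12},\epsilon_{12})}(\lambda_1,\lambda_2)=\operatorname{sign}(\lambda_2)^j\,K_j(\lambda_2;\mu_2,\mu_1;c)\,J_j\Big(\frac{\epsilon_2\lambda_1}{\lambda_2};\,2\mu_2,\,2\mu_1,\,-\frac{c\epsilon_1\epsilon_2}{\lambda_2}\Big),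 \] where, with the nonnegative square root, \[ K_j(\lambda_2;\mu_2,\mu_1;c)=\sqrt{\Big(\frac{\lambda_2^2-c^2}{2}\Big)^j\,\frac{\lambda_2-c\epsilon_1\epsilon_2}{\lambda_2-(-1)^jc\epsilon_1\epsilon_2}\,\frac{\Gamma(\mu_1+\frac12)\Gamma(\mu_2+\frac12)}{\Gamma(\mu_{12}+\frac12)\,h_j(2\mu_2,2\mu_1)}}, \] $J_n(x;a,b,c)$ is the Big $-1$ Jacobi polynomial: for $n$ even \[ J_n={}_2F_1\Big(-\tfrac n2,\tfrac{n+a+b+2}2;\tfrac{a+1}2;\tfrac{1-x^2}{1-c^2}\Big)+\tfrac{n(1-x)}{(1+c)(a+1)}\,{}_2F_1\Big(1-\tfrac n2,\tfrac{n+a+b+2}2;\tfrac{a+3}2;\tfrac{1-x^2}{1-c^2}\Big) \] (the second term being $0$ for $n=0$), and for $n$ odd \[ J_n={}_2F_1\Big(-\tfrac{n-1}2,\tfrac{n+a+b+1}2;\tfrac{a+1}2;\tfrac{1-x^2}{1-c^2}\Big)-\tfrac{(n+a+b+1)(1-x)}{(1+c)(a+1)}\,{}_2F_1\Big(-\tfrac{n-1}2,\tfrac{n+a+b+3}2;\tfrac{a+3}2;\tfrac{1-x^2}{1-c^2}\Big),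 \] and, with $(a)_k=a(a+1)\cdots(a+k-1)$, \[ h_n(a,b)=\frac{2\,\Gamma(\frac{n+b+1}2)\Gamma(\frac{n+a+3}2)(\frac n2)!}{(n+a+1)\Gamma(\frac{n+a+b+2}2)\big(\frac{a+1}2\big)_{n/2}^2}\ (n\text{ even}),\qquad h_n(a,b)=\frac{(n+a+b+1)\Gamma(\frac{n+b+2}2)\Gamma(\frac{n+a+2}2)(\frac{n-1}2)!}{2\,\Gamma(\frac{n+a+b+3}2)\big(\frac{a+1}2\big)_{(n+1)/2}^2}\ (n\text{ odd}). \] -/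

import Mathlib

open MeasureTheory
open scoped TensorProduct InnerProductSpace

noncomputable section

namespace OspConvolution

/-! ## The orthogonal polynomials -/

/-- The `μ`-number `[n]_μ = n + (1 - (-1)^n) μ`. -/
def muNumber (n : ℕ) (μ : ℝ) : ℝ := n + (1 - (-1) ^ n) * μ

/-- The Specialized Chihara polynomials `P_n(x; μ, γ)`: the solution of
`x P_n = [n+1]_μ^{1/2} P_{n+1} + γ (-1)^n P_n + [n]_μ^{1/2} P_{n-1}` with `P_0 = 1`, `P_{-1} = 0`. -/
def chihara (μ γ x : ℝ) : ℕ → ℝ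
  | 0 => 1
  | 1 => (x - γ) / √(muNumber 1 μ)
  | n + 2 => ((x - γ * (-1) ^ (n + 1)) * chihara μ γ x (n + 1)
      - √(muNumber (n + 1) μ) * chihara μ γ x n) / √(muNumber (n + 2) μ)

/-- The weight `W(x, μ, γ)` for which the polynomials `P_n(x; μ, γ)` are orthonormal on
`|x| > |γ|`. -/
def chiharaWeight (x μ γ : ℝ) : ℝ :=
  Real.sign x * (x + γ) * ((x ^ 2 - γ ^ 2) / 2) ^ (μ - 1 / 2)
    * Real.exp (-((x ^ 2 - γ ^ 2) / 2)) / (2 * Real.Gamma (μ + 1 / 2))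

/-- The Big `-1` Jacobi polynomials `J_n(x; a, b, c)`. -/
def bigJacobi (n : ℕ) (x a b c : ℝ) : ℝ :=
  if Even n then
    ₂F₁ (-(n : ℝ) / 2) ((n + a + b + 2) / 2) ((a + 1) / 2) ((1 - x ^ 2) / (1 - c ^ 2))
      + n * (1 - x) / ((1 + c) * (a + 1))
        * ₂F₁ (1 - (n : ℝ) / 2) ((n + a + b + 2) / 2) ((a + 3) / 2) ((1 - x ^ 2) / (1 - c ^ 2))
  else
    ₂F₁ (-((n : ℝ) - 1) / 2) ((n + a + b + 1) / 2) ((a + 1) / 2) ((1 - x ^ 2) / (1 - c ^ 2))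
      - (n + a + b + 1) * (1 - x) / ((1 + c) * (a + 1))
        * ₂F₁ (-((n : ℝ) - 1) / 2) ((n + a + b + 3) / 2) ((a + 3) / 2)
            ((1 - x ^ 2) / (1 - c ^ 2))

/-- The Pochhammer symbol `(x)_k = x (x+1) ⋯ (x+k-1)`. -/
def poch (x : ℝ) (k : ℕ) : ℝ := (ascPochhammer ℝ k).eval x

/-- The normalization factor `h_n(a, b)` of the Big `-1` Jacobi polynomials. -/
def jacobiNorm (n : ℕ) (a b : ℝ) : ℝ :=
  if Even n then
    2 * Real.Gamma ((n + b + 1) / 2) * Real.Gamma ((n + a + 3) / 2) * (n / 2).factorial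
      / ((n + a + 1) * Real.Gamma ((n + a + b + 2) / 2) * poch ((a + 1) / 2) (n / 2) ^ 2)
  else
    (n + a + b + 1) * Real.Gamma ((n + b + 2) / 2) * Real.Gamma ((n + a + 2) / 2)
        * ((n - 1) / 2).factorial
      / (2 * Real.Gamma ((n + a + b + 3) / 2) * poch ((a + 1) / 2) ((n + 1) / 2) ^ 2)

/-! ## Representations of `osp(1|2)` -/

/-- `ℓ²(ℤ₊)`. -/
abbrev Ell2 : Type := lp (fun _ : ℕ => ℂ) 2

/-- The Hilbert space tensor product `ℓ²(ℤ₊) ⊗ ℓ²(ℤ₊)`. -/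
abbrev Ell2Tensor : Type := UniformSpace.Completion (Ell2 ⊗[ℂ] Ell2)

/-- The space of finite linear combinations of the basis vectors `e_n` (`n = 0, 1, 2, …`), which
is the common invariant domain of the generators; `e_n` is `Finsupp.single n 1`. -/
abbrev FinSpan : Type := ℕ →₀ ℂ

/-- The basis vector `e_n`. -/
def bvec (n : ℕ) : FinSpan := Finsupp.single n 1

/-- `J_0 e_n = (n + μ + 1/2) e_n` in the representation `(μ, ε)`. -/
def repJ0 (μ : ℝ) : FinSpan →ₗ[ℂ] FinSpan :=
  Finsupp.linearCombination ℂ fun n => (((n : ℝ) + μ + 1 / 2 : ℝ) : ℂ) • bvec n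

/-- `R e_n = ε (-1)^n e_n` in the representation `(μ, ε)`. -/
def repR (ε : ℝ) : FinSpan →ₗ[ℂ] FinSpan :=
  Finsupp.linearCombination ℂ fun n => ((ε * (-1) ^ n : ℝ) : ℂ) • bvec n

/-- `J_+ e_n = [n+1]_μ^{1/2} e_{n+1}` in the representation `(μ, ε)`. -/
def repJplus (μ : ℝ) : FinSpan →ₗ[ℂ] FinSpan :=
  Finsupp.linearCombination ℂ fun n => ((√(muNumber (n + 1) μ) : ℝ) : ℂ) • bvec (n + 1)

/-- `J_- e_n = [n]_μ^{1/2} e_{n-1}` in the representation `(μ, ε)`; `J_- e_0 = 0` as `[0]_μ = 0`. -/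
def repJminus (μ : ℝ) : FinSpan →ₗ[ℂ] FinSpan :=
  Finsupp.linearCombination ℂ fun n => ((√(muNumber n μ) : ℝ) : ℂ) • bvec (n - 1)

/-- `Δ(J_0) = J_0 ⊗ 1 + 1 ⊗ J_0` on `(μ₁, ε₁) ⊗ (μ₂, ε₂)`. -/
def coprodJ0 (μ₁ μ₂ : ℝ) : FinSpan ⊗[ℂ] FinSpan →ₗ[ℂ] FinSpan ⊗[ℂ] FinSpan :=
  TensorProduct.map (repJ0 μ₁) LinearMap.id + TensorProduct.map LinearMap.id (repJ0 μ₂)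

/-- `Δ(R) = R ⊗ R` on `(μ₁, ε₁) ⊗ (μ₂, ε₂)`. -/
def coprodR (ε₁ ε₂ : ℝ) : FinSpan ⊗[ℂ] FinSpan →ₗ[ℂ] FinSpan ⊗[ℂ] FinSpan :=
  TensorProduct.map (repR ε₁) (repR ε₂)

/-- `Δ(J_+) = J_+ ⊗ R + 1 ⊗ J_+` on `(μ₁, ε₁) ⊗ (μ₂, ε₂)`. -/
def coprodJplus (μ₁ μ₂ ε₂ : ℝ) : FinSpan ⊗[ℂ] FinSpan →ₗ[ℂ] FinSpan ⊗[ℂ] FinSpan :=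
  TensorProduct.map (repJplus μ₁) (repR ε₂) + TensorProduct.map LinearMap.id (repJplus μ₂)

/-- `Δ(J_-) = J_- ⊗ R + 1 ⊗ J_-` on `(μ₁, ε₁) ⊗ (μ₂, ε₂)`. -/
def coprodJminus (μ₁ μ₂ ε₂ : ℝ) : FinSpan ⊗[ℂ] FinSpan →ₗ[ℂ] FinSpan ⊗[ℂ] FinSpan :=
  TensorProduct.map (repJminus μ₁) (repR ε₂) + TensorProduct.map LinearMap.id (repJminus μ₂)

/-- The inclusion of the finite linear combinations of the `e_n` in `ℓ²(ℤ₊)`. -/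
def inclEll2 : FinSpan →ₗ[ℂ] Ell2 :=
  Finsupp.linearCombination ℂ fun n => (lp.single 2 n (1 : ℂ) : Ell2)

/-- The inclusion of the finite linear combinations of the `e_{n₁} ⊗ e_{n₂}` in
`ℓ²(ℤ₊) ⊗ ℓ²(ℤ₊)`. -/
def incl (v : FinSpan ⊗[ℂ] FinSpan) : Ell2Tensor :=
  ((TensorProduct.map inclEll2 inclEll2 v : Ell2 ⊗[ℂ] Ell2) : Ell2Tensor)

/-- `μ₁₂ = μ₁ + μ₂ + j + 1/2`. -/
def mu12 (μ₁ μ₂ : ℝ) (j : ℕ) : ℝ := μ₁ + μ₂ + j + 1 / 2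

/-- `ε₁₂ = ε₁ ε₂ (-1)^j`. -/
def eps12 (ε₁ ε₂ : ℝ) (j : ℕ) : ℝ := ε₁ * ε₂ * (-1) ^ j

/-- `e j N` (`j, N = 0, 1, 2, …`) is the coupled basis `e_N^{(μ₁₂, ε₁₂)}` of
`(μ₁, ε₁) ⊗ (μ₂, ε₂) = ⨁_j (μ₁₂, ε₁₂)`: an orthonormal basis of the tensor product on which, for
each `j`, the generators act through the coproduct as in the representation `(μ₁₂, ε₁₂)`.
These conditions leave a phase free for each `j`. It is fixed, as for the Clebsch-Gordan
coefficients `(-1)^φ(n₁, n₂, j) …` with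
`φ = n₁(n₁-1)/2 + j(j+1)/2 + n₁(n₁+n₂+1)`, by the sign `(-1)^{j(j+1)/2}` of the coefficient of
`e_0 ⊗ e_j` in `e_0^{(μ₁₂, ε₁₂)}`. -/
structure IsCoupledBasis (μ₁ μ₂ ε₁ ε₂ : ℝ) (e : ℕ → ℕ → FinSpan ⊗[ℂ] FinSpan) : Prop where
  orthonormal : Orthonormal ℂ fun p : ℕ × ℕ => incl (e p.1 p.2)
  complete : (Submodule.span ℂ
    (Set.range fun p : ℕ × ℕ => incl (e p.1 p.2))).topologicalClosure = ⊤
  map_J0 : ∀ j N, coprodJ0 μ₁ μ₂ (e j N)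
    = (((N : ℝ) + mu12 μ₁ μ₂ j + 1 / 2 : ℝ) : ℂ) • e j N
  map_R : ∀ j N, coprodR ε₁ ε₂ (e j N) = ((eps12 ε₁ ε₂ j * (-1) ^ N : ℝ) : ℂ) • e j N
  map_Jplus : ∀ j N, coprodJplus μ₁ μ₂ ε₂ (e j N)
    = ((√(muNumber (N + 1) (mu12 μ₁ μ₂ j)) : ℝ) : ℂ) • e j (N + 1)
  map_Jminus : ∀ j N, coprodJminus μ₁ μ₂ ε₂ (e j N)
    = ((√(muNumber N (mu12 μ₁ μ₂ j)) : ℝ) : ℂ) • e j (N - 1)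
  phase : ∀ j, ∃ r : ℝ, 0 < r ∧
    ⟪incl (bvec 0 ⊗ₜ[ℂ] bvec j), incl (e j 0)⟫_ℂ = (((-1) ^ (j * (j + 1) / 2) * r : ℝ) : ℂ)

/-! ## The unitary map `Υ` -/

/-- `G = {(x₁, x₂) : |x₂| > |x₁| > |c|}`. -/
def regionG (c : ℝ) : Set (ℝ × ℝ) := {p | |c| < |p.1| ∧ |p.1| < |p.2|}

/-- The measure `W(x₁, μ₁, c ε₁) W(x₂, μ₂, x₁ ε₂) dx₁ dx₂` on `G`. -/
def measG (μ₁ μ₂ ε₁ ε₂ c : ℝ) : Measure (ℝ × ℝ) :=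
  (volume.restrict (regionG c)).withDensity fun p =>
    ENNReal.ofReal (chiharaWeight p.1 μ₁ (c * ε₁) * chiharaWeight p.2 μ₂ (p.1 * ε₂))

/-- `Υ` is the unitary map `ℓ²(ℤ₊) ⊗ ℓ²(ℤ₊) → L²(G, W W)` with
`Υ (e_{n₁} ⊗ e_{n₂}) = P_{n₁}(x₁; μ₁, c ε₁) P_{n₂}(x₂; μ₂, x₁ ε₂)`. -/
def IsUpsilon (μ₁ μ₂ ε₁ ε₂ c : ℝ)
    (Υ : Ell2Tensor ≃ₗᵢ[ℂ] Lp ℂ 2 (measG μ₁ μ₂ ε₁ ε₂ c)) : Prop :=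
  ∀ n₁ n₂ : ℕ, (Υ (incl (bvec n₁ ⊗ₜ[ℂ] bvec n₂)) : ℝ × ℝ → ℂ)
    =ᵐ[measG μ₁ μ₂ ε₁ ε₂ c] fun p =>
      ((chihara μ₁ (c * ε₁) p.1 n₁ * chihara μ₂ (p.1 * ε₂) p.2 n₂ : ℝ) : ℂ)

/-- The normalization `K_j(x₂; μ₂, μ₁; c)`, with the nonnegative square root. -/
def normK (μ₁ μ₂ ε₁ ε₂ c : ℝ) (j : ℕ) (x₂ : ℝ) : ℝ :=
  √(((x₂ ^ 2 - c ^ 2) / 2) ^ j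
    * ((x₂ - c * ε₁ * ε₂) / (x₂ - (-1) ^ j * c * ε₁ * ε₂))
    * (Real.Gamma (μ₁ + 1 / 2) * Real.Gamma (μ₂ + 1 / 2)
      / (Real.Gamma (mu12 μ₁ μ₂ j + 1 / 2) * jacobiNorm j (2 * μ₂) (2 * μ₁))))

end OspConvolution

end

open OspConvolution

noncomputable section

namespace OspConvolution

/-! ## Pochhammer symbols and `μ`-factorials -/

/-! The argument turns on the element `J_+ + J_- + cR`. Its coproduct is `(J_+ + J_- + cR) ⊗ R + 1 ⊗
(J_+ + J_-)`. In the polynomial model the first tensor factor acts as multiplication by `λ₁`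
(parameter `γ = c ε₁`), which leaves `J_+ + J_- + λ₁ R` in the second factor, and this is
multiplication by `λ₂` (parameter `γ = λ₁ ε₂`). So `Υ` turns the coproduct of this element into
multiplication by `λ₂` (`tensorEval_eq_snd_mul`). On the `j`-th summand the same element acts by the
three-term recurrence of the Chihara polynomials with parameters `(μ₁₂, c ε₁₂)`, hence `Υ e_N = P_N
Υ e_0` (`tensorEval_coupled`).

Being killed by `Δ(J_-)` is a two-term recursion for the coefficients of `e_0`; its solution is a
sign over square roots of `μ`-factorials (`cgCoeff`). Thus `Υ e_0` is, up to its norm, a signed sum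
of products of the rescaled polynomials `divChihara` at `τ = 1` (`lowSum`). In `τ` their generating
function is `exp(-τ u²/2)` times its value at `τ = 0`. A product of two of them carries `exp(-τ (u²
+ v²)/2)`, and the signs annihilate every multiple of `u² + v²`, so the signed sum does not depend
on `τ` (`sum_divChihara_const`). At `τ = 0` the polynomials are products of the factors `x ± γ`, and
the sum becomes two terminating `₂F₁`. Pfaff's transformation (`hypSum_pfaff`) and contiguous
relations carry these to the Big `-1` Jacobi polynomial; the norm is a Chu–Vandermonde sum
(`cgNorm_odd`, `cgNorm_even`).

`Υ` exists because it matches two Hilbert bases. The substitution `t = (x² - γ²)/2` carries the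
Chihara weight to a gamma distribution (`chiharaMeasure_map`), which gives orthonormality through
Laguerre polynomials. Completeness follows from exponential moments, by Fourier transform
(`ae_eq_zero_of_integral_pow_eq_zero`). The coupled basis is obtained by raising the lowest weight
vectors. It spans by induction on the degree (`bvec_mem_span`), and it is unique because the lowest
weight spaces are lines (`exists_eq_smul_cgVec`) on which norm and phase fix the vector. -/

@[simp] lemma poch_zero (x : ℝ) : poch x 0 = 1 := by simp [poch]

lemma poch_succ (x : ℝ) (k : ℕ) : poch x (k + 1) = poch x k * (x + k) := by
  simp [poch, ascPochhammer_succ_eval]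

lemma poch_succ_left (x : ℝ) (k : ℕ) : poch x (k + 1) = x * poch (x + 1) k := by
  simp [poch, ascPochhammer_succ_left]

lemma poch_pos {x : ℝ} (hx : 0 < x) (k : ℕ) : 0 < poch x k := ascPochhammer_pos k x hx

lemma Gamma_add_nat {x : ℝ} (hx : 0 < x) (k : ℕ) :
    Real.Gamma (x + k) = poch x k * Real.Gamma x := by
  induction k with
  | zero => simp
  | succ k ih =>
    rw [poch_succ, Nat.cast_succ, ← add_assoc, Real.Gamma_add_one (by positivity), ih]
    ring

/-- Reversing the factors of the first symbol gives `(-1)^i (x + k)_i`, which continues `(x)_k` to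
`(x)_{k+i}`. -/
lemma poch_reflect (x : ℝ) (k i : ℕ) :
    poch (1 - x - (k + i : ℕ)) i * poch x k = (-1) ^ i * poch x (k + i) := by
  induction i with
  | zero => simp
  | succ i ih =>
    rw [poch_succ_left, show 1 - x - ((k + (i + 1) : ℕ) : ℝ) + 1 = 1 - x - (k + i : ℕ) by
      push_cast; ring, mul_assoc, ih, ← add_assoc, poch_succ]
    push_cast
    ring

@[simp] lemma muNumber_zero (μ : ℝ) : muNumber 0 μ = 0 := by simp [muNumber]

lemma muNumber_one (μ : ℝ) : muNumber 1 μ = 1 + 2 * μ := by norm_num [muNumber]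

lemma muNumber_add_two (n : ℕ) (μ : ℝ) : muNumber (n + 2) μ = muNumber n μ + 2 := by
  simp [muNumber, pow_succ]; ring

/-- The relation `J_- J_+ + J_+ J_- = 2 J_0`, read off on `e_n`. -/
lemma muNumber_add_succ (n : ℕ) (μ : ℝ) :
    muNumber (n + 1) μ + muNumber n μ = 2 * (n + μ + 1 / 2) := by
  simp [muNumber, pow_succ]; ring

lemma muNumber_even (k : ℕ) (μ : ℝ) : muNumber (2 * k) μ = 2 * k := by
  simp [muNumber]

lemma muNumber_odd (k : ℕ) (μ : ℝ) : muNumber (2 * k + 1) μ = 2 * (μ + 1 / 2 + k) := by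
  simp [muNumber, pow_succ]; ring

lemma muNumber_nonneg (n : ℕ) {μ : ℝ} (hμ : 0 < μ) : 0 ≤ muNumber n μ := by
  rcases Nat.even_or_odd' n with ⟨k, rfl | rfl⟩
  · rw [muNumber_even]; positivity
  · rw [muNumber_odd]; positivity

lemma muNumber_succ_pos (n : ℕ) {μ : ℝ} (hμ : 0 < μ) : 0 < muNumber (n + 1) μ := by
  rcases Nat.even_or_odd' n with ⟨k, rfl | rfl⟩
  · rw [muNumber_odd]; positivity
  · rw [show 2 * k + 1 + 1 = 2 * (k + 1) by ring, muNumber_even]; positivity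

/-- The `μ`-factorial `[n]_μ! = [1]_μ ⋯ [n]_μ`. -/
def muFact (μ : ℝ) : ℕ → ℝ
  | 0 => 1
  | n + 1 => muFact μ n * muNumber (n + 1) μ

lemma muFact_pos {μ : ℝ} (hμ : 0 < μ) (n : ℕ) : 0 < muFact μ n := by
  induction n with
  | zero => simp [muFact]
  | succ n ih => exact mul_pos ih (muNumber_succ_pos n hμ)

lemma muFact_even_odd (μ : ℝ) (k : ℕ) :
    muFact μ (2 * k) = 4 ^ k * k.factorial * poch (μ + 1 / 2) k ∧
    muFact μ (2 * k + 1) = 2 * 4 ^ k * k.factorial * poch (μ + 1 / 2) (k + 1) := by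
  induction k with
  | zero => simp [muFact, muNumber_one, poch_succ]; ring
  | succ k ih =>
    have h : muFact μ (2 * (k + 1))
        = 4 ^ (k + 1) * (k + 1).factorial * poch (μ + 1 / 2) (k + 1) := by
      rw [show 2 * (k + 1) = 2 * k + 1 + 1 by ring, muFact, ih.2,
        show 2 * k + 1 + 1 = 2 * (k + 1) by ring, muNumber_even, Nat.factorial_succ]
      push_cast
      ring
    refine ⟨h, ?_⟩
    rw [muFact, h, muNumber_odd, poch_succ _ (k + 1)]
    ring

lemma muFact_even (μ : ℝ) (k : ℕ) :
    muFact μ (2 * k) = 4 ^ k * k.factorial * poch (μ + 1 / 2) k := (muFact_even_odd μ k).1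

lemma muFact_odd (μ : ℝ) (k : ℕ) :
    muFact μ (2 * k + 1) = 2 * 4 ^ k * k.factorial * poch (μ + 1 / 2) (k + 1) :=
  (muFact_even_odd μ k).2

/-! ## The Specialized Chihara polynomials -/

/-- At `n = 0` the truncated index `n - 1` is `0`; the factor `[0]_μ = 0` does the work of `P_{-1} =
0`. -/
lemma mul_chihara {μ : ℝ} (hμ : 0 < μ) (γ x : ℝ) (n : ℕ) :
    x * chihara μ γ x n = √(muNumber (n + 1) μ) * chihara μ γ x (n + 1)
      + γ * (-1) ^ n * chihara μ γ x n + √(muNumber n μ) * chihara μ γ x (n - 1) := by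
  have h := fun n => (Real.sqrt_pos.2 (muNumber_succ_pos n hμ)).ne'
  cases n with
  | zero =>
    have := h 0
    simp only [zero_add] at this
    simp only [chihara, muNumber_zero]
    field_simp
    simp
  | succ n =>
    have := h (n + 1)
    simp only [chihara, Nat.add_sub_cancel]
    field_simp
    ring

/-- Divided powers of a one-parameter deformation of the Specialized Chihara polynomials. At
`τ = 1` these are rescaled Chihara polynomials; at `τ = 0` they are products of linear factors. -/
def divChihara (μ γ x τ : ℝ) : ℕ → ℝ
  | 0 => 1
  | 1 => (x - γ) / muNumber 1 μ
  | n + 2 => ((x - γ * (-1) ^ (n + 1)) * divChihara μ γ x τ (n + 1)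
      - τ * divChihara μ γ x τ n) / muNumber (n + 2) μ

lemma chihara_eq_divChihara {μ : ℝ} (hμ : 0 < μ) (γ x : ℝ) (n : ℕ) :
    chihara μ γ x n = √(muFact μ n) * divChihara μ γ x 1 n := by
  induction n using Nat.twoStepInduction with
  | zero => simp [chihara, divChihara, muFact]
  | one =>
    have h1 := muNumber_succ_pos 0 hμ
    simp only [zero_add] at h1
    have := Real.sqrt_pos.2 h1
    simp only [chihara, divChihara, muFact, one_mul, zero_add]
    rw [mul_div_assoc', div_eq_div_iff this.ne' h1.ne']
    nth_rw 1 [← Real.mul_self_sqrt h1.le]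
    ring
  | more n ih1 ih2 =>
    have h1 := muNumber_succ_pos n hμ
    have h2 := muNumber_succ_pos (n + 1) hμ
    have s2 := Real.sqrt_pos.2 h2
    have f := muFact_pos hμ n
    simp only [chihara, divChihara, muFact]
    rw [ih1, ih2, muFact, Real.sqrt_mul (x := muFact μ n * _) (by positivity),
      Real.sqrt_mul f.le, mul_div_assoc', div_eq_div_iff s2.ne' h2.ne']
    have e1 := Real.mul_self_sqrt h1.le
    have e2 := Real.mul_self_sqrt h2.le
    simp only [add_assoc, Nat.reduceAdd] at e1 e2 ⊢
    linear_combination -√(muFact μ n) * √(muNumber (n + 1) μ) *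
      ((x - γ * (-1) ^ (n + 1)) * divChihara μ γ x 1 (n + 1) - divChihara μ γ x 1 n) * e2

/-- Coefficientwise, this says that the generating function depends on `τ` through the factor
`exp(-τ u²/2)`. In the inductive step the recurrence collects the differentiated terms into `-(1/2)
[n+2] D_{n+2}`, where `D` denotes the polynomials, the explicit `τ` contributes `-D_{n+2}`, and
`[n+4] = [n+2] + 2`. -/
lemma divChihara_hasDerivAt {μ : ℝ} (hμ : 0 < μ) (γ x τ : ℝ) (n : ℕ) :
    HasDerivAt (fun τ => divChihara μ γ x τ (n + 2)) (-(1 / 2) * divChihara μ γ x τ n) τ := by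
  induction n using Nat.twoStepInduction with
  | zero =>
    simp only [divChihara, zero_add]
    have h2 : muNumber 2 μ = 2 := by norm_num [muNumber]
    rw [h2]
    have := (((hasDerivAt_id τ).mul_const (1 : ℝ)).const_sub
      ((x - γ * (-1) ^ 1) * ((x - γ) / muNumber 1 μ))).div_const 2
    exact this.congr_deriv (by norm_num)
  | one =>
    simp only [divChihara, zero_add, Nat.reduceAdd]
    have h1 := muNumber_succ_pos 0 hμ
    have h3 := muNumber_succ_pos 2 hμ
    have e3 := muNumber_add_two 1 μ
    simp only [zero_add, Nat.reduceAdd] at h1 h3 e3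
    have h2 : muNumber 2 μ = 2 := by norm_num [muNumber]
    rw [h2]
    have a := (((hasDerivAt_id τ).mul_const (1 : ℝ)).const_sub
      ((x - γ * (-1) ^ 1) * ((x - γ) / muNumber 1 μ))).div_const 2
    have := ((a.const_mul (x - γ * (-1) ^ (1 + 1))).sub
      ((hasDerivAt_id τ).mul_const ((x - γ) / muNumber 1 μ))).div_const (muNumber 3 μ)
    refine this.congr_deriv ?_
    rw [e3] at h3 ⊢
    field_simp
    ring
  | more n ih1 ih2 =>
    have h2 := muNumber_succ_pos (n + 1) hμ
    have h4 := muNumber_succ_pos (n + 3) hμ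
    have e := muNumber_add_two (n + 2) μ
    have := ((ih2.const_mul (x - γ * (-1) ^ (n + 3))).sub
      ((hasDerivAt_id τ).mul ih1)).div_const (muNumber (n + 4) μ)
    refine this.congr_deriv ?_
    rw [divChihara.eq_3 _ _ _ _ n]
    simp only [id]
    simp only [add_assoc, Nat.reduceAdd] at h2 h4 e ⊢
    rw [e] at h4 ⊢
    rw [show (-1 : ℝ) ^ (n + 3) = (-1) ^ (n + 1) by ring]
    field_simp
    ring

/-- Without the `τ` term the recurrence is of first order, and the factors `x - γ` and `x + γ`
alternate. -/
lemma divChihara_zero_even_odd (μ γ x : ℝ) (hμ : 0 < μ) (k : ℕ) :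
    divChihara μ γ x 0 (2 * k) = (x ^ 2 - γ ^ 2) ^ k / muFact μ (2 * k) ∧
    divChihara μ γ x 0 (2 * k + 1)
      = (x - γ) * (x ^ 2 - γ ^ 2) ^ k / muFact μ (2 * k + 1) := by
  induction k with
  | zero => simp [divChihara, muFact]
  | succ k ih =>
    have h : divChihara μ γ x 0 (2 * (k + 1))
        = (x ^ 2 - γ ^ 2) ^ (k + 1) / muFact μ (2 * (k + 1)) := by
      rw [show 2 * (k + 1) = 2 * k + 2 by ring, divChihara, ih.1, ih.2,
        show muFact μ (2 * k + 2) = muFact μ (2 * k) * muNumber (2 * k + 1) μ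
          * muNumber (2 * k + 1 + 1) μ from rfl,
        show muFact μ (2 * k + 1) = muFact μ (2 * k) * muNumber (2 * k + 1) μ from rfl]
      have := (muNumber_succ_pos (2 * k + 1) hμ).ne'
      have := (muNumber_succ_pos (2 * k) hμ).ne'
      have := (muFact_pos hμ (2 * k)).ne'
      have : (-1 : ℝ) ^ (2 * k + 1) = -1 := by simp [pow_succ]
      rw [this]
      field_simp
      ring
    refine ⟨h, ?_⟩
    rw [show 2 * (k + 1) + 1 = (2 * k + 1) + 2 by ring, divChihara,
      show 2 * k + 1 + 1 = 2 * (k + 1) by ring, h, muFact,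
      show 2 * k + 1 + 1 = 2 * (k + 1) by ring]
    have := (muFact_pos hμ (2 * (k + 1))).ne'
    have := (muNumber_succ_pos (2 * (k + 1)) hμ).ne'
    have e : (-1 : ℝ) ^ (2 * (k + 1)) = 1 := by simp
    rw [show 2 * k + 1 + 2 = 2 * (k + 1) + 1 by ring, e]
    field_simp
    ring

/-- Reproducing kernels of lowest weight vectors in the tensor product. -/
lemma sum_divChihara_const {μ₁ μ₂ : ℝ} (h₁ : 0 < μ₁) (h₂ : 0 < μ₂) (γ x δ y : ℝ) (s : ℕ × ℕ → ℝ)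
    (hs : ∀ n m, s (n + 2, m) + s (n, m + 2) = 0) (j : ℕ) (τ τ' : ℝ) :
    ∑ p ∈ Finset.HasAntidiagonal.antidiagonal j, s p * (divChihara μ₁ γ x τ p.1 * divChihara μ₂ δ y τ p.2)
      = ∑ p ∈ Finset.HasAntidiagonal.antidiagonal j,
        s p * (divChihara μ₁ γ x τ' p.1 * divChihara μ₂ δ y τ' p.2) := by
  let D (μ γ x τ : ℝ) (n : ℕ) : ℝ := match n with
    | 0 => 0
    | 1 => 0
    | n + 2 => -(1 / 2) * divChihara μ γ x τ n
  have hD : ∀ {μ : ℝ} (_ : 0 < μ) (γ x τ : ℝ) (n : ℕ),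
      HasDerivAt (fun τ => divChihara μ γ x τ n) (D μ γ x τ n) τ := by
    intro μ hμ γ x τ n
    match n with
    | 0 => simpa [divChihara, D] using hasDerivAt_const τ (1 : ℝ)
    | 1 => simpa [divChihara, D] using hasDerivAt_const τ ((x - γ) / muNumber 1 μ)
    | n + 2 => exact divChihara_hasDerivAt hμ γ x τ n
  have key : ∀ τ, HasDerivAt (fun τ => ∑ p ∈ Finset.HasAntidiagonal.antidiagonal j,
      s p * (divChihara μ₁ γ x τ p.1 * divChihara μ₂ δ y τ p.2)) 0 τ := by
    intro τ
    have := HasDerivAt.fun_sum (u := Finset.HasAntidiagonal.antidiagonal j) fun p _ =>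
      ((hD h₁ γ x τ p.1).mul (hD h₂ δ y τ p.2)).const_mul (s p)
    refine this.congr_deriv ?_
    simp only [mul_add, Finset.sum_add_distrib]
    match j with
    | 0 => simp [D]
    | 1 => simp [D, Finset.Nat.antidiagonal_succ]
    | j + 2 =>
      -- One half of the product rule needs a first index at least `2`, the other a second index at
      -- least `2`. After shifting, both run over `n + m = j` and pair up with coefficient `s (n +
      -- 2, m) + s (n, m + 2) = 0`.
      rw [Finset.Nat.sum_antidiagonal_succ, Finset.Nat.sum_antidiagonal_succ,
        Finset.Nat.sum_antidiagonal_succ' (n := j + 1), Finset.Nat.sum_antidiagonal_succ']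
      simp only [D, zero_add, zero_mul, mul_zero, add_assoc, Nat.reduceAdd]
      rw [← Finset.sum_add_distrib, Finset.sum_eq_zero]
      intro p _
      linear_combination -(1 / 2) * divChihara μ₁ γ x τ p.1 * divChihara μ₂ δ y τ p.2 * hs p.1 p.2
  exact is_const_of_deriv_eq_zero (fun τ => (key τ).differentiableAt) (fun τ => (key τ).deriv) τ τ'

/-! ## Terminating hypergeometric sums -/

/-- The homogeneous form `∑ i, C(m, i) (d)_i / (g)_i t^i s^{m-i}` of a terminating `₂F₁`. -/
def hypSum : ℕ → ℝ → ℝ → ℝ → ℝ → ℝ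
  | 0, _, _, _, _ => 1
  | m + 1, d, g, t, s => s * hypSum m d g t s + d / g * t * hypSum m (d + 1) (g + 1) t s

/-- Pascal's rule splits the sum of order `m + 1` in two, and `(d)_{i+1} = d (d + 1)_i` makes the
second half a sum with shifted parameters. -/
lemma hypSum_eq (m : ℕ) (d t s : ℝ) {g : ℝ} (hg : 0 < g) :
    hypSum m d g t s = ∑ p ∈ Finset.HasAntidiagonal.antidiagonal m,
      (m.choose p.1 : ℝ) * (poch d p.1 / poch g p.1 * t ^ p.1 * s ^ p.2) := by
  induction m generalizing d g with
  | zero => simp [hypSum]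
  | succ m ih =>
    rw [hypSum, ih d hg, ih (d + 1) (by positivity), Finset.sum_antidiagonal_choose_succ_mul
      (fun i k => poch d i / poch g i * t ^ i * s ^ k), Finset.mul_sum, Finset.mul_sum]
    congr 1
    · refine Finset.sum_congr rfl fun p _ => ?_
      ring
    · refine Finset.sum_congr rfl fun p hp => ?_
      rw [poch_succ_left, poch_succ_left, Nat.choose_symm_of_eq_add
        (Finset.HasAntidiagonal.mem_antidiagonal.1 hp).symm, mul_div_mul_comm]
      ring

/-- True term by term: over the common denominator `(g + 1)_i` the coefficient is `(d)_i ((g + i) -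
(g - d)) = d (d + 1)_i`. -/
lemma hypSum_contiguous (m : ℕ) (d t s : ℝ) {g : ℝ} (hg : 0 < g) :
    g * hypSum m d g t s - (g - d) * hypSum m d (g + 1) t s = d * hypSum m (d + 1) (g + 1) t s := by
  induction m generalizing d g with
  | zero => simp [hypSum]
  | succ m ih =>
    have h1 := ih d hg
    have h2 := ih (d + 1) (g := g + 1) (by positivity)
    simp only [hypSum]
    have : g + 1 ≠ 0 := by positivity
    have e : hypSum m (d + 1) (g + 1) t s
        = ((g - d) * hypSum m (d + 1) (g + 1 + 1) t s
          + (d + 1) * hypSum m (d + 1 + 1) (g + 1 + 1) t s) / (g + 1) := by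
      field_simp
      linear_combination h2
    field_simp
    linear_combination s * (g + 1) * h1 + d * t * h2

/-- Pfaff's transformation. -/
lemma hypSum_pfaff (m : ℕ) (b t s : ℝ) {g : ℝ} (hg : 0 < g) :
    hypSum m b g (-t) (s + t) = hypSum m (g - b) g t s := by
  induction m generalizing b g with
  | zero => simp [hypSum]
  | succ m ih =>
    -- The two recursions share their `s` terms; their `t` terms agree by the contiguous relation at
    -- `d = g - b`.
    have h := hypSum_contiguous m (g - b) t s hg
    rw [hypSum, ih b hg, ih (b + 1) (by positivity), hypSum,
      show g + 1 - (b + 1) = g - b by ring]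
    field_simp
    linear_combination t * h

lemma mul_pow_hypSum (m : ℕ) (d g t s w : ℝ) :
    w ^ m * hypSum m d g t s = hypSum m d g (w * t) (w * s) := by
  induction m generalizing d g with
  | zero => simp [hypSum]
  | succ m ih => rw [hypSum, hypSum, ← ih, ← ih]; ring

lemma hypSum_zero_right (m : ℕ) (d t : ℝ) {g : ℝ} (hg : 0 < g) :
    hypSum m d g t 0 = t ^ m * poch d m / poch g m := by
  induction m generalizing d g with
  | zero => simp [hypSum]
  | succ m ih =>
    rw [hypSum, ih (d + 1) (by positivity), poch_succ_left, poch_succ_left]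
    have := poch_pos (x := g + 1) (by positivity) m
    field_simp
    ring

lemma poch_neg_nat (k i : ℕ) :
    poch (-((i + k : ℕ) : ℝ)) i * k.factorial = (-1) ^ i * (i + k).factorial := by
  induction i with
  | zero => simp
  | succ i ih =>
    rw [poch_succ_left, show -((i + 1 + k : ℕ) : ℝ) + 1 = -((i + k : ℕ) : ℝ) by push_cast; ring,
      mul_assoc, ih, show i + 1 + k = i + k + 1 by ring, Nat.factorial_succ]
    push_cast
    ring

/-- Since `(-m)_i / i! = (-1)^i C(m, i)`, which is `0` for `i > m`, the series is a finite sum and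
no condition on `z` is needed. -/
lemma ordinaryHypergeometric_neg_nat (m : ℕ) (b z : ℝ) {g : ℝ} (hg : 0 < g) :
    ₂F₁ (-(m : ℝ)) b g z = hypSum m b g (-z) 1 := by
  rw [hypSum_eq m b _ _ hg, ordinaryHypergeometric_eq_tsum]
  beta_reduce
  rw [tsum_eq_sum (s := Finset.range (m + 1)), Finset.Nat.sum_antidiagonal_eq_sum_range_succ_mk]
  · refine Finset.sum_congr rfl fun i hi => ?_
    obtain ⟨k, rfl⟩ := Nat.exists_eq_add_of_le (Nat.lt_succ_iff.1 (Finset.mem_range.1 hi))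
    have h := poch_neg_nat k i
    have hk : (k.factorial : ℝ) ≠ 0 := by positivity
    have h' : (Polynomial.eval (-((i + k : ℕ) : ℝ)) (ascPochhammer ℝ i))
        = (-1) ^ i * (i + k).factorial / k.factorial := by
      rw [eq_div_iff hk]; exact h
    simp only [smul_eq_mul]
    rw [h', Nat.choose_symm_add, Nat.add_choose, Nat.cast_div (Nat.factorial_mul_factorial_dvd_factorial_add i k)
      (by positivity)]
    have := (poch_pos hg i).ne'
    simp only [poch] at this ⊢
    push_cast
    field_simp
    ring
  · intro i hi
    have : m < i := by simpa using hi
    have h0 : Polynomial.eval (-(m : ℝ)) (ascPochhammer ℝ i) = 0 := by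
      rw [ascPochhammer_eval_eq_zero_iff]
      exact ⟨m, this, by simp⟩
    simp [h0]

/-! ## Lowest weight vectors -/

lemma sum_antidiagonal_odd (f : ℕ × ℕ → ℝ) (m : ℕ) :
    ∑ p ∈ Finset.HasAntidiagonal.antidiagonal (2 * m + 1), f p
      = ∑ p ∈ Finset.HasAntidiagonal.antidiagonal m,
        (f (2 * p.1, 2 * p.2 + 1) + f (2 * p.1 + 1, 2 * p.2)) := by
  induction m generalizing f with
  | zero => simp [Finset.Nat.antidiagonal_succ]
  | succ m ih =>
    rw [show 2 * (m + 1) + 1 = 2 * m + 1 + 1 + 1 by ring, Finset.Nat.sum_antidiagonal_succ,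
      Finset.Nat.sum_antidiagonal_succ, ih (fun p => f (p.1 + 1 + 1, p.2)),
      Finset.Nat.sum_antidiagonal_succ]
    simp only [mul_add, mul_zero, zero_add, mul_one, add_assoc, Nat.reduceAdd]

lemma sum_antidiagonal_even (f : ℕ × ℕ → ℝ) (m : ℕ) :
    ∑ p ∈ Finset.HasAntidiagonal.antidiagonal (2 * (m + 1)), f p
      = ∑ p ∈ Finset.HasAntidiagonal.antidiagonal (m + 1), f (2 * p.1, 2 * p.2)
        + ∑ p ∈ Finset.HasAntidiagonal.antidiagonal m, f (2 * p.1 + 1, 2 * p.2 + 1) := by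
  rw [show 2 * (m + 1) = 2 * m + 1 + 1 by ring, Finset.Nat.sum_antidiagonal_succ,
    sum_antidiagonal_odd (fun p => f (p.1 + 1, p.2)), Finset.Nat.sum_antidiagonal_succ,
    Finset.sum_add_distrib]
  simp only [mul_add, mul_zero, mul_one, add_assoc, Nat.reduceAdd]
  ring

/-- The alternating sum `∑ (-1)^i s^k t^i / (k! i! (α)_k (β)_i)` over `k + i = m`. -/
def altSum (m : ℕ) (α β s t : ℝ) : ℝ :=
  ∑ p ∈ Finset.HasAntidiagonal.antidiagonal m, (-1) ^ p.2 * (s ^ p.1 * t ^ p.2)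
    / (p.1.factorial * p.2.factorial * poch α p.1 * poch β p.2)

/-- By reflection `1 / (α)_k = (-1)^i (1 - α - m)_i / (α)_m` when `k + i = m`; the factorials form a
binomial coefficient. -/
lemma altSum_eq (m : ℕ) {α β : ℝ} (s t : ℝ) (hα : 0 < α) (hβ : 0 < β) :
    altSum m α β s t = hypSum m (1 - α - m) β t s / (m.factorial * poch α m) := by
  rw [hypSum_eq m _ _ _ hβ, altSum, ← Finset.Nat.sum_antidiagonal_swap, Finset.sum_div]
  refine Finset.sum_congr rfl fun ⟨i, k⟩ hp => ?_
  obtain rfl := Finset.HasAntidiagonal.mem_antidiagonal.1 hp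
  have h := poch_reflect α k i
  rw [add_comm k i] at h
  have hk := (poch_pos hα k).ne'
  have hn := (poch_pos hα (i + k)).ne'
  have hi := (poch_pos hβ i).ne'
  have h' : poch (1 - α - (i + k : ℕ)) i = (-1) ^ i * poch α (i + k) / poch α k := by
    rw [eq_div_iff hk, h]
  simp only [Prod.swap]
  rw [h', Nat.choose_symm_add, Nat.add_choose,
    Nat.cast_div (Nat.factorial_mul_factorial_dvd_factorial_add i k) (by positivity)]
  push_cast
  field_simp

/-- Chu–Vandermonde: at `s = 1`, `t = -1` Pfaff's transformation has `s + t = 0`, so only the top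
term survives. At this point all the terms of `altSum` are positive, as in the norm. -/
lemma altSum_one_neg_one (m : ℕ) {α β : ℝ} (hα : 0 < α) (hβ : 0 < β) :
    altSum m α β 1 (-1) = poch (α + β + m - 1) m / (m.factorial * poch α m * poch β m) := by
  have h := hypSum_pfaff m (α + β + m - 1) (-1) 1 hβ
  rw [altSum_eq m _ _ hα hβ, show 1 - α - m = β - (α + β + m - 1) by ring, ← h,
    neg_neg, add_neg_cancel, hypSum_zero_right _ _ _ hβ]
  have := (poch_pos hα m).ne'
  have := (poch_pos hβ m).ne'
  field_simp
  simp

lemma altSum_half (m : ℕ) {α β : ℝ} (s t : ℝ) (hα : 0 < α) (hβ : 0 < β) :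
    altSum m α β (s / 2) (t / 2)
      = hypSum m (1 - α - m) β t s / (2 ^ m * m.factorial * poch α m) := by
  rw [altSum_eq _ _ _ hα hβ, show t / 2 = 2⁻¹ * t by ring, show s / 2 = 2⁻¹ * s by ring,
    ← mul_pow_hypSum]
  have := (poch_pos hα m).ne'
  field_simp
  rw [mul_right_comm, ← mul_pow]
  norm_num

/-- The sign of the Clebsch-Gordan coefficient of `e_n ⊗ e_m` in a lowest weight vector. -/
def cgSign (ε : ℝ) (p : ℕ × ℕ) : ℝ := ε ^ p.1 * (-1) ^ (p.2 * (p.2 + 1) / 2)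

lemma triangle_succ (m : ℕ) : (m + 1) * (m + 1 + 1) / 2 = m * (m + 1) / 2 + (m + 1) := by
  rw [show (m + 1) * (m + 1 + 1) = m * (m + 1) + (m + 1) * 2 by ring,
    Nat.add_mul_div_right _ _ (by norm_num)]

/-- The triangular numbers of `m` and `m + 2` differ by the odd number `2m + 3`. This is the
cancellation required by `sum_divChihara_const`. -/
lemma cgSign_add_two {ε : ℝ} (hε : ε ^ 2 = 1) (n m : ℕ) :
    cgSign ε (n + 2, m) + cgSign ε (n, m + 2) = 0 := by
  have : (-1 : ℝ) ^ ((m + 1 + 1) * (m + 1 + 1 + 1) / 2) = -(-1) ^ (m * (m + 1) / 2) := by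
    rw [triangle_succ, triangle_succ, add_assoc, pow_add,
      show m + 1 + (m + 1 + 1) = 2 * (m + 1) + 1 by ring]
    simp [pow_succ]
  simp only [cgSign, pow_add, hε]
  rw [show m + 2 = m + 1 + 1 by rfl, this]
  ring

lemma triangle_sign (i : ℕ) : (-1 : ℝ) ^ (2 * i * (2 * i + 1) / 2) = (-1) ^ i ∧
    (-1 : ℝ) ^ ((2 * i + 1) * (2 * i + 1 + 1) / 2) = -(-1) ^ i := by
  have : (-1 : ℝ) ^ (2 * i * (2 * i + 1) / 2) = (-1) ^ i := by
    rw [mul_assoc, Nat.mul_div_cancel_left _ (by norm_num), mul_add, ← mul_assoc,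
      mul_comm i 2, mul_assoc, pow_add, pow_mul]
    simp
  refine ⟨this, ?_⟩
  rw [triangle_succ, pow_add, this, pow_add, pow_mul]
  simp

lemma cgSign_sq {ε : ℝ} (hε : ε ^ 2 = 1) (p : ℕ × ℕ) : cgSign ε p ^ 2 = 1 := by
  rw [cgSign, mul_pow, ← pow_mul, ← pow_mul, mul_comm p.1, pow_mul, hε,
    mul_comm _ 2, pow_mul (-1 : ℝ)]
  simp

/-- The squared norm of the unnormalized lowest weight vector of degree `j`. -/
def cgNorm (μ₁ μ₂ : ℝ) (j : ℕ) : ℝ :=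
  ∑ p ∈ Finset.HasAntidiagonal.antidiagonal j, 1 / (muFact μ₁ p.1 * muFact μ₂ p.2)

lemma cgNorm_pos {μ₁ μ₂ : ℝ} (h₁ : 0 < μ₁) (h₂ : 0 < μ₂) (j : ℕ) : 0 < cgNorm μ₁ μ₂ j := by
  refine Finset.sum_pos (fun p _ => ?_) ⟨(0, j), by simp⟩
  have := muFact_pos h₁ p.1
  have := muFact_pos h₂ p.2
  positivity

/-- The polynomial, up to normalization, attached to the lowest weight vector of degree `j`. -/
def lowSum (μ₁ μ₂ ε γ x y : ℝ) (j : ℕ) : ℝ :=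
  ∑ p ∈ Finset.HasAntidiagonal.antidiagonal j,
    cgSign ε p * (divChihara μ₁ γ x 1 p.1 * divChihara μ₂ (x * ε) y 1 p.2)

/-- Exactly one of the two indices is odd. Each case is a Chu–Vandermonde sum; over the common
denominator they contribute the factors `α + m` and `β + m`, where `α = μ₁ + 1/2` and `β = μ₂ +
1/2`. Their sum `α + β + 2m` is the last factor of `(α + β + m)_{m+1}`. -/
lemma cgNorm_odd {μ₁ μ₂ : ℝ} (h₁ : 0 < μ₁) (h₂ : 0 < μ₂) (m : ℕ) :
    cgNorm μ₁ μ₂ (2 * m + 1)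
    = poch (μ₁ + 1 / 2 + (μ₂ + 1 / 2) + m) (m + 1) / (2 * 4 ^ m * m.factorial
      * poch (μ₁ + 1 / 2) (m + 1) * poch (μ₂ + 1 / 2) (m + 1)) := by
  obtain ⟨α, hα⟩ : ∃ α, α = μ₁ + 1 / 2 := ⟨_, rfl⟩
  obtain ⟨β, hβ⟩ : ∃ β, β = μ₂ + 1 / 2 := ⟨_, rfl⟩
  have ha : 0 < α := by rw [hα]; positivity
  have hb : 0 < β := by rw [hβ]; positivity
  have : cgNorm μ₁ μ₂ (2 * m + 1) = altSum m α (β + 1) 1 (-1) / (2 * 4 ^ m * β)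
      + altSum m (α + 1) β 1 (-1) / (2 * 4 ^ m * α) := by
    rw [cgNorm, sum_antidiagonal_odd, Finset.sum_add_distrib]
    simp only [muFact_even, muFact_odd, altSum, Finset.sum_div, ← hα, ← hβ]
    congr 1 <;> refine Finset.sum_congr rfl fun p hp => ?_ <;>
      obtain rfl := Finset.HasAntidiagonal.mem_antidiagonal.1 hp <;>
      · have := (poch_pos ha p.1).ne'
        have := (poch_pos hb p.2).ne'
        have := (poch_pos (x := α + 1) (by positivity) p.1).ne'
        have := (poch_pos (x := β + 1) (by positivity) p.2).ne'
        simp only [poch_succ_left, one_pow, one_mul, ← mul_pow, neg_mul, mul_neg, neg_neg, pow_add]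
        field_simp
  rw [this, altSum_one_neg_one m ha (by positivity), altSum_one_neg_one m (by positivity) hb,
    ← hα, ← hβ, show α + (β + 1) + m - 1 = α + β + m by ring,
    show α + 1 + β + m - 1 = α + β + m by ring, poch_succ (α + β + m)]
  have e1 := poch_succ α m
  have e2 := poch_succ β m
  rw [poch_succ_left α] at e1 ⊢
  rw [poch_succ_left β] at e2 ⊢
  have := (poch_pos ha m).ne'
  have := (poch_pos hb m).ne'
  have := (poch_pos (x := α + 1) (by positivity) m).ne'
  have := (poch_pos (x := β + 1) (by positivity) m).ne'
  have f1 : poch α m = α * poch (α + 1) m / (α + m) := by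
    rw [eq_div_iff (by positivity), e1]
  have f2 : poch β m = β * poch (β + 1) m / (β + m) := by
    rw [eq_div_iff (by positivity), e2]
  have : α + (m : ℝ) ≠ 0 := by positivity
  have : β + (m : ℝ) ≠ 0 := by positivity
  rw [f1, f2]
  field_simp
  ring

/-- Both indices are even or both are odd. With `M = m + 1` the two Chu–Vandermonde sums contribute
`α + β + M - 1` and `M`, whose sum completes `(α + β + M)_M`. -/
lemma cgNorm_even {μ₁ μ₂ : ℝ} (h₁ : 0 < μ₁) (h₂ : 0 < μ₂) (m : ℕ) :
    cgNorm μ₁ μ₂ (2 * m)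
    = poch (μ₁ + 1 / 2 + (μ₂ + 1 / 2) + m) m / (4 ^ m * m.factorial
      * poch (μ₁ + 1 / 2) m * poch (μ₂ + 1 / 2) m) := by
  cases m with
  | zero => simp [cgNorm, muFact]
  | succ m =>
    obtain ⟨α, hα⟩ : ∃ α, α = μ₁ + 1 / 2 := ⟨_, rfl⟩
    obtain ⟨β, hβ⟩ : ∃ β, β = μ₂ + 1 / 2 := ⟨_, rfl⟩
    have ha : 0 < α := by rw [hα]; positivity
    have hb : 0 < β := by rw [hβ]; positivity
    have : cgNorm μ₁ μ₂ (2 * (m + 1)) = altSum (m + 1) α β 1 (-1) / 4 ^ (m + 1)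
        + altSum m (α + 1) (β + 1) 1 (-1) / (4 * 4 ^ m * α * β) := by
      rw [cgNorm, sum_antidiagonal_even]
      simp only [muFact_even, muFact_odd, altSum, Finset.sum_div, ← hα, ← hβ]
      congr 1 <;> refine Finset.sum_congr rfl fun p hp => ?_ <;>
        rw [← Finset.HasAntidiagonal.mem_antidiagonal.1 hp] <;>
        · have := (poch_pos ha p.1).ne'
          have := (poch_pos hb p.2).ne'
          have := (poch_pos (x := α + 1) (by positivity) p.1).ne'
          have := (poch_pos (x := β + 1) (by positivity) p.2).ne'
          simp only [poch_succ_left, one_pow, one_mul, ← mul_pow, neg_mul, mul_neg, neg_neg,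
            pow_add]
          field_simp
          try norm_num
    rw [this, altSum_one_neg_one _ ha hb, altSum_one_neg_one m (by positivity) (by positivity),
      ← hα, ← hβ, show α + 1 + (β + 1) + m - 1 = α + β + (m + 1 : ℕ) by push_cast; ring,
      poch_succ_left (α + β + (m + 1 : ℕ) - 1), sub_add_cancel,
      poch_succ (α + β + (m + 1 : ℕ)) m, poch_succ_left α, poch_succ_left β, Nat.factorial_succ]
    have := (poch_pos (x := α + 1) (by positivity) m).ne'
    have := (poch_pos (x := β + 1) (by positivity) m).ne'
    push_cast
    field_simp
    ring

lemma lowSum_eq_undeformed {μ₁ μ₂ ε : ℝ} (h₁ : 0 < μ₁) (h₂ : 0 < μ₂) (hε : ε ^ 2 = 1)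
    (γ x y : ℝ) (j : ℕ) : lowSum μ₁ μ₂ ε γ x y j
      = ∑ p ∈ Finset.HasAntidiagonal.antidiagonal j,
        cgSign ε p * (divChihara μ₁ γ x 0 p.1 * divChihara μ₂ (x * ε) y 0 p.2) :=
  sum_divChihara_const h₁ h₂ γ x (x * ε) y (cgSign ε) (cgSign_add_two hε) j 1 0

/-- At `τ = 0` the odd index leaves a single linear factor, `x - γ` or `y - x ε`. As `(x ε)² = x²`,
the quadratic factors `x² - γ²` and `y² - x²` add up to `y² - γ²`; this is the additivity used in
Pfaff's transformation. One halving of each comes from the factor `4^k` in the `μ`-factorials, the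
other anticipates `altSum_half`. -/
lemma lowSum_odd {μ₁ μ₂ ε : ℝ} (h₁ : 0 < μ₁) (h₂ : 0 < μ₂) (hε : ε ^ 2 = 1)
    (γ x y : ℝ) (m : ℕ) : lowSum μ₁ μ₂ ε γ x y (2 * m + 1)
      = ε * (x - γ) / (2 * (μ₁ + 1 / 2)) * altSum m (μ₁ + 1 / 2 + 1) (μ₂ + 1 / 2)
          ((x ^ 2 - γ ^ 2) / 2 / 2) ((y ^ 2 - x ^ 2) / 2 / 2)
        - (y - x * ε) / (2 * (μ₂ + 1 / 2)) * altSum m (μ₁ + 1 / 2) (μ₂ + 1 / 2 + 1)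
          ((x ^ 2 - γ ^ 2) / 2 / 2) ((y ^ 2 - x ^ 2) / 2 / 2) := by
  obtain ⟨α, hα⟩ : ∃ α, α = μ₁ + 1 / 2 := ⟨_, rfl⟩
  obtain ⟨β, hβ⟩ : ∃ β, β = μ₂ + 1 / 2 := ⟨_, rfl⟩
  have ha : 0 < α := by rw [hα]; positivity
  have hb : 0 < β := by rw [hβ]; positivity
  rw [lowSum_eq_undeformed h₁ h₂ hε, sum_antidiagonal_odd, Finset.sum_add_distrib, add_comm,
    sub_eq_add_neg, altSum, altSum, Finset.mul_sum, Finset.mul_sum, ← Finset.sum_neg_distrib,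
    ← hα, ← hβ]
  have hxe : (x * ε) ^ 2 = x ^ 2 := by rw [mul_pow, hε, mul_one]
  congr 1 <;> refine Finset.sum_congr rfl fun p hp => ?_ <;>
    · have := (poch_pos ha p.1).ne'
      have := (poch_pos hb p.2).ne'
      have := (poch_pos (x := α + 1) (by positivity) p.1).ne'
      have := (poch_pos (x := β + 1) (by positivity) p.2).ne'
      simp only [(divChihara_zero_even_odd _ _ _ h₁ p.1).1, (divChihara_zero_even_odd _ _ _ h₁ p.1).2,
        (divChihara_zero_even_odd _ _ _ h₂ p.2).1, (divChihara_zero_even_odd _ _ _ h₂ p.2).2,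
        cgSign, (triangle_sign _).1, (triangle_sign _).2, muFact_even, muFact_odd, ← hα, ← hβ,
        poch_succ_left, pow_add, pow_mul, hε, hxe, div_div, div_pow]
      norm_num
      field_simp

lemma lowSum_even_succ {μ₁ μ₂ ε : ℝ} (h₁ : 0 < μ₁) (h₂ : 0 < μ₂) (hε : ε ^ 2 = 1)
    (γ x y : ℝ) (m : ℕ) : lowSum μ₁ μ₂ ε γ x y (2 * (m + 1))
      = altSum (m + 1) (μ₁ + 1 / 2) (μ₂ + 1 / 2)
          ((x ^ 2 - γ ^ 2) / 2 / 2) ((y ^ 2 - x ^ 2) / 2 / 2)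
        - ε * (x - γ) * (y - x * ε) / (4 * (μ₁ + 1 / 2) * (μ₂ + 1 / 2))
          * altSum m (μ₁ + 1 / 2 + 1) (μ₂ + 1 / 2 + 1)
          ((x ^ 2 - γ ^ 2) / 2 / 2) ((y ^ 2 - x ^ 2) / 2 / 2) := by
  obtain ⟨α, hα⟩ : ∃ α, α = μ₁ + 1 / 2 := ⟨_, rfl⟩
  obtain ⟨β, hβ⟩ : ∃ β, β = μ₂ + 1 / 2 := ⟨_, rfl⟩
  have ha : 0 < α := by rw [hα]; positivity
  have hb : 0 < β := by rw [hβ]; positivity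
  rw [lowSum_eq_undeformed h₁ h₂ hε, sum_antidiagonal_even,
    sub_eq_add_neg, altSum, altSum, Finset.mul_sum, ← Finset.sum_neg_distrib, ← hα, ← hβ]
  have hxe : (x * ε) ^ 2 = x ^ 2 := by rw [mul_pow, hε, mul_one]
  congr 1 <;> refine Finset.sum_congr rfl fun p hp => ?_ <;>
    · have := (poch_pos ha p.1).ne'
      have := (poch_pos hb p.2).ne'
      have := (poch_pos (x := α + 1) (by positivity) p.1).ne'
      have := (poch_pos (x := β + 1) (by positivity) p.2).ne'
      simp only [(divChihara_zero_even_odd _ _ _ h₁ p.1).1, (divChihara_zero_even_odd _ _ _ h₁ p.1).2,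
        (divChihara_zero_even_odd _ _ _ h₂ p.2).1, (divChihara_zero_even_odd _ _ _ h₂ p.2).2,
        cgSign, (triangle_sign _).1, (triangle_sign _).2, muFact_even, muFact_odd, ← hα, ← hβ,
        poch_succ_left, pow_add, pow_mul, hε, hxe, div_div, div_pow]
      norm_num
      field_simp
      try ring

/-! ## The normalization constants -/

/-- The Gamma quotients collapse to Pochhammer symbols. What is left is the square of the constant
relating `altSum` to `hypSum`, over the squared norm of the lowest weight vector. -/
lemma normConst_even {μ₁ μ₂ : ℝ} (h₁ : 0 < μ₁) (h₂ : 0 < μ₂) (m : ℕ) :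
    Real.Gamma (μ₁ + 1 / 2) * Real.Gamma (μ₂ + 1 / 2)
      / (Real.Gamma (mu12 μ₁ μ₂ (2 * m) + 1 / 2) * jacobiNorm (2 * m) (2 * μ₂) (2 * μ₁))
      = (1 / (2 ^ m * m.factorial * poch (μ₁ + 1 / 2) m)) ^ 2 / cgNorm μ₁ μ₂ (2 * m) := by
  obtain ⟨α, hα⟩ : ∃ α, α = μ₁ + 1 / 2 := ⟨_, rfl⟩
  obtain ⟨β, hβ⟩ : ∃ β, β = μ₂ + 1 / 2 := ⟨_, rfl⟩
  have ha : 0 < α := by rw [hα]; positivity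
  have hb : 0 < β := by rw [hβ]; positivity
  rw [cgNorm_even h₁ h₂, ← hα, ← hβ, jacobiNorm, if_pos (even_two_mul m), mu12,
    Nat.mul_div_cancel_left _ (by norm_num),
    show μ₁ + μ₂ + (2 * m : ℕ) + 1 / 2 + 1 / 2 = α + β + m + m by rw [hα, hβ]; push_cast; ring,
    show ((2 * m : ℕ) + 2 * μ₁ + 1) / 2 = α + m by rw [hα]; push_cast; ring,
    show ((2 * m : ℕ) + 2 * μ₂ + 3) / 2 = β + m + 1 by rw [hβ]; push_cast; ring,
    show ((2 * m : ℕ) + 2 * μ₂ + 1) = 2 * (β + m) by rw [hβ]; push_cast; ring,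
    show ((2 * m : ℕ) + 2 * μ₂ + 2 * μ₁ + 2) / 2 = α + β + m by rw [hα, hβ]; push_cast; ring,
    show (2 * μ₂ + 1) / 2 = β by rw [hβ]; ring,
    Real.Gamma_add_one (by positivity), Gamma_add_nat ha, Gamma_add_nat hb,
    Gamma_add_nat (x := α + β + m) (by positivity)]
  have := (poch_pos ha m).ne'
  have := (poch_pos hb m).ne'
  have := (poch_pos (x := α + β + m) (by positivity) m).ne'
  have := (Real.Gamma_pos_of_pos ha).ne'
  have := (Real.Gamma_pos_of_pos hb).ne'
  have := (Real.Gamma_pos_of_pos (s := α + β + m) (by positivity)).ne'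
  have e : (4 : ℝ) ^ m = 2 ^ m * 2 ^ m := by rw [← mul_pow]; norm_num
  rw [e]
  field_simp

lemma normConst_odd {μ₁ μ₂ : ℝ} (h₁ : 0 < μ₁) (h₂ : 0 < μ₂) (m : ℕ) :
    Real.Gamma (μ₁ + 1 / 2) * Real.Gamma (μ₂ + 1 / 2)
      / (Real.Gamma (mu12 μ₁ μ₂ (2 * m + 1) + 1 / 2) * jacobiNorm (2 * m + 1) (2 * μ₂) (2 * μ₁))
      = 2 * (1 / (2 * 2 ^ m * m.factorial * poch (μ₁ + 1 / 2) (m + 1))) ^ 2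
        / cgNorm μ₁ μ₂ (2 * m + 1) := by
  obtain ⟨α, hα⟩ : ∃ α, α = μ₁ + 1 / 2 := ⟨_, rfl⟩
  obtain ⟨β, hβ⟩ : ∃ β, β = μ₂ + 1 / 2 := ⟨_, rfl⟩
  have ha : 0 < α := by rw [hα]; positivity
  have hb : 0 < β := by rw [hβ]; positivity
  rw [cgNorm_odd h₁ h₂, ← hα, ← hβ, jacobiNorm, if_neg (by simp), mu12, Nat.add_sub_cancel,
    Nat.mul_div_cancel_left _ (by norm_num), show (2 * m + 1 + 1) / 2 = m + 1 by omega,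
    show μ₁ + μ₂ + (2 * m + 1 : ℕ) + 1 / 2 + 1 / 2 = α + β + m + 1 + m by
      rw [hα, hβ]; push_cast; ring,
    show ((2 * m + 1 : ℕ) + 2 * μ₁ + 2) / 2 = α + (m + 1 : ℕ) by rw [hα]; push_cast; ring,
    show ((2 * m + 1 : ℕ) + 2 * μ₂ + 2) / 2 = β + (m + 1 : ℕ) by rw [hβ]; push_cast; ring,
    show ((2 * m + 1 : ℕ) + 2 * μ₂ + 2 * μ₁ + 1) = 2 * (α + β + m) by
      rw [hα, hβ]; push_cast; ring,
    show ((2 * m + 1 : ℕ) + 2 * μ₂ + 2 * μ₁ + 3) / 2 = α + β + m + 1 by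
      rw [hα, hβ]; push_cast; ring,
    show (2 * μ₂ + 1) / 2 = β by rw [hβ]; ring,
    Gamma_add_nat ha, Gamma_add_nat hb,
    Gamma_add_nat (x := α + β + m + 1) (by positivity), poch_succ_left (α + β + m)]
  have := (poch_pos ha (m + 1)).ne'
  have := (poch_pos hb (m + 1)).ne'
  have := (poch_pos (x := α + β + m + 1) (by positivity) m).ne'
  have := (Real.Gamma_pos_of_pos ha).ne'
  have := (Real.Gamma_pos_of_pos hb).ne'
  have := (Real.Gamma_pos_of_pos (s := α + β + m + 1) (by positivity)).ne'
  have e : (4 : ℝ) ^ m = 2 ^ m * 2 ^ m := by rw [← mul_pow]; norm_num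
  rw [e]
  field_simp

/-- Term by term: `(b + 1)_i - (b)_i = i (b + 1)_{i-1}`, `i C(m + 1, i) = (m + 1) C(m, i - 1)` and
`(g)_i = g (g + 1)_{i-1}`. -/
lemma hypSum_succ_contiguous (m : ℕ) (b t s : ℝ) {g : ℝ} (hg : 0 < g) :
    hypSum (m + 1) (b + 1) g t s
      = hypSum (m + 1) b g t s + (m + 1) / g * t * hypSum m (b + 1) (g + 1) t s := by
  induction m generalizing b g with
  | zero => simp only [hypSum]; push_cast; ring
  | succ m ih =>
    have e1 : hypSum (m + 1 + 1) b g t s = s * hypSum (m + 1) b g t s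
      + b / g * t * hypSum (m + 1) (b + 1) (g + 1) t s := rfl
    have e2 : hypSum (m + 1) (b + 1) (g + 1) t s = s * hypSum m (b + 1) (g + 1) t s
      + (b + 1) / (g + 1) * t * hypSum m (b + 1 + 1) (g + 1 + 1) t s := rfl
    rw [hypSum, ih b hg, ih (b + 1) (g := g + 1) (by positivity), e1, e2]
    have : g + 1 ≠ 0 := by positivity
    push_cast
    field_simp
    ring

/-! ## Lowest weight vectors and Big `-1` Jacobi polynomials -/

lemma pow_mul_ordinaryHypergeometric (m : ℕ) (b t w : ℝ) {g : ℝ} (hg : 0 < g) (hw : w ≠ 0) :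
    w ^ m * ₂F₁ (-(m : ℝ)) b g (t / w) = hypSum m b g (-t) w := by
  rw [ordinaryHypergeometric_neg_nat m b _ hg, mul_pow_hypSum]
  congr 1 <;> field_simp

/-- For odd `j` this restores the sign of `λ₂ - c ε₁ ε₂`, which the nonnegative square root in `K_j`
loses. -/
lemma sign_mul_abs (y z : ℝ) (h : 0 < y * z) : Real.sign y * |z| = z := by
  rcases lt_trichotomy y 0 with hy | hy | hy
  · rw [Real.sign_of_neg hy, abs_of_neg (by nlinarith)]; ring
  · simp [hy] at h
  · rw [Real.sign_of_pos hy, abs_of_pos (by nlinarith)]; ring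

/-- The data entering the formula for the lowest weight vectors. -/
lemma bigJacobi_args {ε₁ ε₂ c x y : ℝ} (hε₁ : ε₁ ^ 2 = 1) (hε₂ : ε₂ ^ 2 = 1)
    (hcx : |c| < |x|) (hxy : |x| < |y|) :
    0 < (y ^ 2 - c ^ 2) / 2 ∧ 0 < y * (y - c * ε₁ * ε₂) ∧ y + c * ε₁ * ε₂ ≠ 0 ∧
    (y - c * ε₁ * ε₂) * (y + c * ε₁ * ε₂) = y ^ 2 - c ^ 2 ∧
    (1 - (ε₂ * x / y) ^ 2) / (1 - (-(c * ε₁ * ε₂) / y) ^ 2)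
      = ((y ^ 2 - x ^ 2) / 2) / ((y ^ 2 - c ^ 2) / 2) ∧
    (1 - ε₂ * x / y) / (1 + -(c * ε₁ * ε₂) / y) = (y - x * ε₂) / (y - c * ε₁ * ε₂) := by
  have hcy : |c| < |y| := hcx.trans hxy
  have hy : y ≠ 0 := by rintro rfl; simp at hcy; exact absurd hcy (abs_nonneg c).not_gt
  have h2 : c ^ 2 < y ^ 2 := sq_lt_sq.2 hcy
  have he : (c * ε₁ * ε₂) ^ 2 = c ^ 2 := by rw [mul_pow, mul_pow, hε₁, hε₂]; ring
  have h4 : (y - c * ε₁ * ε₂) * (y + c * ε₁ * ε₂) = y ^ 2 - c ^ 2 := by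
    linear_combination -he
  have hlt : |c * ε₁ * ε₂| < |y| := sq_lt_sq.1 (by rw [he]; exact h2)
  have h3 : 0 < y * (y - c * ε₁ * ε₂) := by
    have : |y * (c * ε₁ * ε₂)| < |y| * |y| := by
      rw [abs_mul]; exact mul_lt_mul_of_pos_left hlt (abs_pos.2 hy)
    have := (abs_lt.1 this).2
    rw [abs_mul_abs_self] at this
    linarith
  have h5 : y - c * ε₁ * ε₂ ≠ 0 := fun h => by simp [h] at h3
  have h6 : y + c * ε₁ * ε₂ ≠ 0 := fun h => by rw [h] at h4; linarith
  refine ⟨by linarith, h3, h6, h4, ?_, ?_⟩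
  · have h7 : y ^ 2 - c ^ 2 ≠ 0 := by linarith
    have : 1 - (-(c * ε₁ * ε₂) / y) ^ 2 = (y ^ 2 - c ^ 2) / y ^ 2 := by
      rw [div_pow, neg_sq, he]; field_simp
    rw [this, div_pow, mul_pow, hε₂]
    field_simp
  · have : 1 + -(c * ε₁ * ε₂) / y = (y - c * ε₁ * ε₂) / y := by field_simp; ring
    rw [this]
    field_simp

/-- Multiplying by `w^m (y - e)` clears all denominators. Since `w = s + t` with `s = (x² - c²)/2`,
Pfaff's transformation takes both `₂F₁` of the Jacobi polynomial from the arguments `(-t, w)` to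
`(t, s)`, where `altSum` lives. One contiguous relation then accounts for the difference. -/
lemma lowSum_eq_bigJacobi_odd {μ₁ μ₂ ε₁ ε₂ c x y : ℝ} (h₁ : 0 < μ₁) (h₂ : 0 < μ₂)
    (hε₁ : ε₁ ^ 2 = 1) (hε₂ : ε₂ ^ 2 = 1) (hcx : |c| < |x|) (hxy : |x| < |y|) (m : ℕ) :
    lowSum μ₁ μ₂ ε₂ (c * ε₁) x y (2 * m + 1) / √(cgNorm μ₁ μ₂ (2 * m + 1))
      = Real.sign y ^ (2 * m + 1) * normK μ₁ μ₂ ε₁ ε₂ c (2 * m + 1) y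
        * bigJacobi (2 * m + 1) (ε₂ * x / y) (2 * μ₂) (2 * μ₁) (-(c * ε₁ * ε₂) / y) := by
  obtain ⟨hw, hpos, hne, hmul, hz, hq⟩ := bigJacobi_args hε₁ hε₂ hcx hxy
  obtain ⟨α, hα⟩ : ∃ α, α = μ₁ + 1 / 2 := ⟨_, rfl⟩
  obtain ⟨β, hβ⟩ : ∃ β, β = μ₂ + 1 / 2 := ⟨_, rfl⟩
  have ha : 0 < α := by rw [hα]; positivity
  have hb : 0 < β := by rw [hβ]; positivity
  have hsq : (c * ε₁) ^ 2 = c ^ 2 := by rw [mul_pow, hε₁, mul_one]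
  have hy : y ≠ 0 := fun h => by simp [h] at hpos
  have hsign : Real.sign y ^ 2 = 1 := by
    rcases Real.sign_apply_eq_of_ne_zero y hy with h | h <;> rw [h] <;> norm_num
  have hd : y - c * ε₁ * ε₂ ≠ 0 := fun h => by simp [h] at hpos
  set e := c * ε₁ * ε₂ with he
  set w := (y ^ 2 - c ^ 2) / 2 with hwdef
  set t := (y ^ 2 - x ^ 2) / 2 with htdef
  have hst : w = (x ^ 2 - (c * ε₁) ^ 2) / 2 + t := by rw [hsq]; ring
  have hp := poch_pos ha (m + 1)
  have hN := cgNorm_pos h₁ h₂ (2 * m + 1)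
  have hK : Real.sign y ^ (2 * m + 1) * normK μ₁ μ₂ ε₁ ε₂ c (2 * m + 1) y
      = (y - e) * w ^ m / (2 * 2 ^ m * m.factorial * poch α (m + 1))
        / √(cgNorm μ₁ μ₂ (2 * m + 1)) := by
    have : ((y ^ 2 - c ^ 2) / 2) ^ (2 * m + 1)
        * ((y - c * ε₁ * ε₂) / (y - (-1) ^ (2 * m + 1) * c * ε₁ * ε₂))
        * (Real.Gamma (μ₁ + 1 / 2) * Real.Gamma (μ₂ + 1 / 2)
        / (Real.Gamma (mu12 μ₁ μ₂ (2 * m + 1) + 1 / 2)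
          * jacobiNorm (2 * m + 1) (2 * μ₂) (2 * μ₁)))
        = ((y - e) * w ^ m / (2 * 2 ^ m * m.factorial * poch α (m + 1))) ^ 2
          / cgNorm μ₁ μ₂ (2 * m + 1) := by
      rw [normConst_odd h₁ h₂, ← hα, ← hwdef, ← he,
        show y - (-1) ^ (2 * m + 1) * c * ε₁ * ε₂ = y + e by rw [he, pow_succ, pow_mul]; simp]
      -- The odd power of `w` and the quotient in `K_j` combine to a perfect square; the `1/2`
      -- cancels the `2` in `normConst_odd`.
      have : w * ((y - e) / (y + e)) = (y - e) ^ 2 / 2 := by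
        rw [hwdef, ← hmul]; field_simp
      rw [pow_succ, mul_assoc (w ^ (2 * m)), this]
      field_simp
      ring
    rw [normK, this, Real.sqrt_div (sq_nonneg _), Real.sqrt_sq_eq_abs, pow_succ, pow_mul, hsign,
      one_pow, one_mul, mul_div_assoc', sign_mul_abs]
    rw [mul_div_assoc', ← mul_assoc]
    positivity
  have hg := hypSum_contiguous m (-(α + m)) t ((x ^ 2 - (c * ε₁) ^ 2) / 2) hb
  have p1 := hypSum_pfaff m (α + β + m) t ((x ^ 2 - (c * ε₁) ^ 2) / 2) hb
  have p2 := hypSum_pfaff m (α + β + m + 1) t ((x ^ 2 - (c * ε₁) ^ 2) / 2) (g := β + 1)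
    (by positivity)
  rw [← hst, show β - (α + β + m) = -(α + m) by ring] at p1
  rw [← hst, show β + 1 - (α + β + m + 1) = -(α + m) by ring] at p2
  have hJ : w ^ m * (y - e) * bigJacobi (2 * m + 1) (ε₂ * x / y) (2 * μ₂) (2 * μ₁) (-e / y)
      = (y - e) * hypSum m (-(α + m)) β t ((x ^ 2 - (c * ε₁) ^ 2) / 2)
        - (α + β + m) / β * (y - x * ε₂)
          * hypSum m (-(α + m)) (β + 1) t ((x ^ 2 - (c * ε₁) ^ 2) / 2) := by
    rw [← p1, ← p2, ← pow_mul_ordinaryHypergeometric m _ _ _ hb hw.ne',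
      ← pow_mul_ordinaryHypergeometric m _ _ _ (by positivity) hw.ne', bigJacobi,
      if_neg (by simp), hz,
      show -(((2 * m + 1 : ℕ) : ℝ) - 1) / 2 = -(m : ℝ) by push_cast; ring,
      show ((2 * m + 1 : ℕ) + 2 * μ₂ + 2 * μ₁ + 1) / 2 = α + β + m by
        rw [hα, hβ]; push_cast; ring,
      show ((2 * m + 1 : ℕ) + 2 * μ₂ + 2 * μ₁ + 3) / 2 = α + β + m + 1 by
        rw [hα, hβ]; push_cast; ring,
      show ((2 * m + 1 : ℕ) + 2 * μ₂ + 2 * μ₁ + 1) = 2 * (α + β + m) by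
        rw [hα, hβ]; push_cast; ring,
      show (2 * μ₂ + 1) / 2 = β by rw [hβ]; ring,
      show (2 * μ₂ + 3) / 2 = β + 1 by rw [hβ]; ring,
      show 2 * μ₂ + 1 = 2 * β by rw [hβ]; ring, mul_comm (1 + -e / y), mul_div_mul_comm, hq]
    field_simp
  rw [hK, lowSum_odd h₁ h₂ hε₂, ← hα, ← hβ, ← htdef, altSum_half m _ _ (by positivity) hb,
    altSum_half m _ _ ha (by positivity)]
  have e1 : (y - e) * w ^ m / (2 * 2 ^ m * m.factorial * poch α (m + 1))
        / √(cgNorm μ₁ μ₂ (2 * m + 1))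
        * bigJacobi (2 * m + 1) (ε₂ * x / y) (2 * μ₂) (2 * μ₁) (-e / y)
      = w ^ m * (y - e) * bigJacobi (2 * m + 1) (ε₂ * x / y) (2 * μ₂) (2 * μ₁) (-e / y)
        / (2 * 2 ^ m * m.factorial * poch α (m + 1)) / √(cgNorm μ₁ μ₂ (2 * m + 1)) := by ring
  rw [e1, hJ]
  congr 1
  rw [show 1 - (α + 1) - (m : ℝ) = -(α + m) by ring,
    show 1 - α - (m : ℝ) = -(α + m) + 1 by ring]
  have e2 := poch_succ α m
  rw [poch_succ_left] at e2
  have := (poch_pos ha m).ne'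
  have := (poch_pos (x := α + 1) (by positivity) m).ne'
  have hm : α + (m : ℝ) ≠ 0 := by positivity
  have e3 : poch α m = α * poch (α + 1) m / (α + m) := by rw [e2]; field_simp
  rw [poch_succ_left, e3]
  set A := hypSum m (-(α + m)) β t ((x ^ 2 - (c * ε₁) ^ 2) / 2)
  set B := hypSum m (-(α + m)) (β + 1) t ((x ^ 2 - (c * ε₁) ^ 2) / 2)
  set C := hypSum m (-(α + m) + 1) (β + 1) t ((x ^ 2 - (c * ε₁) ^ 2) / 2)
  have hee : e = c * ε₁ * ε₂ := he
  rw [hee]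
  have hε : ε₂ * ε₂ = 1 := by rw [← sq, hε₂]
  field_simp
  -- The relation `β A - (α + β + m) B = -(α + m) C` eliminates `B`. The remaining coefficient of
  -- `A` is `(y - e) - (y - x ε₂) = ε₂ (x - c ε₁)`.
  linear_combination -(y - x * ε₂) * hg

lemma lowSum_eq_bigJacobi_even {μ₁ μ₂ ε₁ ε₂ c x y : ℝ} (h₁ : 0 < μ₁) (h₂ : 0 < μ₂)
    (hε₁ : ε₁ ^ 2 = 1) (hε₂ : ε₂ ^ 2 = 1) (hcx : |c| < |x|) (hxy : |x| < |y|) (m : ℕ) :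
    lowSum μ₁ μ₂ ε₂ (c * ε₁) x y (2 * m) / √(cgNorm μ₁ μ₂ (2 * m))
      = Real.sign y ^ (2 * m) * normK μ₁ μ₂ ε₁ ε₂ c (2 * m) y
        * bigJacobi (2 * m) (ε₂ * x / y) (2 * μ₂) (2 * μ₁) (-(c * ε₁ * ε₂) / y) := by
  obtain ⟨hw, hpos, hne, hmul, hz, hq⟩ := bigJacobi_args hε₁ hε₂ hcx hxy
  obtain ⟨α, hα⟩ : ∃ α, α = μ₁ + 1 / 2 := ⟨_, rfl⟩
  obtain ⟨β, hβ⟩ : ∃ β, β = μ₂ + 1 / 2 := ⟨_, rfl⟩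
  have ha : 0 < α := by rw [hα]; positivity
  have hb : 0 < β := by rw [hβ]; positivity
  have hsq : (c * ε₁) ^ 2 = c ^ 2 := by rw [mul_pow, hε₁, mul_one]
  have hy : y ≠ 0 := fun h => by simp [h] at hpos
  have hsign : Real.sign y ^ 2 = 1 := by
    rcases Real.sign_apply_eq_of_ne_zero y hy with h | h <;> rw [h] <;> norm_num
  have hd : y - c * ε₁ * ε₂ ≠ 0 := fun h => by simp [h] at hpos
  set e := c * ε₁ * ε₂ with he
  set w := (y ^ 2 - c ^ 2) / 2 with hwdef
  set t := (y ^ 2 - x ^ 2) / 2 with htdef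
  set s := (x ^ 2 - (c * ε₁) ^ 2) / 2 with hsdef
  have hst : w = s + t := by rw [hsdef, hsq]; ring
  have hp := poch_pos ha m
  have hN := cgNorm_pos h₁ h₂ (2 * m)
  have hK : Real.sign y ^ (2 * m) * normK μ₁ μ₂ ε₁ ε₂ c (2 * m) y
      = w ^ m / (2 ^ m * m.factorial * poch α m) / √(cgNorm μ₁ μ₂ (2 * m)) := by
    have : ((y ^ 2 - c ^ 2) / 2) ^ (2 * m)
        * ((y - c * ε₁ * ε₂) / (y - (-1) ^ (2 * m) * c * ε₁ * ε₂))
        * (Real.Gamma (μ₁ + 1 / 2) * Real.Gamma (μ₂ + 1 / 2)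
        / (Real.Gamma (mu12 μ₁ μ₂ (2 * m) + 1 / 2) * jacobiNorm (2 * m) (2 * μ₂) (2 * μ₁)))
        = (w ^ m / (2 ^ m * m.factorial * poch α m)) ^ 2 / cgNorm μ₁ μ₂ (2 * m) := by
      rw [normConst_even h₁ h₂, ← hα, ← hwdef, ← he,
        show y - (-1) ^ (2 * m) * c * ε₁ * ε₂ = y - e by rw [he, pow_mul]; simp, div_self hd]
      field_simp
      ring
    rw [normK, this, Real.sqrt_div (sq_nonneg _), Real.sqrt_sq (by positivity), pow_mul, hsign,
      one_pow, one_mul]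
  have e1 (J : ℝ) : w ^ m / (2 ^ m * m.factorial * poch α m) / √(cgNorm μ₁ μ₂ (2 * m)) * J
      = w ^ m * J / (2 ^ m * m.factorial * poch α m) / √(cgNorm μ₁ μ₂ (2 * m)) := by ring
  rw [hK, e1]
  congr 1
  cases m with
  | zero =>
    -- For `j = 0` the second hypergeometric series does not terminate, but its prefactor `n = 0`
    -- removes it.
    have h0 : ∀ b z : ℝ, ₂F₁ (-((0 : ℕ) : ℝ)) b β z = 1 := fun b z => by
      rw [ordinaryHypergeometric_neg_nat 0 _ _ hb]; rfl
    rw [bigJacobi, if_pos (even_two_mul _), show (2 * μ₂ + 1) / 2 = β by rw [hβ]; ring,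
      show -((2 * 0 : ℕ) : ℝ) / 2 = -((0 : ℕ) : ℝ) by simp, h0]
    simp [lowSum, cgSign, divChihara]
  | succ m =>
    have hJ : w ^ (m + 1) * bigJacobi (2 * (m + 1)) (ε₂ * x / y) (2 * μ₂) (2 * μ₁) (-e / y)
        = hypSum (m + 1) (α + β + m + 1) β (-t) w
          + (m + 1) / β * w * ((y - x * ε₂) / (y - e))
            * hypSum m (α + β + m + 1) (β + 1) (-t) w := by
      rw [← pow_mul_ordinaryHypergeometric (m + 1) _ _ _ hb hw.ne',
        ← pow_mul_ordinaryHypergeometric m _ _ _ (by positivity) hw.ne', bigJacobi,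
        if_pos (even_two_mul _), hz,
        show -((2 * (m + 1) : ℕ) : ℝ) / 2 = -((m + 1 : ℕ) : ℝ) by push_cast; ring,
        show 1 - ((2 * (m + 1) : ℕ) : ℝ) / 2 = -(m : ℝ) by push_cast; ring,
        show ((2 * (m + 1) : ℕ) + 2 * μ₂ + 2 * μ₁ + 2) / 2 = α + β + m + 1 by
          rw [hα, hβ]; push_cast; ring,
        show (2 * μ₂ + 1) / 2 = β by rw [hβ]; ring,
        show (2 * μ₂ + 3) / 2 = β + 1 by rw [hβ]; ring,
        show 2 * μ₂ + 1 = 2 * β by rw [hβ]; ring,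
        mul_comm (1 + -e / y), mul_div_mul_comm, hq]
      push_cast
      field_simp
      ring
    have p1 := hypSum_pfaff (m + 1) (α + β + m) t s hb
    have p2 := hypSum_pfaff m (α + β + m + 1) t s (g := β + 1) (by positivity)
    -- Lowering the numerator parameter to `α + β + m` makes Pfaff's transformation yield `-(α + m)`
    -- in both terms. The correction `-(m + 1)/β t` is absorbed by the `t` in `hwq`.
    have hc := hypSum_succ_contiguous m (α + β + m) (-t) w hb
    rw [← hst, show β - (α + β + m) = -(α + m) by ring] at p1
    rw [← hst, show β + 1 - (α + β + m + 1) = -(α + m) by ring] at p2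
    rw [p1, p2] at hc
    have hwq : w * ((y - x * ε₂) / (y - e)) = t - ε₂ * (x - c * ε₁) * (y - x * ε₂) / 2 := by
      rw [hwdef, ← hmul, htdef]
      field_simp
      rw [he]
      linear_combination -x ^ 2 * hε₂
    rw [hJ, mul_assoc ((m + 1) / β) w, hwq, p2, lowSum_even_succ h₁ h₂ hε₂, ← hα, ← hβ, ← hsdef,
      ← htdef, altSum_half _ _ _ ha hb, altSum_half m _ _ (by positivity) (by positivity),
      show 1 - α - ((m + 1 : ℕ) : ℝ) = -(α + m) by push_cast; ring,
      show 1 - (α + 1) - (m : ℝ) = -(α + m) by ring, Nat.factorial_succ, poch_succ_left]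
    have := (poch_pos (x := α + 1) (by positivity) m).ne'
    rw [← sub_eq_iff_eq_add.2 hc.symm.symm]
    push_cast
    field_simp
    ring

open ProbabilityTheory
open scoped ENNReal

/-! ## Laguerre polynomials and gamma distributions -/

/-- Monic Laguerre polynomials `(-2)^n n! L_n^{(α-1)}(x/2)`. -/
def laguerre : ℕ → ℝ → ℝ → ℝ
  | 0, _, _ => 1
  | n + 1, α, x => x * laguerre n (α + 1) x - 2 * (n + α) * laguerre n α x

/-- The classical `L_{n+1}^{(α)} = L_{n+1}^{(α-1)} + L_n^{(α)}` in the monic normalization. -/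
lemma laguerre_succ_add_one (n : ℕ) (α x : ℝ) :
    laguerre (n + 1) (α + 1) x = laguerre (n + 1) α x - 2 * (n + 1) * laguerre n (α + 1) x := by
  induction n generalizing α with
  | zero => simp only [laguerre]; push_cast; ring
  | succ n ih =>
    have h1 := ih α
    have h2 := ih (α + 1)
    have e1 (β : ℝ) : laguerre (n + 1 + 1) β x = x * laguerre (n + 1) (β + 1) x
      - 2 * ((n + 1 : ℕ) + β) * laguerre (n + 1) β x := rfl
    have e2 : laguerre (n + 1) (α + 1) x = x * laguerre n (α + 1 + 1) x
      - 2 * (n + (α + 1)) * laguerre n (α + 1) x := rfl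
    rw [e1, e1, h2]
    push_cast
    linear_combination 2 * (n + 1) * e2 - 2 * (n + 1 + α) * h1

/-- The quadratic decomposition of the Chihara polynomials. The defining recursion of `laguerre`
gives the even steps, `laguerre_succ_add_one` the odd ones. -/
lemma divChihara_one_even_odd {μ : ℝ} (hμ : 0 < μ) (γ x : ℝ) (k : ℕ) :
    divChihara μ γ x 1 (2 * k) = laguerre k (μ + 1 / 2) (x ^ 2 - γ ^ 2) / muFact μ (2 * k) ∧
    divChihara μ γ x 1 (2 * k + 1)
      = (x - γ) * laguerre k (μ + 1 / 2 + 1) (x ^ 2 - γ ^ 2) / muFact μ (2 * k + 1) := by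
  induction k with
  | zero => simp [divChihara, muFact, laguerre]
  | succ k ih =>
    have f0 := (muFact_pos hμ (2 * k)).ne'
    have n1 := (muNumber_succ_pos (2 * k) hμ).ne'
    have n2 := (muNumber_succ_pos (2 * k + 1) hμ).ne'
    have n3 := (muNumber_succ_pos (2 * k + 2) hμ).ne'
    have F1 : muFact μ (2 * k + 1) = muFact μ (2 * k) * muNumber (2 * k + 1) μ := rfl
    have F2 : muFact μ (2 * k + 2) = muFact μ (2 * k) * muNumber (2 * k + 1) μ
      * muNumber (2 * k + 1 + 1) μ := rfl
    have F3 : muFact μ (2 * k + 1 + 2) = muFact μ (2 * k) * muNumber (2 * k + 1) μ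
      * muNumber (2 * k + 1 + 1) μ * muNumber (2 * k + 2 + 1) μ := rfl
    have h : divChihara μ γ x 1 (2 * (k + 1))
        = laguerre (k + 1) (μ + 1 / 2) (x ^ 2 - γ ^ 2) / muFact μ (2 * (k + 1)) := by
      rw [show 2 * (k + 1) = 2 * k + 2 by ring, divChihara, ih.1, ih.2, F1, F2, laguerre,
        pow_succ, pow_mul]
      have e := muNumber_odd k μ
      field_simp
      rw [e]
      norm_num
      ring
    refine ⟨h, ?_⟩
    rw [show 2 * (k + 1) + 1 = 2 * k + 1 + 2 by ring, divChihara,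
      show 2 * k + 1 + 1 = 2 * (k + 1) by ring, h, ih.2, laguerre_succ_add_one,
      show 2 * (k + 1) = 2 * k + 2 by ring, F1, F2, F3,
      show 2 * k + 2 = 2 * (k + 1) by ring, pow_mul]
    have e := muNumber_even (k + 1) μ
    have n2' : muNumber (2 * (k + 1)) μ ≠ 0 := n2
    have n3' : muNumber (2 * (k + 1) + 1) μ ≠ 0 := n3
    rw [show 2 * k + 1 + 2 = 2 * (k + 1) + 1 by ring]
    field_simp
    rw [e]
    push_cast
    norm_num
    ring

/-- A factor `t` becomes a shift of `α`, so moments and Laguerre integrals follow by induction from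
total mass one. -/
lemma mul_gammaPDFReal {α : ℝ} (hα : 0 < α) (t : ℝ) :
    t * gammaPDFReal α 1 t = α * gammaPDFReal (α + 1) 1 t := by
  unfold gammaPDFReal
  split_ifs with ht
  · rw [Real.Gamma_add_one hα.ne', add_sub_cancel_right]
    have := (Real.Gamma_pos_of_pos hα).ne'
    rcases ht.eq_or_lt with rfl | h
    · simp [Real.zero_rpow hα.ne']
    · have : t ^ α = t * t ^ (α - 1) := by
        rw [Real.rpow_sub_one h.ne']; field_simp
      rw [this]
      simp only [Real.one_rpow]
      field_simp
  · simp

lemma integrable_gammaMeasure_iff {α : ℝ} (hα : 0 < α) (f : ℝ → ℝ) :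
    Integrable f (gammaMeasure α 1) ↔ Integrable fun t => f t * gammaPDFReal α 1 t := by
  rw [gammaMeasure, integrable_withDensity_iff (f := gammaPDF α 1)]
  · simp only [gammaPDF, ENNReal.toReal_ofReal (gammaPDFReal_nonneg hα one_pos _)]
  · exact (measurable_gammaPDFReal α 1).ennreal_ofReal
  · exact Filter.Eventually.of_forall fun _ => ENNReal.ofReal_lt_top

lemma integral_gammaMeasure {α : ℝ} (hα : 0 < α) (f : ℝ → ℝ) :
    ∫ t, f t ∂gammaMeasure α 1 = ∫ t, f t * gammaPDFReal α 1 t := by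
  rw [gammaMeasure, integral_withDensity_eq_integral_toReal_smul (f := gammaPDF α 1)]
  · simp only [gammaPDF, ENNReal.toReal_ofReal (gammaPDFReal_nonneg hα one_pos _), smul_eq_mul,
      mul_comm]
  · exact (measurable_gammaPDFReal α 1).ennreal_ofReal
  · exact Filter.Eventually.of_forall fun _ => ENNReal.ofReal_lt_top

lemma integrable_pow_gammaMeasure (k : ℕ) {α : ℝ} (hα : 0 < α) :
    Integrable (fun t : ℝ => t ^ k) (gammaMeasure α 1) := by
  induction k generalizing α with
  | zero =>
    have := isProbabilityMeasure_gammaMeasure hα one_pos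
    simp
  | succ k ih =>
    have := (integrable_gammaMeasure_iff (by positivity) _).1 (ih (α := α + 1) (by positivity))
    rw [integrable_gammaMeasure_iff hα]
    refine (this.const_mul α).congr (Filter.Eventually.of_forall fun t => ?_)
    have := mul_gammaPDFReal hα t
    simp only
    linear_combination -t ^ k * this

lemma integral_mul_gammaMeasure {α : ℝ} (hα : 0 < α) (f : ℝ → ℝ) :
    ∫ t, t * f t ∂gammaMeasure α 1 = α * ∫ t, f t ∂gammaMeasure (α + 1) 1 := by
  rw [integral_gammaMeasure hα, integral_gammaMeasure (by positivity), ← integral_const_mul]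
  refine integral_congr_ae (Filter.Eventually.of_forall fun t => ?_)
  have := mul_gammaPDFReal hα t
  simp only
  linear_combination f t * this

lemma integrable_laguerre (n k : ℕ) (β : ℝ) {α : ℝ} (hα : 0 < α) :
    Integrable (fun t => t ^ k * laguerre n β (2 * t)) (gammaMeasure α 1) := by
  induction n generalizing k β with
  | zero => simpa [laguerre] using integrable_pow_gammaMeasure k hα
  | succ n ih =>
    refine (((ih (k + 1) (β + 1)).const_mul 2).sub ((ih k β).const_mul (2 * (n + β)))).congr
      (Filter.Eventually.of_forall fun t => ?_)
    simp only [laguerre, Pi.sub_apply]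
    ring

/-- The two terms of the recursion integrate to `2α δ_{n,0}` and `2(n + α) δ_{n,0}`, which cancel.
-/
lemma integral_laguerre (n : ℕ) {α : ℝ} (hα : 0 < α) :
    ∫ t, laguerre n α (2 * t) ∂gammaMeasure α 1 = if n = 0 then 1 else 0 := by
  induction n generalizing α with
  | zero =>
    have := isProbabilityMeasure_gammaMeasure hα one_pos
    simp [laguerre]
  | succ n ih =>
    have h1 : ∀ t, laguerre (n + 1) α (2 * t) = 2 * (t * laguerre n (α + 1) (2 * t))
        - 2 * (n + α) * laguerre n α (2 * t) := fun t => by rw [laguerre]; ring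
    simp only [h1]
    rw [integral_sub, integral_const_mul, integral_const_mul, integral_mul_gammaMeasure hα,
      ih hα, ih (by positivity)]
    · rcases eq_or_ne n 0 with rfl | h
      · simp
      · simp [h]
    · simpa using (integrable_laguerre n 1 (α + 1) hα).const_mul 2
    · simpa using (integrable_laguerre n 0 α hα).const_mul _

/-- The factor `exp(t / 2)` lowers the rate from `1` to `1/2`, at the cost of the constant `2^α`. -/
lemma lintegral_exp_half_gammaMeasure {α : ℝ} (hα : 0 < α) :
    ∫⁻ t, ENNReal.ofReal (Real.exp (t / 2)) ∂gammaMeasure α 1 < ⊤ := by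
  have : ∀ t, gammaPDF α 1 t * ENNReal.ofReal (Real.exp (t / 2))
      = ENNReal.ofReal (2 ^ α) * gammaPDF α (1 / 2) t := by
    intro t
    rw [gammaPDF, gammaPDF, ← ENNReal.ofReal_mul (gammaPDFReal_nonneg hα one_pos _),
      ← ENNReal.ofReal_mul (by positivity)]
    congr 1
    unfold gammaPDFReal
    split_ifs with ht
    · have e1 : Real.exp (-(1 * t)) * Real.exp (t / 2) = Real.exp (-(1 / 2 * t)) := by
        rw [← Real.exp_add]; ring_nf
      have e2 : (2 : ℝ) ^ α * (1 / 2) ^ α = 1 := by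
        rw [← Real.mul_rpow (by norm_num) (by norm_num)]; norm_num
      rw [Real.one_rpow, mul_assoc _ (Real.exp _), e1]
      linear_combination -(t ^ (α - 1) * Real.exp (-(1 / 2 * t)) / Real.Gamma α) * e2
    · simp
  rw [gammaMeasure, lintegral_withDensity_eq_lintegral_mul₀]
  · simp only [Pi.mul_apply, this]
    rw [lintegral_const_mul, lintegral_gammaPDF_eq_one hα (by norm_num), mul_one]
    · exact ENNReal.ofReal_lt_top
    · exact (measurable_gammaPDFReal α _).ennreal_ofReal
  · exact (measurable_gammaPDFReal α _).ennreal_ofReal.aemeasurable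
  · fun_prop

/-! ## The orthogonality measure of the Specialized Chihara polynomials -/

/-- The density of the orthogonality measure of the Specialized Chihara polynomials. -/
def chiharaDensity (μ γ x : ℝ) : ℝ := if |γ| < |x| then chiharaWeight x μ γ else 0

lemma chiharaWeight_eq {μ γ x : ℝ} (hx : |γ| < |x|) : chiharaWeight x μ γ
    = Real.sign x * (x + γ) / 2 * gammaPDFReal (μ + 1 / 2) 1 ((x ^ 2 - γ ^ 2) / 2) := by
  have : γ ^ 2 < x ^ 2 := sq_lt_sq.2 hx
  rw [chiharaWeight, gammaPDFReal, if_pos (by linarith), Real.one_rpow, one_mul,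
    show μ + 1 / 2 - 1 = μ - 1 / 2 by ring]
  field_simp

lemma sign_mul_add_nonneg {γ x : ℝ} (hx : |γ| < |x|) : 0 ≤ Real.sign x * (x + γ) := by
  rcases lt_trichotomy x 0 with h | h | h
  · rw [Real.sign_of_neg h]; rw [abs_of_neg h] at hx
    have := (abs_lt.1 hx).2
    linarith
  · simp [h]
  · rw [Real.sign_of_pos h]; rw [abs_of_pos h] at hx
    have := (abs_lt.1 hx).1
    linarith

lemma chiharaWeight_nonneg {μ γ x : ℝ} (hμ : 0 < μ) (hx : |γ| < |x|) :
    0 ≤ chiharaWeight x μ γ := by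
  rw [chiharaWeight_eq hx]
  exact mul_nonneg (div_nonneg (sign_mul_add_nonneg hx) zero_le_two)
    (gammaPDFReal_nonneg (by positivity) one_pos _)

lemma chiharaDensity_nonneg {μ : ℝ} (hμ : 0 < μ) (γ x : ℝ) : 0 ≤ chiharaDensity μ γ x := by
  unfold chiharaDensity
  split_ifs with h
  exacts [chiharaWeight_nonneg hμ h, le_rfl]

lemma measurable_sign : Measurable Real.sign := by
  unfold Real.sign
  exact Measurable.ite measurableSet_Iio measurable_const
    (Measurable.ite measurableSet_Ioi measurable_const measurable_const)

lemma measurable_chiharaDensity {E : Type*} [MeasurableSpace E] (μ : ℝ) {γ x : E → ℝ}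
    (hγ : Measurable γ) (hx : Measurable x) :
    Measurable fun p => chiharaDensity μ (γ p) (x p) := by
  unfold chiharaDensity chiharaWeight
  refine Measurable.ite (measurableSet_lt (by fun_prop) (by fun_prop)) ?_ measurable_const
  have := measurable_sign.comp hx
  simp only [Function.comp_def] at this
  fun_prop

/-- The orthogonality measure of the Specialized Chihara polynomials. -/
def chiharaMeasure (μ γ : ℝ) : Measure ℝ :=
  volume.withDensity fun x => ENNReal.ofReal (chiharaDensity μ γ x)

lemma lintegral_chiharaMeasure (μ γ : ℝ) (f : ℝ → ℝ≥0∞) (hf : Measurable f) :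
    ∫⁻ x, f x ∂chiharaMeasure μ γ = ∫⁻ x, ENNReal.ofReal (chiharaDensity μ γ x) * f x := by
  rw [chiharaMeasure, lintegral_withDensity_eq_lintegral_mul _ _ hf]
  · rfl
  · exact (measurable_chiharaDensity μ measurable_const measurable_id).ennreal_ofReal

lemma integral_chiharaMeasure {μ : ℝ} (hμ : 0 < μ) (γ : ℝ) (f : ℝ → ℝ) :
    ∫ x, f x ∂chiharaMeasure μ γ = ∫ x, chiharaDensity μ γ x * f x := by
  have hm : Measurable fun x => ENNReal.ofReal (chiharaDensity μ γ x) :=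
    (measurable_chiharaDensity μ measurable_const measurable_id).ennreal_ofReal
  rw [chiharaMeasure, integral_withDensity_eq_integral_toReal_smul hm
    (Filter.Eventually.of_forall fun _ => ENNReal.ofReal_lt_top)]
  simp only [ENNReal.toReal_ofReal (chiharaDensity_nonneg hμ _ _), smul_eq_mul]

/-- The prefactors `(x + γ)/2` and `(x - γ)/2` at `x` and `-x` add up to `x`, the Jacobian of `(x² -
γ²)/2`. -/
lemma chiharaDensity_add_neg {μ γ x : ℝ} (hx : |γ| < x) :
    chiharaDensity μ γ x + chiharaDensity μ γ (-x)
      = x * gammaPDFReal (μ + 1 / 2) 1 ((x ^ 2 - γ ^ 2) / 2) := by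
  have h0 : 0 < x := (abs_nonneg γ).trans_lt hx
  have hx' : |γ| < |x| := by rwa [abs_of_pos h0]
  have hx'' : |γ| < |-x| := by rwa [abs_neg]
  rw [chiharaDensity, chiharaDensity, if_pos hx', if_pos hx'', chiharaWeight_eq hx',
    chiharaWeight_eq hx'', Real.sign_of_pos h0, Real.sign_of_neg (by linarith), neg_sq]
  ring

/-- Fold the line at the origin; on `x > |γ|` the map is injective with image `t > 0`, and the
folded density is the gamma density times the Jacobian. -/
lemma chiharaMeasure_map {μ : ℝ} (hμ : 0 < μ) (γ : ℝ) :
    (chiharaMeasure μ γ).map (fun x => (x ^ 2 - γ ^ 2) / 2) = gammaMeasure (μ + 1 / 2) 1 := by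
  have hφ : Measurable fun x : ℝ => (x ^ 2 - γ ^ 2) / 2 := by fun_prop
  refine Measure.ext_of_lintegral _ fun g hg => ?_
  have hm : Measurable fun x => ENNReal.ofReal (chiharaDensity μ γ x) :=
    (measurable_chiharaDensity μ measurable_const measurable_id).ennreal_ofReal
  have hD : ∀ x, |x| ≤ |γ| → chiharaDensity μ γ x = 0 := fun x hx => by
    rw [chiharaDensity, if_neg hx.not_gt]
  rw [lintegral_map hg hφ, lintegral_chiharaMeasure μ γ (fun x => g ((x ^ 2 - γ ^ 2) / 2)) (hg.comp hφ)]
  set F : ℝ → ℝ≥0∞ := fun x => ENNReal.ofReal (chiharaDensity μ γ x) * g ((x ^ 2 - γ ^ 2) / 2)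
    with hF
  have hFm : Measurable F := hm.mul (hg.comp hφ)
  have s1 : ∫⁻ x, F x = ∫⁻ x in Set.Ioi |γ|, F x + F (-x) := by
    rw [lintegral_add_left hFm, ← lintegral_add_compl F (measurableSet_Ioi (a := (0 : ℝ)))]
    have hsub : Set.Ioi |γ| ⊆ Set.Ioi (0 : ℝ) := Set.Ioi_subset_Ioi (abs_nonneg γ)
    have key : ∀ G : ℝ → ℝ≥0∞, (∀ x, |x| ≤ |γ| → G x = 0) →
        ∫⁻ x in Set.Ioi 0, G x = ∫⁻ x in Set.Ioi |γ|, G x := by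
      intro G hG
      rw [← lintegral_indicator measurableSet_Ioi, ← lintegral_indicator measurableSet_Ioi]
      congr 1
      ext x
      by_cases h1 : |γ| < x
      · rw [Set.indicator_of_mem (hsub h1), Set.indicator_of_mem (show x ∈ Set.Ioi |γ| from h1)]
      · rw [Set.indicator_of_notMem (show x ∉ Set.Ioi |γ| from h1)]
        by_cases h2 : 0 < x
        · rw [Set.indicator_of_mem (show x ∈ Set.Ioi (0 : ℝ) from h2)]
          exact hG x (by rw [abs_of_pos h2]; exact not_lt.1 h1)
        · rw [Set.indicator_of_notMem (show x ∉ Set.Ioi (0 : ℝ) from h2)]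
    have e2 : ∫⁻ x in (Set.Ioi (0 : ℝ))ᶜ, F x = ∫⁻ x in Set.Ioi 0, F (-x) := by
      rw [Set.compl_Ioi, ← setLIntegral_congr Iio_ae_eq_Iic,
        ← (Measure.measurePreserving_neg (volume : Measure ℝ)).setLIntegral_comp_preimage
          measurableSet_Iio hFm]
      simp
    rw [e2, key F fun x hx => by simp [hF, hD x hx],
      key (fun x => F (-x)) fun x hx => by simp [hF, hD (-x) (by rwa [abs_neg])]]
  have s2 : ∀ x ∈ Set.Ioi |γ|, F x + F (-x)
      = ENNReal.ofReal |x| * (gammaPDF (μ + 1 / 2) 1 ((x ^ 2 - γ ^ 2) / 2)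
        * g ((x ^ 2 - γ ^ 2) / 2)) := by
    intro x hx
    have h0 : 0 < x := (abs_nonneg γ).trans_lt hx
    simp only [hF, neg_sq]
    rw [← add_mul, ← ENNReal.ofReal_add (chiharaDensity_nonneg hμ _ _)
      (chiharaDensity_nonneg hμ _ _), chiharaDensity_add_neg hx, ENNReal.ofReal_mul h0.le,
      abs_of_pos h0, gammaPDF, mul_assoc]
  have him : (fun x : ℝ => (x ^ 2 - γ ^ 2) / 2) '' Set.Ioi |γ| = Set.Ioi 0 := by
    ext t
    simp only [Set.mem_image, Set.mem_Ioi]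
    constructor
    · rintro ⟨x, hx, rfl⟩
      have : γ ^ 2 < x ^ 2 := sq_lt_sq.2 (hx.trans_le (le_abs_self x))
      linarith
    · intro ht
      have h : 0 ≤ 2 * t + γ ^ 2 := by positivity
      refine ⟨√(2 * t + γ ^ 2), ?_, by rw [Real.sq_sqrt h]; ring⟩
      rw [← Real.sqrt_sq_eq_abs]
      exact Real.sqrt_lt_sqrt (sq_nonneg γ) (by linarith)
  have hinj : Set.InjOn (fun x : ℝ => (x ^ 2 - γ ^ 2) / 2) (Set.Ioi |γ|) := by
    intro x hx y hy h
    have hx0 : 0 < x := (abs_nonneg γ).trans_lt hx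
    have hy0 : 0 < y := (abs_nonneg γ).trans_lt hy
    have : x ^ 2 = y ^ 2 := by simp only at h; linarith
    exact (sq_eq_sq₀ hx0.le hy0.le).1 this
  have hder : ∀ x ∈ Set.Ioi |γ|,
      HasDerivWithinAt (fun x : ℝ => (x ^ 2 - γ ^ 2) / 2) x (Set.Ioi |γ|) x := by
    intro x _
    have := (((hasDerivAt_id x).pow 2).sub_const (γ ^ 2)).div_const 2
    exact (this.congr_deriv (by simp)).hasDerivWithinAt
  have hpdf : Measurable (gammaPDF (μ + 1 / 2) 1) :=
    (measurable_gammaPDFReal _ 1).ennreal_ofReal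
  rw [s1, setLIntegral_congr_fun measurableSet_Ioi s2,
    ← lintegral_image_eq_lintegral_abs_deriv_mul measurableSet_Ioi hder hinj
      (fun t => gammaPDF (μ + 1 / 2) 1 t * g t), him, gammaMeasure,
    lintegral_withDensity_eq_lintegral_mul _ hpdf hg,
    ← lintegral_indicator measurableSet_Ioi]
  refine lintegral_congr_ae ?_
  -- The gamma density need not vanish at `t = 0`, which the image misses; a point is null.
  filter_upwards [Measure.ae_ne volume (0 : ℝ)] with t ht
  by_cases h : 0 < t
  · rw [Set.indicator_of_mem (show t ∈ Set.Ioi (0 : ℝ) from h)]; rfl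
  · rw [Set.indicator_of_notMem (show t ∉ Set.Ioi (0 : ℝ) from h), Pi.mul_apply,
      gammaPDF_of_neg (lt_of_le_of_ne (not_lt.1 h) ht), zero_mul]

/-! ## Functions of exponential growth -/

/-- Measurable functions bounded by `C exp (b ‖p‖)`. -/
def ExpGrowth {E : Type*} [NormedAddCommGroup E] [MeasurableSpace E] (f : E → ℝ) : Prop :=
  Measurable f ∧ ∃ C b : ℝ, 0 ≤ C ∧ 0 ≤ b ∧ ∀ p, |f p| ≤ C * Real.exp (b * ‖p‖)

namespace ExpGrowth

variable {E : Type*} [NormedAddCommGroup E] [MeasurableSpace E] {f g : E → ℝ}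

lemma const (a : ℝ) : ExpGrowth fun _ : E => a :=
  ⟨measurable_const, |a|, 0, abs_nonneg a, le_rfl, fun p => by simp⟩

lemma mul (hf : ExpGrowth f) (hg : ExpGrowth g) : ExpGrowth fun p => f p * g p := by
  obtain ⟨mf, C, b, hC, hb, h⟩ := hf
  obtain ⟨mg, C', b', hC', hb', h'⟩ := hg
  refine ⟨mf.mul mg, C * C', b + b', by positivity, by positivity, fun p => ?_⟩
  rw [abs_mul, add_mul, Real.exp_add]
  calc |f p| * |g p| ≤ (C * Real.exp (b * ‖p‖)) * (C' * Real.exp (b' * ‖p‖)) :=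
        mul_le_mul (h p) (h' p) (abs_nonneg _) (by positivity)
    _ = _ := by ring

lemma add (hf : ExpGrowth f) (hg : ExpGrowth g) : ExpGrowth fun p => f p + g p := by
  obtain ⟨mf, C, b, hC, hb, h⟩ := hf
  obtain ⟨mg, C', b', hC', hb', h'⟩ := hg
  refine ⟨mf.add mg, C + C', b + b', by positivity, by positivity, fun p => ?_⟩
  have e1 : Real.exp (b * ‖p‖) ≤ Real.exp ((b + b') * ‖p‖) := by
    gcongr; linarith
  have e2 : Real.exp (b' * ‖p‖) ≤ Real.exp ((b + b') * ‖p‖) := by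
    gcongr; linarith
  calc |f p + g p| ≤ |f p| + |g p| := abs_add_le _ _
    _ ≤ C * Real.exp (b * ‖p‖) + C' * Real.exp (b' * ‖p‖) := add_le_add (h p) (h' p)
    _ ≤ C * Real.exp ((b + b') * ‖p‖) + C' * Real.exp ((b + b') * ‖p‖) := by gcongr
    _ = _ := by ring

lemma sub (hf : ExpGrowth f) (hg : ExpGrowth g) : ExpGrowth fun p => f p - g p := by
  have := hf.add ((const (-1)).mul hg)
  simpa only [neg_one_mul, ← sub_eq_add_neg] using this

lemma exp_norm [OpensMeasurableSpace E] (b : ℝ) : ExpGrowth fun p : E => Real.exp (b * ‖p‖) := by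
  refine ⟨by fun_prop, 1, |b|, zero_le_one, abs_nonneg b, fun p => ?_⟩
  rw [abs_of_pos (Real.exp_pos _), one_mul]
  gcongr
  exact le_abs_self b

lemma of_le_norm (hm : Measurable f) (C : ℝ) (hC : 0 ≤ C) (h : ∀ p, |f p| ≤ C * ‖p‖) :
    ExpGrowth f := by
  refine ⟨hm, C, 1, hC, zero_le_one, fun p => (h p).trans ?_⟩
  gcongr
  have := Real.add_one_le_exp (1 * ‖p‖)
  linarith

lemma chihara {γ x : E → ℝ} (μ : ℝ) (hγ : ExpGrowth γ) (hx : ExpGrowth x) (n : ℕ) :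
    ExpGrowth fun p => chihara μ (γ p) (x p) n := by
  induction n using Nat.twoStepInduction with
  | zero => exact const 1
  | one =>
    have := (hx.sub hγ).mul (const (√(muNumber 1 μ))⁻¹)
    simpa only [OspConvolution.chihara, div_eq_mul_inv] using this
  | more n ih1 ih2 =>
    have := (((hx.sub (hγ.mul (const ((-1) ^ (n + 1))))).mul ih2).sub
      ((const (√(muNumber (n + 1) μ))).mul ih1)).mul (const (√(muNumber (n + 2) μ))⁻¹)
    simpa only [OspConvolution.chihara, div_eq_mul_inv] using this

end ExpGrowth

/-! ## Orthonormality of the Specialized Chihara polynomials -/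

/-- The exponential moment `∫ exp (t / 2)` of the gamma distribution. -/
def gammaExpMoment (μ : ℝ) : ℝ≥0∞ :=
  ∫⁻ t, ENNReal.ofReal (Real.exp (t / 2)) ∂gammaMeasure (μ + 1 / 2) 1

/-- The dependence on `γ` is explicit because the inner integral over `λ₂` has `γ = λ₁ ε₂`, which is
then integrated in `λ₁`. -/
lemma lintegral_exp_chiharaMeasure {μ : ℝ} (hμ : 0 < μ) (γ b : ℝ) :
    ∫⁻ x, ENNReal.ofReal (Real.exp (b * |x|)) ∂chiharaMeasure μ γ
      ≤ ENNReal.ofReal (Real.exp (b * |γ| + b ^ 2)) * gammaExpMoment μ := by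
  have hφ : Measurable fun x : ℝ => (x ^ 2 - γ ^ 2) / 2 := by fun_prop
  rw [gammaExpMoment, ← chiharaMeasure_map hμ γ, lintegral_map (by fun_prop) hφ,
    ← lintegral_const_mul _ (by fun_prop), lintegral_chiharaMeasure _ _ _ (by fun_prop),
    lintegral_chiharaMeasure _ _ _ (by fun_prop)]
  refine lintegral_mono fun x => ?_
  by_cases hx : |γ| < |x|
  · gcongr
    rw [← ENNReal.ofReal_mul (Real.exp_pos _).le, ← Real.exp_add]
    gcongr
    have h : 0 ≤ |x| - |γ| := by linarith
    have h0 := abs_nonneg γ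
    rw [← sq_abs x, ← sq_abs γ]
    -- With `h = |x| - |γ|`: `b h ≤ b² + h²/4 ≤ b² + (x² - γ²)/4`.
    nlinarith [sq_nonneg (b - (|x| - |γ|) / 2), mul_nonneg h h0]
  · simp [chiharaDensity, hx]

lemma gammaExpMoment_lt_top {μ : ℝ} (hμ : 0 < μ) : gammaExpMoment μ < ⊤ :=
  lintegral_exp_half_gammaMeasure (by positivity)

lemma integrable_of_expGrowth {E : Type*} [NormedAddCommGroup E] [MeasurableSpace E]
    [OpensMeasurableSpace E] {m : Measure E}
    (hm : ∀ b : ℝ, 0 ≤ b → ∫⁻ p, ENNReal.ofReal (Real.exp (b * ‖p‖)) ∂m < ⊤)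
    {f : E → ℝ} (hf : ExpGrowth f) : Integrable f m := by
  obtain ⟨mf, C, b, hC, hb, h⟩ := hf
  refine ⟨mf.aestronglyMeasurable, ?_⟩
  rw [hasFiniteIntegral_iff_norm]
  calc ∫⁻ p, ENNReal.ofReal ‖f p‖ ∂m
      ≤ ∫⁻ p, ENNReal.ofReal C * ENNReal.ofReal (Real.exp (b * ‖p‖)) ∂m := by
        refine lintegral_mono fun p => ?_
        rw [← ENNReal.ofReal_mul hC]
        exact ENNReal.ofReal_le_ofReal (h p)
    _ < ⊤ := by
        rw [lintegral_const_mul _ (by fun_prop)]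
        exact ENNReal.mul_lt_top ENNReal.ofReal_lt_top (hm b hb)

lemma ExpGrowth.integrable_chiharaMeasure {μ : ℝ} (hμ : 0 < μ) (γ : ℝ) {f : ℝ → ℝ}
    (hf : ExpGrowth f) : Integrable f (chiharaMeasure μ γ) :=
  integrable_of_expGrowth (fun b _ => by
    simp only [Real.norm_eq_abs]
    exact (lintegral_exp_chiharaMeasure hμ γ b).trans_lt
      (ENNReal.mul_lt_top ENNReal.ofReal_lt_top (gammaExpMoment_lt_top hμ))) hf

lemma integral_chihara {μ : ℝ} (hμ : 0 < μ) (γ : ℝ) (n : ℕ) :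
    ∫ x, chihara μ γ x n ∂chiharaMeasure μ γ = if n = 0 then 1 else 0 := by
  have hα : 0 < μ + 1 / 2 := by positivity
  rcases Nat.even_or_odd' n with ⟨k, rfl | rfl⟩
  · have h : ∀ x, chihara μ γ x (2 * k) = √(muFact μ (2 * k)) / muFact μ (2 * k)
        * laguerre k (μ + 1 / 2) (2 * ((x ^ 2 - γ ^ 2) / 2)) := by
      intro x
      rw [chihara_eq_divChihara hμ, (divChihara_one_even_odd hμ γ x k).1]
      ring_nf
    have hi := integral_laguerre k hα
    rw [← chiharaMeasure_map hμ γ, integral_map (by fun_prop)] at hi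
    · simp only [h]
      rw [integral_const_mul, hi]
      rcases eq_or_ne k 0 with rfl | hk
      · simp [muFact]
      · simp [hk]
    · rw [chiharaMeasure_map hμ γ]
      simpa using (integrable_laguerre k 0 (μ + 1 / 2) hα).aestronglyMeasurable
  · rw [if_neg (by omega), integral_chiharaMeasure hμ]
    -- The factors `x + γ` of the weight and `x - γ` of the polynomial multiply to an even function,
    -- so `sign x` makes the integrand odd.
    have hodd : ∀ x, chiharaDensity μ γ (-x) * chihara μ γ (-x) (2 * k + 1)
        = -(chiharaDensity μ γ x * chihara μ γ x (2 * k + 1)) := by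
      intro x
      rw [chihara_eq_divChihara hμ, chihara_eq_divChihara hμ,
        (divChihara_one_even_odd hμ γ x k).2, (divChihara_one_even_odd hμ γ (-x) k).2, neg_sq]
      unfold chiharaDensity chiharaWeight
      rw [abs_neg, Real.sign_neg, neg_sq]
      split_ifs <;> ring
    have := integral_neg_eq_self
      (fun x => chiharaDensity μ γ x * chihara μ γ x (2 * k + 1)) volume
    simp only [hodd, integral_neg] at this
    linarith

/-- Expanding `x P_m P_n` by the recurrence of either factor expresses the pairing of `P_{m+1}` with
`P_n` through pairings of smaller first index. The induction starts from the integral of a single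
`P_n`. -/
lemma integral_chihara_mul {μ : ℝ} (hμ : 0 < μ) (γ : ℝ) (m n : ℕ) :
    ∫ x, chihara μ γ x m * chihara μ γ x n ∂chiharaMeasure μ γ = if m = n then 1 else 0 := by
  have hP := fun n => ExpGrowth.chihara (E := ℝ) μ (ExpGrowth.const γ)
    (ExpGrowth.of_le_norm measurable_id 1 zero_le_one fun p => by simp) n
  have hI := fun m n => ((hP m).mul (hP n)).integrable_chiharaMeasure hμ γ
  simp only [id] at hI
  have hs := fun n => Real.mul_self_sqrt (muNumber_nonneg n hμ)
  have hpos := fun n => Real.sqrt_pos.2 (muNumber_succ_pos n hμ)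
  induction m using Nat.strong_induction_on generalizing n with
  | _ m ih =>
    cases m with
    | zero =>
      simp only [chihara, one_mul, integral_chihara hμ, eq_comm]
    | succ m =>
      have key : ∀ x, √(muNumber (m + 1) μ) * (chihara μ γ x (m + 1) * chihara μ γ x n)
          = √(muNumber (n + 1) μ) * (chihara μ γ x m * chihara μ γ x (n + 1))
          + γ * ((-1) ^ n - (-1) ^ m) * (chihara μ γ x m * chihara μ γ x n)
          + √(muNumber n μ) * (chihara μ γ x m * chihara μ γ x (n - 1))
          - √(muNumber m μ) * (chihara μ γ x (m - 1) * chihara μ γ x n) := by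
        intro x
        linear_combination chihara μ γ x m * mul_chihara hμ γ x n
          - chihara μ γ x n * mul_chihara hμ γ x m
      have h := congrArg (fun f : ℝ → ℝ => ∫ x, f x ∂chiharaMeasure μ γ) (funext key)
      rw [integral_sub, integral_add, integral_add, integral_const_mul, integral_const_mul,
        integral_const_mul, integral_const_mul, integral_const_mul, ih m (by omega),
        ih m (by omega), ih m (by omega)] at h
      rotate_left
      · exact (hI _ _).const_mul _
      · exact (hI _ _).const_mul _
      · exact ((hI _ _).const_mul _).add ((hI _ _).const_mul _)
      · exact (hI _ _).const_mul _
      · exact (((hI _ _).const_mul _).add ((hI _ _).const_mul _)).add ((hI _ _).const_mul _)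
      · exact (hI _ _).const_mul _
      have hm : √(muNumber m μ) * ∫ x, chihara μ γ x (m - 1) * chihara μ γ x n
          ∂chiharaMeasure μ γ = √(muNumber m μ) * if m - 1 = n then 1 else 0 := by
        cases m with
        | zero => simp
        | succ m => rw [Nat.add_sub_cancel, ih m (by omega)]
      have hm0 : γ * ((-1) ^ n - (-1) ^ m) * (if m = n then 1 else 0 : ℝ) = 0 := by
        split_ifs with h <;> simp [h]
      rw [hm, hm0] at h
      have h2 : √(muNumber (m + 1) μ) * ∫ x, chihara μ γ x (m + 1) * chihara μ γ x n
          ∂chiharaMeasure μ γ = √(muNumber (m + 1) μ) * if m + 1 = n then 1 else 0 := by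
        rw [h]
        rcases eq_or_ne (m + 1) n with rfl | h1
        · simp
          intro h; omega
        · rw [if_neg h1]
          rcases eq_or_ne m (n + 1) with rfl | h3
          · have : n + 1 ≠ n - 1 := by omega
            simp [this]
          · rw [if_neg h3]
            have a1 : √(muNumber n μ) * (if m = n - 1 then 1 else 0 : ℝ) = 0 := by
              split_ifs with h5
              · obtain rfl : n = 0 := by omega
                simp
              · simp
            have a2 : √(muNumber m μ) * (if m - 1 = n then 1 else 0 : ℝ) = 0 := by
              split_ifs with h5
              · obtain rfl : m = 0 := by omega
                simp
              · simp
            rw [a1, a2]; ring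
      exact mul_left_cancel₀ (hpos m).ne' h2

/-! ## The two-variable measure -/

/-- Because `|x ε| = |x|`, the region `G` is exactly where both one-variable densities are switched
on. In product form the measure can be integrated iteratively. -/
lemma measG_eq_withDensity {μ₁ ε₁ ε₂ : ℝ} (μ₂ c : ℝ) (h₁ : 0 < μ₁)
    (hε₁ : ε₁ ^ 2 = 1) (hε₂ : ε₂ ^ 2 = 1) :
    measG μ₁ μ₂ ε₁ ε₂ c = volume.withDensity fun p : ℝ × ℝ =>
      ENNReal.ofReal (chiharaDensity μ₁ (c * ε₁) p.1)
        * ENNReal.ofReal (chiharaDensity μ₂ (p.1 * ε₂) p.2) := by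
  have hG : MeasurableSet (regionG c) := by
    unfold regionG
    exact (measurableSet_lt measurable_const measurable_fst.abs).inter
      (measurableSet_lt measurable_fst.abs measurable_snd.abs)
  rw [measG, ← withDensity_indicator hG]
  have ha : ∀ {ε : ℝ} (_ : ε ^ 2 = 1) (x : ℝ), |x * ε| = |x| := by
    intro ε hε x
    rw [← sq_eq_sq₀ (abs_nonneg _) (abs_nonneg _), sq_abs, sq_abs, mul_pow, hε, mul_one]
  congr 1
  ext p
  by_cases h1 : |c| < |p.1|
  · by_cases h2 : |p.1| < |p.2|
    · have h1' : |c * ε₁| < |p.1| := by rwa [ha hε₁]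
      rw [Set.indicator_of_mem (show p ∈ regionG c from ⟨h1, h2⟩),
        ENNReal.ofReal_mul (chiharaWeight_nonneg h₁ h1'), chiharaDensity, chiharaDensity,
        if_pos h1', if_pos (by rwa [ha hε₂])]
    · rw [Set.indicator_of_notMem (fun h => h2 h.2), chiharaDensity, chiharaDensity,
        ha hε₂, if_neg h2]
      simp
  · rw [Set.indicator_of_notMem (fun h => h1 h.1), chiharaDensity, ha hε₁, if_neg h1]
    simp

lemma measurable_ofReal_chiharaDensity {E : Type*} [MeasurableSpace E] (μ : ℝ) {γ x : E → ℝ}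
    (hγ : Measurable γ) (hx : Measurable x) :
    Measurable fun p => ENNReal.ofReal (chiharaDensity μ (γ p) (x p)) :=
  (measurable_chiharaDensity μ hγ hx).ennreal_ofReal

lemma lintegral_measG {μ₁ ε₁ ε₂ : ℝ} (μ₂ c : ℝ) (h₁ : 0 < μ₁)
    (hε₁ : ε₁ ^ 2 = 1) (hε₂ : ε₂ ^ 2 = 1) {f : ℝ × ℝ → ℝ≥0∞} (hf : Measurable f) :
    ∫⁻ p, f p ∂measG μ₁ μ₂ ε₁ ε₂ c
      = ∫⁻ x, ENNReal.ofReal (chiharaDensity μ₁ (c * ε₁) x)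
        * ∫⁻ y, f (x, y) ∂chiharaMeasure μ₂ (x * ε₂) := by
  have m1 := measurable_ofReal_chiharaDensity μ₁ (E := ℝ × ℝ)
    (measurable_const (a := c * ε₁)) measurable_fst
  have m2 := measurable_ofReal_chiharaDensity μ₂ (E := ℝ × ℝ)
    (measurable_fst.mul_const ε₂) measurable_snd
  have m12 : Measurable fun p : ℝ × ℝ => ENNReal.ofReal (chiharaDensity μ₁ (c * ε₁) p.1)
      * ENNReal.ofReal (chiharaDensity μ₂ (p.1 * ε₂) p.2) := m1.mul m2
  rw [measG_eq_withDensity μ₂ c h₁ hε₁ hε₂, lintegral_withDensity_eq_lintegral_mul _ m12 hf,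
    Measure.volume_eq_prod, lintegral_prod _ (m12.mul hf).aemeasurable]
  refine lintegral_congr fun x => ?_
  rw [lintegral_chiharaMeasure _ _ (fun y => f (x, y)) (hf.comp measurable_prodMk_left),
    ← lintegral_const_mul]
  · simp only [Pi.mul_apply, mul_assoc]
  · exact (m2.mul hf).comp measurable_prodMk_left

/-- The inner exponential moment grows at most like `exp(b |x|)` in the outer variable, so the outer
one still converges. -/
lemma lintegral_exp_norm_measG_lt_top {μ₁ μ₂ ε₁ ε₂ : ℝ} (c : ℝ) (h₁ : 0 < μ₁) (h₂ : 0 < μ₂)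
    (hε₁ : ε₁ ^ 2 = 1) (hε₂ : ε₂ ^ 2 = 1) {b : ℝ} (hb : 0 ≤ b) :
    ∫⁻ p, ENNReal.ofReal (Real.exp (b * ‖p‖)) ∂measG μ₁ μ₂ ε₁ ε₂ c < ⊤ := by
  have ha : ∀ x, |x * ε₂| = |x| := by
    intro x
    rw [← sq_eq_sq₀ (abs_nonneg _) (abs_nonneg _), sq_abs, sq_abs, mul_pow, hε₂, mul_one]
  have hin : ∀ x : ℝ, ∫⁻ y, ENNReal.ofReal (Real.exp (b * ‖(x, y)‖)) ∂chiharaMeasure μ₂ (x * ε₂)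
      ≤ (ENNReal.ofReal (Real.exp (b ^ 2)) * gammaExpMoment μ₂)
        * ENNReal.ofReal (Real.exp ((2 * b) * |x|)) := by
    intro x
    calc ∫⁻ y, ENNReal.ofReal (Real.exp (b * ‖(x, y)‖)) ∂chiharaMeasure μ₂ (x * ε₂)
        ≤ ∫⁻ y, ENNReal.ofReal (Real.exp (b * |x|)) * ENNReal.ofReal (Real.exp (b * |y|))
          ∂chiharaMeasure μ₂ (x * ε₂) := by
          refine lintegral_mono fun y => ?_
          rw [← ENNReal.ofReal_mul (Real.exp_pos _).le, ← Real.exp_add, ← mul_add]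
          gcongr
          exact max_le (le_add_of_nonneg_right (abs_nonneg y)) (le_add_of_nonneg_left (abs_nonneg x))
      _ ≤ ENNReal.ofReal (Real.exp (b * |x|))
          * (ENNReal.ofReal (Real.exp (b * |x| + b ^ 2)) * gammaExpMoment μ₂) := by
          rw [lintegral_const_mul _ (by fun_prop)]
          gcongr
          simpa only [ha] using lintegral_exp_chiharaMeasure h₂ (x * ε₂) b
      _ = _ := by
          rw [← mul_assoc, ← ENNReal.ofReal_mul (Real.exp_pos _).le, mul_right_comm,
            ← ENNReal.ofReal_mul (Real.exp_pos _).le, ← Real.exp_add, ← Real.exp_add]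
          ring_nf
  rw [lintegral_measG μ₂ c h₁ hε₁ hε₂ (by fun_prop)]
  calc _ ≤ ∫⁻ x, ENNReal.ofReal (chiharaDensity μ₁ (c * ε₁) x)
        * ((ENNReal.ofReal (Real.exp (b ^ 2)) * gammaExpMoment μ₂)
        * ENNReal.ofReal (Real.exp ((2 * b) * |x|))) :=
        lintegral_mono fun x => mul_le_mul_right (hin x) _
    _ = (ENNReal.ofReal (Real.exp (b ^ 2)) * gammaExpMoment μ₂)
        * ∫⁻ x, ENNReal.ofReal (Real.exp ((2 * b) * |x|)) ∂chiharaMeasure μ₁ (c * ε₁) := by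
        rw [← lintegral_const_mul _ (by fun_prop), lintegral_chiharaMeasure _ _ _ (by fun_prop)]
    _ < ⊤ := by
        refine ENNReal.mul_lt_top (ENNReal.mul_lt_top ENNReal.ofReal_lt_top
          (gammaExpMoment_lt_top h₂)) ((lintegral_exp_chiharaMeasure h₁ _ _).trans_lt
          (ENNReal.mul_lt_top ENNReal.ofReal_lt_top (gammaExpMoment_lt_top h₁)))

lemma ExpGrowth.integrable_measG {μ₁ μ₂ ε₁ ε₂ : ℝ} (c : ℝ) (h₁ : 0 < μ₁) (h₂ : 0 < μ₂)
    (hε₁ : ε₁ ^ 2 = 1) (hε₂ : ε₂ ^ 2 = 1) {f : ℝ × ℝ → ℝ} (hf : ExpGrowth f) :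
    Integrable f (measG μ₁ μ₂ ε₁ ε₂ c) :=
  integrable_of_expGrowth (fun _ hb => lintegral_exp_norm_measG_lt_top c h₁ h₂ hε₁ hε₂ hb) hf

lemma ExpGrowth.memLp_measG {μ₁ μ₂ ε₁ ε₂ : ℝ} (c : ℝ) (h₁ : 0 < μ₁) (h₂ : 0 < μ₂)
    (hε₁ : ε₁ ^ 2 = 1) (hε₂ : ε₂ ^ 2 = 1) {f : ℝ × ℝ → ℝ} (hf : ExpGrowth f) :
    MemLp f 2 (measG μ₁ μ₂ ε₁ ε₂ c) := by
  rw [memLp_two_iff_integrable_sq hf.1.aestronglyMeasurable]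
  simpa only [sq] using (hf.mul hf).integrable_measG c h₁ h₂ hε₁ hε₂

lemma integral_measG {μ₁ μ₂ ε₁ ε₂ : ℝ} (c : ℝ) (h₁ : 0 < μ₁) (h₂ : 0 < μ₂)
    (hε₁ : ε₁ ^ 2 = 1) (hε₂ : ε₂ ^ 2 = 1) {f : ℝ × ℝ → ℝ}
    (hf : Integrable f (measG μ₁ μ₂ ε₁ ε₂ c)) :
    ∫ p, f p ∂measG μ₁ μ₂ ε₁ ε₂ c
      = ∫ x, ∫ y, f (x, y) ∂chiharaMeasure μ₂ (x * ε₂) ∂chiharaMeasure μ₁ (c * ε₁) := by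
  have m1 := measurable_ofReal_chiharaDensity μ₁ (E := ℝ × ℝ)
    (measurable_const (a := c * ε₁)) measurable_fst
  have m2 := measurable_ofReal_chiharaDensity μ₂ (E := ℝ × ℝ)
    (measurable_fst.mul_const ε₂) measurable_snd
  have m12 : Measurable fun p : ℝ × ℝ => ENNReal.ofReal (chiharaDensity μ₁ (c * ε₁) p.1)
      * ENNReal.ofReal (chiharaDensity μ₂ (p.1 * ε₂) p.2) := m1.mul m2
  have hfin : ∀ᵐ p : ℝ × ℝ, (ENNReal.ofReal (chiharaDensity μ₁ (c * ε₁) p.1)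
      * ENNReal.ofReal (chiharaDensity μ₂ (p.1 * ε₂) p.2)) < ⊤ :=
    Filter.Eventually.of_forall fun _ => ENNReal.mul_lt_top ENNReal.ofReal_lt_top
      ENNReal.ofReal_lt_top
  have e : ∀ p : ℝ × ℝ, (ENNReal.ofReal (chiharaDensity μ₁ (c * ε₁) p.1)
      * ENNReal.ofReal (chiharaDensity μ₂ (p.1 * ε₂) p.2)).toReal
      = chiharaDensity μ₁ (c * ε₁) p.1 * chiharaDensity μ₂ (p.1 * ε₂) p.2 := fun p => by
    rw [ENNReal.toReal_mul, ENNReal.toReal_ofReal (chiharaDensity_nonneg h₁ _ _),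
      ENNReal.toReal_ofReal (chiharaDensity_nonneg h₂ _ _)]
  rw [measG_eq_withDensity μ₂ c h₁ hε₁ hε₂] at hf ⊢
  rw [integrable_withDensity_iff_integrable_smul' m12 hfin] at hf
  rw [integral_withDensity_eq_integral_toReal_smul m12 hfin]
  simp only [e, smul_eq_mul] at hf ⊢
  rw [Measure.volume_eq_prod] at hf ⊢
  rw [integral_prod _ hf, integral_chiharaMeasure h₁]
  congr 1
  ext x
  rw [integral_chiharaMeasure h₂, ← integral_const_mul]
  simp only [mul_assoc]

/-- The two-variable polynomials `P_n(x; μ₁, c ε₁) P_m(y; μ₂, x ε₂)`. -/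
def chihara₂ (μ₁ μ₂ ε₁ ε₂ c : ℝ) (q : ℕ × ℕ) (p : ℝ × ℝ) : ℝ :=
  chihara μ₁ (c * ε₁) p.1 q.1 * chihara μ₂ (p.1 * ε₂) p.2 q.2

lemma expGrowth_fst : ExpGrowth fun p : ℝ × ℝ => p.1 :=
  ExpGrowth.of_le_norm measurable_fst 1 zero_le_one fun p => by
    rw [one_mul]; exact le_max_left |p.1| |p.2|

lemma expGrowth_snd : ExpGrowth fun p : ℝ × ℝ => p.2 :=
  ExpGrowth.of_le_norm measurable_snd 1 zero_le_one fun p => by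
    rw [one_mul]; exact le_max_right |p.1| |p.2|

lemma expGrowth_chihara₂ (μ₁ μ₂ ε₁ ε₂ c : ℝ) (q : ℕ × ℕ) :
    ExpGrowth (chihara₂ μ₁ μ₂ ε₁ ε₂ c q) :=
  (ExpGrowth.chihara μ₁ (ExpGrowth.const _) expGrowth_fst q.1).mul
    (ExpGrowth.chihara μ₂ (expGrowth_fst.mul (ExpGrowth.const ε₂)) expGrowth_snd q.2)

/-- The inner integral is a Kronecker delta whatever the value of its parameter `λ₁ ε₂`, so the
outer one decouples. -/
lemma integral_chihara₂_mul {μ₁ μ₂ ε₁ ε₂ : ℝ} (c : ℝ) (h₁ : 0 < μ₁) (h₂ : 0 < μ₂)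
    (hε₁ : ε₁ ^ 2 = 1) (hε₂ : ε₂ ^ 2 = 1) (q r : ℕ × ℕ) :
    ∫ p, chihara₂ μ₁ μ₂ ε₁ ε₂ c q p * chihara₂ μ₁ μ₂ ε₁ ε₂ c r p ∂measG μ₁ μ₂ ε₁ ε₂ c
      = if q = r then 1 else 0 := by
  rw [integral_measG c h₁ h₂ hε₁ hε₂ (((expGrowth_chihara₂ μ₁ μ₂ ε₁ ε₂ c q).mul
    (expGrowth_chihara₂ μ₁ μ₂ ε₁ ε₂ c r)).integrable_measG c h₁ h₂ hε₁ hε₂)]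
  simp only [chihara₂, mul_mul_mul_comm, integral_const_mul, integral_chihara_mul h₂,
    integral_mul_const, integral_chihara_mul h₁, Prod.ext_iff]
  split_ifs <;> simp_all

/-! ## Completeness of the two-variable polynomials -/

/-- An integrand orthogonal to the powers of all linear forms vanishes. -/
lemma ae_eq_zero_of_integral_pow_eq_zero {E : Type*} [NormedAddCommGroup E] [NormedSpace ℝ E]
    [CompleteSpace E] [MeasurableSpace E] [BorelSpace E] [SecondCountableTopology E] {m : Measure E}
    {g : E → ℝ}
    (hg : ∀ b : ℝ, Integrable (fun p => Real.exp (b * ‖p‖) * g p) m)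
    (h0 : ∀ (L : StrongDual ℝ E) (k : ℕ), ∫ p, (L p) ^ k * g p ∂m = 0) : g =ᵐ[m] 0 := by
  have hgi : Integrable g m := by simpa using hg 0
  -- The Fourier transform of `g` vanishes: expand the exponential and integrate termwise, dominated
  -- by `exp(‖L‖ ‖p‖) |g p|`.
  have hchar : ∀ L : StrongDual ℝ E, ∫ p, Complex.exp (L p * Complex.I) * (g p : ℂ) ∂m = 0 := by
    intro L
    have hs := hasSum_integral_of_dominated_convergence (μ := m)
      (F := fun (k : ℕ) p => (((L p : ℂ) * Complex.I) ^ k / (k.factorial : ℂ)) * (g p : ℂ))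
      (f := fun p => Complex.exp (L p * Complex.I) * (g p : ℂ))
      (fun k p => (|L p| ^ k / k.factorial) * |g p|) ?_ ?_ ?_ ?_ ?_
    · have hz : ∀ k : ℕ, ∫ p, (((L p : ℂ) * Complex.I) ^ k / (k.factorial : ℂ)) * (g p : ℂ) ∂m
          = 0 := by
        intro k
        have : ∀ p, (((L p : ℂ) * Complex.I) ^ k / (k.factorial : ℂ)) * (g p : ℂ)
            = (Complex.I ^ k / k.factorial) * (((L p) ^ k * g p : ℝ) : ℂ) := fun p => by
          push_cast; ring
        simp only [this]
        have h1 := integral_ofReal (𝕜 := ℂ) (f := fun p => (L p) ^ k * g p) (μ := m)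
        rw [h0] at h1
        rw [integral_const_mul]
        exact mul_eq_zero_of_right _ (h1.trans Complex.ofReal_zero)
      simp only [hz] at hs
      exact hs.unique hasSum_zero
    · intro k
      have h1 : AEStronglyMeasurable (fun p => ((L p : ℂ) * Complex.I) ^ k / (k.factorial : ℂ)) m :=
        (by fun_prop : Continuous fun p => ((L p : ℂ) * Complex.I) ^ k
          / (k.factorial : ℂ)).aestronglyMeasurable
      exact h1.mul (Complex.continuous_ofReal.comp_aestronglyMeasurable hgi.1)
    · intro k
      refine Filter.Eventually.of_forall fun p => ?_
      simp
    · refine Filter.Eventually.of_forall fun p => ?_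
      exact (Real.summable_pow_div_factorial |L p|).mul_right _
    · have : ∀ p, ∑' k : ℕ, (|L p| ^ k / k.factorial) * |g p| = Real.exp |L p| * |g p| := by
        intro p
        rw [tsum_mul_right, Real.exp_eq_exp_ℝ, NormedSpace.exp_eq_tsum_div]
      simp only [this]
      refine (hg ‖L‖).mono ?_ ?_
      · exact (by fun_prop : Continuous fun p => Real.exp |L p|).aestronglyMeasurable.mul hgi.1.norm
      · refine Filter.Eventually.of_forall fun p => ?_
        rw [norm_mul, norm_mul, Real.norm_eq_abs, Real.norm_eq_abs, Real.norm_eq_abs, abs_abs,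
          Real.abs_exp, Real.norm_eq_abs, Real.abs_exp]
        gcongr
        exact L.le_opNorm p
    · refine Filter.Eventually.of_forall fun p => ?_
      have := NormedSpace.expSeries_div_hasSum_exp ((L p : ℂ) * Complex.I)
      rw [← Complex.exp_eq_exp_ℂ] at this
      exact this.mul_right _
  have hint : ∀ L : StrongDual ℝ E, ∀ h : E → ℝ, Integrable h m →
      Integrable (fun p => Complex.exp (L p * Complex.I) * (h p : ℂ)) m := by
    intro L h hh
    refine hh.ofReal.bdd_mul (c := 1) ?_ (Filter.Eventually.of_forall fun p => ?_)
    · exact (by fun_prop : Continuous fun p => Complex.exp (L p * Complex.I)).aestronglyMeasurable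
    · rw [Complex.norm_exp_ofReal_mul_I]
  have ham : ∀ h : E → ℝ, Integrable h m → AEMeasurable (fun p => ENNReal.ofReal (h p)) m :=
    fun h hh => hh.1.aemeasurable.ennreal_ofReal
  have hfin : ∀ h : E → ℝ, Integrable h m →
      IsFiniteMeasure (m.withDensity fun p => ENNReal.ofReal (h p)) := fun h hh =>
    isFiniteMeasure_withDensity_ofReal hh.2
  have hcf : ∀ h : E → ℝ, Integrable h m → ∀ L : StrongDual ℝ E,
      charFunDual (m.withDensity fun p => ENNReal.ofReal (h p)) L
        = ∫ p, Complex.exp (L p * Complex.I) * ((max (h p) 0 : ℝ) : ℂ) ∂m := by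
    intro h hh L
    rw [charFunDual_apply, integral_withDensity_eq_integral_toReal_smul₀ (ham h hh)
      (Filter.Eventually.of_forall fun _ => ENNReal.ofReal_lt_top)]
    refine integral_congr_ae (Filter.Eventually.of_forall fun p => ?_)
    simp only [ENNReal.toReal_ofReal', Complex.real_smul]
    ring
  have hneg : Integrable (fun p => -g p) m := hgi.neg
  have := hfin g hgi
  have := hfin _ hneg
  -- The positive and negative parts of `g` define finite measures with the same characteristic
  -- function.
  have heq : m.withDensity (fun p => ENNReal.ofReal (g p))
      = m.withDensity (fun p => ENNReal.ofReal (-g p)) := by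
    refine Measure.ext_of_charFunDual (funext fun L => ?_)
    rw [hcf g hgi, hcf _ hneg, ← sub_eq_zero, ← integral_sub (hint L _ hgi.pos_part)
      (hint L _ hneg.pos_part), ← hchar L]
    refine integral_congr_ae (Filter.Eventually.of_forall fun p => ?_)
    simp only
    rw [← mul_sub, ← Complex.ofReal_sub]
    congr 3
    rcases le_total 0 (g p) with h | h
    · rw [max_eq_left h, max_eq_right (by linarith), sub_zero]
    · rw [max_eq_right h, max_eq_left (by linarith)]; ring
  rw [withDensity_eq_iff (ham g hgi) (ham _ hneg) (by
    have := hgi.lintegral_lt_top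
    exact this.ne)] at heq
  filter_upwards [heq] with p hp
  rcases lt_trichotomy 0 (g p) with h | h | h
  · rw [ENNReal.ofReal_of_nonpos (p := -g p) (by linarith), ENNReal.ofReal_eq_zero] at hp
    exact absurd hp h.not_ge
  · exact h.symm
  · rw [ENNReal.ofReal_of_nonpos h.le, eq_comm, ENNReal.ofReal_eq_zero] at hp
    exact absurd hp (by linarith)

/-- The second recurrence has `γ = λ₁ ε₂`; the factor `λ₁` it produces is expanded by the first
recurrence. The result is the matrix of `Δ(J_+ + J_- + cR)`. -/
lemma mul_chihara₂_snd {μ₁ μ₂ : ℝ} (h₁ : 0 < μ₁) (h₂ : 0 < μ₂) (ε₁ ε₂ c : ℝ) (n m : ℕ)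
    (p : ℝ × ℝ) : p.2 * chihara₂ μ₁ μ₂ ε₁ ε₂ c (n, m) p
      = √(muNumber (m + 1) μ₂) * chihara₂ μ₁ μ₂ ε₁ ε₂ c (n, m + 1) p
        + √(muNumber m μ₂) * chihara₂ μ₁ μ₂ ε₁ ε₂ c (n, m - 1) p
        + ε₂ * (-1) ^ m * (√(muNumber (n + 1) μ₁) * chihara₂ μ₁ μ₂ ε₁ ε₂ c (n + 1, m) p
          + c * ε₁ * (-1) ^ n * chihara₂ μ₁ μ₂ ε₁ ε₂ c (n, m) p
          + √(muNumber n μ₁) * chihara₂ μ₁ μ₂ ε₁ ε₂ c (n - 1, m) p) := by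
  unfold chihara₂
  linear_combination chihara μ₁ (c * ε₁) p.1 n * mul_chihara h₂ (p.1 * ε₂) p.2 m
    + ε₂ * (-1) ^ m * chihara μ₂ (p.1 * ε₂) p.2 m * mul_chihara h₁ (c * ε₁) p.1 n

lemma mul_chihara₂_fst {μ₁ : ℝ} (h₁ : 0 < μ₁) (μ₂ ε₁ ε₂ c : ℝ) (n m : ℕ)
    (p : ℝ × ℝ) : p.1 * chihara₂ μ₁ μ₂ ε₁ ε₂ c (n, m) p
      = √(muNumber (n + 1) μ₁) * chihara₂ μ₁ μ₂ ε₁ ε₂ c (n + 1, m) p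
          + c * ε₁ * (-1) ^ n * chihara₂ μ₁ μ₂ ε₁ ε₂ c (n, m) p
          + √(muNumber n μ₁) * chihara₂ μ₁ μ₂ ε₁ ε₂ c (n - 1, m) p := by
  unfold chihara₂
  linear_combination chihara μ₂ (p.1 * ε₂) p.2 m * mul_chihara h₁ (c * ε₁) p.1 n

/-- The span of the two-variable polynomials is stable under multiplication by a function which
maps the polynomials to the span. -/
lemma mul_mem_span_of_mul_mem_span {ι X : Type*} {P : ι → X → ℝ} {l : X → ℝ}
    (h : ∀ i, l * P i ∈ Submodule.span ℝ (Set.range P)) {F : X → ℝ}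
    (hF : F ∈ Submodule.span ℝ (Set.range P)) : l * F ∈ Submodule.span ℝ (Set.range P) := by
  induction hF using Submodule.span_induction with
  | mem F hF => obtain ⟨i, rfl⟩ := hF; exact h i
  | zero => simp
  | add F G _ _ hF hG => rw [mul_add]; exact add_mem hF hG
  | smul a F _ hF => rw [mul_smul_comm]; exact Submodule.smul_mem _ a hF

lemma linear_pow_mem_span {μ₁ μ₂ : ℝ} (h₁ : 0 < μ₁) (h₂ : 0 < μ₂) (ε₁ ε₂ c : ℝ)
    (L : StrongDual ℝ (ℝ × ℝ)) (k : ℕ) : (fun p => (L p) ^ k)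
      ∈ Submodule.span ℝ (Set.range (chihara₂ μ₁ μ₂ ε₁ ε₂ c)) := by
  have hP : ∀ q (a : ℝ), a • chihara₂ μ₁ μ₂ ε₁ ε₂ c q
      ∈ Submodule.span ℝ (Set.range (chihara₂ μ₁ μ₂ ε₁ ε₂ c)) := fun q a =>
    Submodule.smul_mem _ _ (Submodule.subset_span ⟨q, rfl⟩)
  have m1 : ∀ q, Prod.fst * chihara₂ μ₁ μ₂ ε₁ ε₂ c q
      ∈ Submodule.span ℝ (Set.range (chihara₂ μ₁ μ₂ ε₁ ε₂ c)) := by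
    rintro ⟨n, m⟩
    have : Prod.fst * chihara₂ μ₁ μ₂ ε₁ ε₂ c (n, m)
        = √(muNumber (n + 1) μ₁) • chihara₂ μ₁ μ₂ ε₁ ε₂ c (n + 1, m)
          + (c * ε₁ * (-1) ^ n) • chihara₂ μ₁ μ₂ ε₁ ε₂ c (n, m)
          + √(muNumber n μ₁) • chihara₂ μ₁ μ₂ ε₁ ε₂ c (n - 1, m) := by
      ext p; exact mul_chihara₂_fst h₁ μ₂ ε₁ ε₂ c n m p
    rw [this]
    exact add_mem (add_mem (hP _ _) (hP _ _)) (hP _ _)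
  have m2 : ∀ q, Prod.snd * chihara₂ μ₁ μ₂ ε₁ ε₂ c q
      ∈ Submodule.span ℝ (Set.range (chihara₂ μ₁ μ₂ ε₁ ε₂ c)) := by
    rintro ⟨n, m⟩
    have : Prod.snd * chihara₂ μ₁ μ₂ ε₁ ε₂ c (n, m)
        = √(muNumber (m + 1) μ₂) • chihara₂ μ₁ μ₂ ε₁ ε₂ c (n, m + 1)
        + √(muNumber m μ₂) • chihara₂ μ₁ μ₂ ε₁ ε₂ c (n, m - 1)
        + (ε₂ * (-1) ^ m) • (√(muNumber (n + 1) μ₁) • chihara₂ μ₁ μ₂ ε₁ ε₂ c (n + 1, m)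
          + (c * ε₁ * (-1) ^ n) • chihara₂ μ₁ μ₂ ε₁ ε₂ c (n, m)
          + √(muNumber n μ₁) • chihara₂ μ₁ μ₂ ε₁ ε₂ c (n - 1, m)) := by
      ext p; exact mul_chihara₂_snd h₁ h₂ ε₁ ε₂ c n m p
    rw [this]
    exact add_mem (add_mem (hP _ _) (hP _ _)) (Submodule.smul_mem _ _
      (add_mem (add_mem (hP _ _) (hP _ _)) (hP _ _)))
  induction k with
  | zero =>
    refine Submodule.subset_span ⟨(0, 0), ?_⟩
    ext p
    simp [chihara₂, chihara]
  | succ k ih =>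
    have hL : (fun p => (L p) ^ (k + 1)) = L (1, 0) • (Prod.fst * fun p => (L p) ^ k)
        + L (0, 1) • (Prod.snd * fun p => (L p) ^ k) := by
      ext p
      have : L p = p.1 * L (1, 0) + p.2 * L (0, 1) := by
        rw [← smul_eq_mul, ← smul_eq_mul, ← map_smul, ← map_smul, ← map_add]
        simp
      simp only [Pi.add_apply, Pi.smul_apply, Pi.mul_apply, smul_eq_mul]
      rw [pow_succ]
      nth_rw 2 [this]
      ring
    rw [hL]
    exact add_mem (Submodule.smul_mem _ _ (mul_mem_span_of_mul_mem_span m1 ih))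
      (Submodule.smul_mem _ _ (mul_mem_span_of_mul_mem_span m2 ih))

lemma ae_eq_zero_of_integral_chihara₂_eq_zero {μ₁ μ₂ ε₁ ε₂ : ℝ} (c : ℝ) (h₁ : 0 < μ₁)
    (h₂ : 0 < μ₂) (hε₁ : ε₁ ^ 2 = 1) (hε₂ : ε₂ ^ 2 = 1) {g : ℝ × ℝ → ℝ}
    (hg : MemLp g 2 (measG μ₁ μ₂ ε₁ ε₂ c))
    (h0 : ∀ q, ∫ p, chihara₂ μ₁ μ₂ ε₁ ε₂ c q p * g p ∂measG μ₁ μ₂ ε₁ ε₂ c = 0) :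
    g =ᵐ[measG μ₁ μ₂ ε₁ ε₂ c] 0 := by
  have hI : ∀ {f : ℝ × ℝ → ℝ}, ExpGrowth f →
      Integrable (fun p => f p * g p) (measG μ₁ μ₂ ε₁ ε₂ c) := fun hf =>
    (hf.memLp_measG c h₁ h₂ hε₁ hε₂).integrable_mul hg
  refine ae_eq_zero_of_integral_pow_eq_zero (fun b => hI (ExpGrowth.exp_norm b)) fun L k => ?_
  have key : ∀ F ∈ Submodule.span ℝ (Set.range (chihara₂ μ₁ μ₂ ε₁ ε₂ c)),
      ExpGrowth F ∧ ∫ p, F p * g p ∂measG μ₁ μ₂ ε₁ ε₂ c = 0 := by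
    intro F hF
    induction hF using Submodule.span_induction with
    | mem F hF => obtain ⟨q, rfl⟩ := hF; exact ⟨expGrowth_chihara₂ _ _ _ _ _ _, h0 q⟩
    | zero => exact ⟨ExpGrowth.const 0, by simp⟩
    | add F G _ _ hF hG =>
      refine ⟨hF.1.add hG.1, ?_⟩
      simp only [Pi.add_apply, add_mul]
      rw [integral_add (hI hF.1) (hI hG.1), hF.2, hG.2, add_zero]
    | smul a F _ hF =>
      refine ⟨(ExpGrowth.const a).mul hF.1, ?_⟩
      simp only [Pi.smul_apply, smul_eq_mul, mul_assoc]
      rw [integral_const_mul, hF.2, mul_zero]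
  exact (key _ (linear_pow_mem_span h₁ h₂ ε₁ ε₂ c L k)).2

/-! ## The tensor product of two discrete series representations -/

/-- The product basis of `FinSpan ⊗ FinSpan`. -/
def tensorBasis : Module.Basis (ℕ × ℕ) ℂ (FinSpan ⊗[ℂ] FinSpan) :=
  Finsupp.basisSingleOne.tensorProduct Finsupp.basisSingleOne

@[simp] lemma tensorBasis_apply (q : ℕ × ℕ) : tensorBasis q = bvec q.1 ⊗ₜ[ℂ] bvec q.2 := by
  simp [tensorBasis, Module.Basis.tensorProduct_apply', bvec]

lemma tensor_induction {p : FinSpan ⊗[ℂ] FinSpan → Prop} (h0 : p 0)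
    (hadd : ∀ v w, p v → p w → p (v + w)) (hsmul : ∀ (a : ℂ) v, p v → p (a • v))
    (hb : ∀ n m, p (bvec n ⊗ₜ bvec m)) (v : FinSpan ⊗[ℂ] FinSpan) : p v := by
  have hv : v ∈ Submodule.span ℂ (Set.range tensorBasis) := by
    rw [tensorBasis.span_eq]; trivial
  induction hv using Submodule.span_induction with
  | mem v hv => obtain ⟨q, rfl⟩ := hv; rw [tensorBasis_apply]; exact hb _ _
  | zero => exact h0
  | add v w _ _ hv hw => exact hadd v w hv hw
  | smul a v _ hv => exact hsmul a v hv

lemma tensor_linearMap_ext {M : Type*} [AddCommMonoid M] [Module ℂ M]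
    {f g : FinSpan ⊗[ℂ] FinSpan →ₗ[ℂ] M}
    (h : ∀ n m, f (bvec n ⊗ₜ bvec m) = g (bvec n ⊗ₜ bvec m)) : f = g :=
  tensorBasis.ext fun q => by rw [tensorBasis_apply]; exact h q.1 q.2

lemma coprodJ0_bvec (μ₁ μ₂ : ℝ) (n m : ℕ) : coprodJ0 μ₁ μ₂ (bvec n ⊗ₜ bvec m)
    = (((n + m : ℕ) + μ₁ + μ₂ + 1 : ℝ) : ℂ) • (bvec n ⊗ₜ[ℂ] bvec m) := by
  have : (((n + m : ℕ) + μ₁ + μ₂ + 1 : ℝ) : ℂ)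
      = ((n + μ₁ + 1 / 2 : ℝ) : ℂ) + ((m + μ₂ + 1 / 2 : ℝ) : ℂ) := by
    push_cast; ring
  rw [this, add_smul]
  simp only [coprodJ0, repJ0, LinearMap.add_apply, TensorProduct.map_tmul, LinearMap.id_apply]
  simp only [bvec, Finsupp.linearCombination_single, one_smul, TensorProduct.smul_tmul',
    TensorProduct.tmul_smul]

lemma coprodR_bvec (ε₁ ε₂ : ℝ) (n m : ℕ) : coprodR ε₁ ε₂ (bvec n ⊗ₜ bvec m)
    = ((ε₁ * ε₂ * (-1) ^ (n + m) : ℝ) : ℂ) • (bvec n ⊗ₜ[ℂ] bvec m) := by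
  have : ((ε₁ * ε₂ * (-1) ^ (n + m) : ℝ) : ℂ)
      = ((ε₁ * (-1) ^ n : ℝ) : ℂ) * ((ε₂ * (-1) ^ m : ℝ) : ℂ) := by
    push_cast; ring
  rw [this, ← TensorProduct.smul_tmul_smul]
  simp [coprodR, repR, TensorProduct.map_tmul, bvec]

lemma coprodJplus_bvec (μ₁ μ₂ ε₂ : ℝ) (n m : ℕ) : coprodJplus μ₁ μ₂ ε₂ (bvec n ⊗ₜ bvec m)
    = ((ε₂ * (-1) ^ m * √(muNumber (n + 1) μ₁) : ℝ) : ℂ) • (bvec (n + 1) ⊗ₜ[ℂ] bvec m)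
      + ((√(muNumber (m + 1) μ₂) : ℝ) : ℂ) • (bvec n ⊗ₜ[ℂ] bvec (m + 1)) := by
  rw [mul_comm (ε₂ * _), Complex.ofReal_mul, ← TensorProduct.smul_tmul_smul,
    ← TensorProduct.tmul_smul]
  simp only [coprodJplus, repJplus, repR, LinearMap.add_apply, TensorProduct.map_tmul,
    LinearMap.id_apply]
  simp only [bvec, Finsupp.linearCombination_single, one_smul]

lemma coprodJminus_bvec (μ₁ μ₂ ε₂ : ℝ) (n m : ℕ) : coprodJminus μ₁ μ₂ ε₂ (bvec n ⊗ₜ bvec m)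
    = ((ε₂ * (-1) ^ m * √(muNumber n μ₁) : ℝ) : ℂ) • (bvec (n - 1) ⊗ₜ[ℂ] bvec m)
      + ((√(muNumber m μ₂) : ℝ) : ℂ) • (bvec n ⊗ₜ[ℂ] bvec (m - 1)) := by
  rw [mul_comm (ε₂ * _), Complex.ofReal_mul, ← TensorProduct.smul_tmul_smul,
    ← TensorProduct.tmul_smul]
  simp only [coprodJminus, repJminus, repR, LinearMap.add_apply, TensorProduct.map_tmul,
    LinearMap.id_apply]
  simp only [bvec, Finsupp.linearCombination_single, one_smul]

/-! ### Relations of `osp(1|2)` under the coproduct. -/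

lemma coprodJ0_coprodJplus (μ₁ μ₂ ε₂ : ℝ) (v : FinSpan ⊗[ℂ] FinSpan) :
    coprodJ0 μ₁ μ₂ (coprodJplus μ₁ μ₂ ε₂ v)
      = coprodJplus μ₁ μ₂ ε₂ (coprodJ0 μ₁ μ₂ v) + coprodJplus μ₁ μ₂ ε₂ v := by
  refine LinearMap.congr_fun (f := coprodJ0 μ₁ μ₂ ∘ₗ coprodJplus μ₁ μ₂ ε₂)
    (g := coprodJplus μ₁ μ₂ ε₂ ∘ₗ coprodJ0 μ₁ μ₂ + coprodJplus μ₁ μ₂ ε₂)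
    (tensor_linearMap_ext fun n m => ?_) v
  simp only [LinearMap.comp_apply, LinearMap.add_apply, coprodJplus_bvec, coprodJ0_bvec,
    map_add, map_smul]
  push_cast
  module

lemma coprodR_coprodJplus (μ₁ μ₂ ε₁ ε₂ : ℝ) (v : FinSpan ⊗[ℂ] FinSpan) :
    coprodR ε₁ ε₂ (coprodJplus μ₁ μ₂ ε₂ v) + coprodJplus μ₁ μ₂ ε₂ (coprodR ε₁ ε₂ v) = 0 := by
  refine LinearMap.congr_fun
    (f := coprodR ε₁ ε₂ ∘ₗ coprodJplus μ₁ μ₂ ε₂ + coprodJplus μ₁ μ₂ ε₂ ∘ₗ coprodR ε₁ ε₂)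
    (g := 0) (tensor_linearMap_ext fun n m => ?_) v
  simp only [LinearMap.comp_apply, LinearMap.add_apply, coprodJplus_bvec, coprodR_bvec,
    map_add, map_smul, LinearMap.zero_apply]
  push_cast
  module

/-- The mixed terms cancel because `R` anticommutes with `J_±`, and `R² = 1` reduces the rest to the
relation in each factor. -/
lemma coprodJminus_coprodJplus {μ₁ μ₂ ε₂ : ℝ} (h₁ : 0 < μ₁) (h₂ : 0 < μ₂) (hε₂ : ε₂ ^ 2 = 1)
    (v : FinSpan ⊗[ℂ] FinSpan) : coprodJminus μ₁ μ₂ ε₂ (coprodJplus μ₁ μ₂ ε₂ v)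
      + coprodJplus μ₁ μ₂ ε₂ (coprodJminus μ₁ μ₂ ε₂ v) = (2 : ℂ) • coprodJ0 μ₁ μ₂ v := by
  refine LinearMap.congr_fun (f := coprodJminus μ₁ μ₂ ε₂ ∘ₗ coprodJplus μ₁ μ₂ ε₂
      + coprodJplus μ₁ μ₂ ε₂ ∘ₗ coprodJminus μ₁ μ₂ ε₂)
    (g := (2 : ℂ) • coprodJ0 μ₁ μ₂) (tensor_linearMap_ext fun n m => ?_) v
  have hs : ∀ n {μ : ℝ}, 0 < μ → ((√(muNumber n μ) : ℝ) : ℂ) ^ 2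
      = ((muNumber n μ : ℝ) : ℂ) := fun n μ h => by
    rw [← Complex.ofReal_pow, Real.sq_sqrt (muNumber_nonneg n h)]
  have hε : (ε₂ : ℂ) ^ 2 = 1 := by rw [← Complex.ofReal_pow, hε₂]; simp
  have hn : ∀ (n : ℕ) (μ : ℝ), ((muNumber (n + 1) μ : ℝ) : ℂ) + ((muNumber n μ : ℝ) : ℂ)
      = 2 * (n + μ + 1 / 2) := fun n μ => by
    have := congrArg (fun x : ℝ => (x : ℂ)) (muNumber_add_succ n μ)
    push_cast at this
    exact this
  have hm : ∀ m : ℕ, ((-1 : ℂ) ^ m) ^ 2 = 1 := fun m => by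
    rw [← pow_mul, mul_comm, pow_mul]; simp
  simp only [LinearMap.comp_apply, LinearMap.add_apply, LinearMap.smul_apply, coprodJplus_bvec,
    coprodJminus_bvec, coprodJ0_bvec, map_add, map_smul, Nat.add_sub_cancel]
  have hd : (((√(muNumber (n + 1) μ₁) : ℝ) : ℂ) ^ 2 + ((√(muNumber n μ₁) : ℝ) : ℂ) ^ 2)
      * ((ε₂ : ℂ) ^ 2 * ((-1 : ℂ) ^ m) ^ 2)
      + ((√(muNumber (m + 1) μ₂) : ℝ) : ℂ) ^ 2 + ((√(muNumber m μ₂) : ℝ) : ℂ) ^ 2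
      = 2 * (n + m + μ₁ + μ₂ + 1) := by
    rw [hs _ h₁, hs _ h₁, hs _ h₂, hs _ h₂, hε, hm]
    linear_combination hn n μ₁ + hn m μ₂
  -- The cases separate the truncated indices `n - 1` and `m - 1` at `0`, where the coefficient
  -- `√[0]_μ` vanishes.
  rcases n with _ | n <;> rcases m with _ | m <;>
    simp only [Nat.add_sub_cancel, Nat.zero_sub, muNumber_zero, Real.sqrt_zero, mul_zero,
      Complex.ofReal_zero, zero_smul, add_zero, zero_add] at hd ⊢ <;>
    push_cast at hd ⊢ <;> match_scalars <;> first | linear_combination hd | ring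

/-! ## The inclusion in the Hilbert space -/

/-- The inclusion in the Hilbert space tensor product as a linear map. -/
def inclLinear : FinSpan ⊗[ℂ] FinSpan →ₗ[ℂ] Ell2Tensor :=
  (UniformSpace.Completion.toComplₗᵢ (𝕜 := ℂ) (E := Ell2 ⊗[ℂ] Ell2)).toLinearMap ∘ₗ
    TensorProduct.map inclEll2 inclEll2

lemma incl_eq (v : FinSpan ⊗[ℂ] FinSpan) : incl v = inclLinear v := rfl

lemma inner_incl_bvec (n m n' m' : ℕ) :
    ⟪inclLinear (bvec n ⊗ₜ[ℂ] bvec m), inclLinear (bvec n' ⊗ₜ[ℂ] bvec m')⟫_ℂ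
      = if (n, m) = (n', m') then 1 else 0 := by
  rw [← incl_eq, ← incl_eq, incl, incl, UniformSpace.Completion.inner_coe]
  simp only [TensorProduct.map_tmul, TensorProduct.inner_tmul, inclEll2, bvec,
    Finsupp.linearCombination_single, one_smul, Prod.mk.injEq]
  rw [lp.inner_single_left, lp.inner_single_left, lp.single_apply, lp.single_apply]
  rcases eq_or_ne n n' with rfl | h <;> rcases eq_or_ne m m' with rfl | h' <;>
    simp_all

lemma denseRange_inclEll2 : DenseRange inclEll2 := by
  have hcl : ∀ x : Ell2, x ∈ (LinearMap.range inclEll2).topologicalClosure := by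
    intro x
    have hx := lp.hasSum_single (p := 2) (by simp) x
    refine mem_closure_of_tendsto hx (Filter.Eventually.of_forall fun s => ?_)
    refine sum_mem fun i _ => ⟨Finsupp.single i (x i), ?_⟩
    simp only [inclEll2, Finsupp.linearCombination_single]
    rw [← lp.single_smul, smul_eq_mul, mul_one]
  exact fun x => hcl x

lemma denseRange_inclLinear : DenseRange inclLinear := by
  have hcl : ∀ x y : Ell2, ((x ⊗ₜ[ℂ] y : Ell2 ⊗[ℂ] Ell2) : Ell2Tensor)
      ∈ (LinearMap.range inclLinear).topologicalClosure := by
    intro x y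
    have hc : Continuous fun z : Ell2 × Ell2 =>
        ((z.1 ⊗ₜ[ℂ] z.2 : Ell2 ⊗[ℂ] Ell2) : Ell2Tensor) :=
      (UniformSpace.Completion.continuous_coe _).comp TensorProduct.continuous_tmul
    refine (denseRange_inclEll2.prodMap denseRange_inclEll2).induction_on
      (p := fun z : Ell2 × Ell2 => ((z.1 ⊗ₜ[ℂ] z.2 : Ell2 ⊗[ℂ] Ell2) : Ell2Tensor)
      ∈ (LinearMap.range inclLinear).topologicalClosure) (x, y) ?_ fun a => ?_
    · exact (Submodule.isClosed_topologicalClosure _).preimage hc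
    · exact Submodule.le_topologicalClosure _ ⟨a.1 ⊗ₜ a.2, rfl⟩
  have hcl' : ∀ t : Ell2 ⊗[ℂ] Ell2, (t : Ell2Tensor)
      ∈ (LinearMap.range inclLinear).topologicalClosure := by
    intro t
    induction t with
    | zero => rw [UniformSpace.Completion.coe_zero]; exact zero_mem _
    | tmul x y => exact hcl x y
    | add s t hs ht => rw [UniformSpace.Completion.coe_add]; exact add_mem hs ht
  intro z
  refine UniformSpace.Completion.induction_on
    (p := fun z => z ∈ (LinearMap.range inclLinear).topologicalClosure) z ?_ hcl'
  exact Submodule.isClosed_topologicalClosure _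

lemma tensorBasis_repr (q : ℕ × ℕ) (v : FinSpan ⊗[ℂ] FinSpan) : tensorBasis.repr v q
    = ⟪inclLinear (bvec q.1 ⊗ₜ[ℂ] bvec q.2), inclLinear v⟫_ℂ := by
  induction v using tensor_induction with
  | h0 => simp
  | hadd v w hv hw => simp only [map_add, inner_add_right, Finsupp.add_apply, hv, hw]
  | hsmul a v hv => simp only [map_smul, inner_smul_right, Finsupp.smul_apply, hv, smul_eq_mul]
  | hb n m =>
    rw [inner_incl_bvec, ← tensorBasis_apply (n, m), Module.Basis.repr_self,
      Finsupp.single_apply, Prod.mk.eta]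
    simp only [eq_comm (a := q)]

lemma ext_of_coord {v w : FinSpan ⊗[ℂ] FinSpan}
    (h : ∀ n m, ⟪inclLinear (bvec n ⊗ₜ[ℂ] bvec m), inclLinear v⟫_ℂ
      = ⟪inclLinear (bvec n ⊗ₜ[ℂ] bvec m), inclLinear w⟫_ℂ) : v = w :=
  tensorBasis.ext_elem fun q => by rw [tensorBasis_repr, tensorBasis_repr, h]

/-- Adjointness holds for each of the two tensor terms, since `R` is diagonal with real entries. -/
lemma inner_coprodJplus (μ₁ μ₂ ε₂ : ℝ) (v w : FinSpan ⊗[ℂ] FinSpan) :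
    ⟪inclLinear (coprodJplus μ₁ μ₂ ε₂ v), inclLinear w⟫_ℂ
      = ⟪inclLinear v, inclLinear (coprodJminus μ₁ μ₂ ε₂ w)⟫_ℂ := by
  induction v using tensor_induction with
  | h0 => simp
  | hadd v v' h h' => simp only [map_add, inner_add_left, h, h']
  | hsmul a v h => simp only [map_smul, inner_smul_left, h]
  | hb n m =>
    induction w using tensor_induction with
    | h0 => simp
    | hadd v v' h h' => simp only [map_add, inner_add_right, h, h']
    | hsmul a v h => simp only [map_smul, inner_smul_right, h]
    | hb n' m' =>
      simp only [coprodJplus_bvec, coprodJminus_bvec, map_add, map_smul, inner_add_left,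
        inner_add_right, inner_smul_left, inner_smul_right, inner_incl_bvec, Complex.conj_ofReal,
        Prod.mk.injEq]
      congr 1
      · cases n' with
        | zero => simp
        | succ n' =>
          simp only [Nat.add_sub_cancel, Nat.add_right_cancel_iff]
          split_ifs with h
          · rw [h.1, h.2]
          · simp
      · cases m' with
        | zero => simp
        | succ m' =>
          simp only [Nat.add_sub_cancel, Nat.add_right_cancel_iff]
          split_ifs with h
          · rw [h.2]
          · simp

/-! ## The coupled basis -/

/-- Subtraction is carried out by scalars, so the additive monoid structure of the module suffices.
-/
lemma eq_sub_smul_of_add_smul_eq {M : Type*} [AddCommMonoid M] [Module ℂ M] {x y : M} {a b : ℂ}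
    (h : x + a • y = b • y) : x = (b - a) • y := by
  rw [sub_eq_add_neg, add_smul, ← h, add_assoc, ← add_smul, add_neg_cancel, zero_smul, add_zero]

lemma smul_add_self {M : Type*} [AddCommMonoid M] [Module ℂ M] (a : ℂ) (y : M) :
    a • y + y = (a + 1) • y := by
  rw [add_smul, one_smul]

/-- The Clebsch-Gordan coefficient of `e_{p.1} ⊗ e_{p.2}` in the lowest weight vector. -/
def cgCoeff (μ₁ μ₂ ε : ℝ) (p : ℕ × ℕ) : ℝ :=
  cgSign ε p / (√(muFact μ₁ p.1) * √(muFact μ₂ p.2) * √(cgNorm μ₁ μ₂ (p.1 + p.2)))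

lemma cgCoeff_ne_zero {μ₁ μ₂ ε : ℝ} (h₁ : 0 < μ₁) (h₂ : 0 < μ₂) (hε : ε ^ 2 = 1) (p : ℕ × ℕ) :
    cgCoeff μ₁ μ₂ ε p ≠ 0 := by
  have h := cgSign_sq hε p
  have h₁' := muFact_pos h₁ p.1
  have h₂' := muFact_pos h₂ p.2
  have h₃' := cgNorm_pos h₁ h₂ (p.1 + p.2)
  have : cgSign ε p ≠ 0 := fun h0 => by simp [h0] at h
  unfold cgCoeff
  positivity

/-- The coefficient of `e_n ⊗ e_m` in `Δ(J_-)` applied to the lowest weight vector. The square roots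
cancel, and the sign alternates because consecutive triangular numbers differ by `m + 1`. -/
lemma cgCoeff_succ {μ₁ μ₂ ε : ℝ} (h₁ : 0 < μ₁) (h₂ : 0 < μ₂) (hε : ε ^ 2 = 1) (n m : ℕ) :
    ε * (-1) ^ m * √(muNumber (n + 1) μ₁) * cgCoeff μ₁ μ₂ ε (n + 1, m)
      + √(muNumber (m + 1) μ₂) * cgCoeff μ₁ μ₂ ε (n, m + 1) = 0 := by
  have h₁' := Real.sqrt_pos.2 (muFact_pos h₁ n)
  have h₂' := Real.sqrt_pos.2 (muFact_pos h₂ m)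
  have h₃ := Real.sqrt_pos.2 (muNumber_succ_pos n h₁)
  have h₄ := Real.sqrt_pos.2 (muNumber_succ_pos m h₂)
  have h₅ := Real.sqrt_pos.2 (cgNorm_pos h₁ h₂ (n + m + 1))
  have e₁ : muFact μ₁ (n + 1) = muFact μ₁ n * muNumber (n + 1) μ₁ := rfl
  have e₂ : muFact μ₂ (m + 1) = muFact μ₂ m * muNumber (m + 1) μ₂ := rfl
  have hm : ((-1 : ℝ) ^ m) ^ 2 = 1 := by rw [← pow_mul, mul_comm, pow_mul]; simp
  simp only [cgCoeff, cgSign, triangle_succ, e₁, e₂, Real.sqrt_mul (muFact_pos h₁ n).le,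
    Real.sqrt_mul (muFact_pos h₂ m).le, show n + 1 + m = n + m + 1 by ring,
    show n + (m + 1) = n + m + 1 by ring]
  field_simp
  simp only [pow_add, pow_one]
  linear_combination (ε ^ n * (-1) ^ (m * (m + 1) / 2) * (-1) ^ m) * hε

lemma cgCoeff_zero (μ₁ μ₂ ε : ℝ) (j : ℕ) (h₁ : 0 < μ₁) (h₂ : 0 < μ₂) :
    ∃ r : ℝ, 0 < r ∧ cgCoeff μ₁ μ₂ ε (0, j) = (-1) ^ (j * (j + 1) / 2) * r := by
  refine ⟨1 / (√(muFact μ₁ 0) * √(muFact μ₂ j) * √(cgNorm μ₁ μ₂ (0 + j))), ?_, ?_⟩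
  · have h₁' := muFact_pos h₁ 0
    have h₂' := muFact_pos h₂ j
    have h₃' := cgNorm_pos h₁ h₂ (0 + j)
    positivity
  · simp only [cgCoeff, cgSign, pow_zero, one_mul]
    ring

lemma sum_cgCoeff_sq {μ₁ μ₂ ε : ℝ} (h₁ : 0 < μ₁) (h₂ : 0 < μ₂) (hε : ε ^ 2 = 1) (j : ℕ) :
    ∑ p ∈ Finset.HasAntidiagonal.antidiagonal j, cgCoeff μ₁ μ₂ ε p ^ 2 = 1 := by
  have h₃ := cgNorm_pos h₁ h₂ j
  have : ∀ p ∈ Finset.HasAntidiagonal.antidiagonal j, cgCoeff μ₁ μ₂ ε p ^ 2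
      = 1 / (muFact μ₁ p.1 * muFact μ₂ p.2) / cgNorm μ₁ μ₂ j := fun p hp => by
    rw [Finset.HasAntidiagonal.mem_antidiagonal] at hp
    have h₁' := muFact_pos h₁ p.1
    have h₂' := muFact_pos h₂ p.2
    rw [cgCoeff, div_pow, cgSign_sq hε, mul_pow, mul_pow, Real.sq_sqrt h₁'.le, Real.sq_sqrt h₂'.le,
      hp, Real.sq_sqrt h₃.le, div_div]
  rw [Finset.sum_congr rfl this, ← Finset.sum_div, ← cgNorm, div_self h₃.ne']

/-- The lowest weight vector of the `j`-th summand. -/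
def cgVec (μ₁ μ₂ ε : ℝ) (j : ℕ) : FinSpan ⊗[ℂ] FinSpan :=
  ∑ p ∈ Finset.HasAntidiagonal.antidiagonal j,
    (cgCoeff μ₁ μ₂ ε p : ℂ) • (bvec p.1 ⊗ₜ[ℂ] bvec p.2)

lemma inner_cgVec (μ₁ μ₂ ε : ℝ) (j n m : ℕ) :
    ⟪inclLinear (bvec n ⊗ₜ[ℂ] bvec m), inclLinear (cgVec μ₁ μ₂ ε j)⟫_ℂ
      = if n + m = j then (cgCoeff μ₁ μ₂ ε (n, m) : ℂ) else 0 := by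
  simp only [cgVec, map_sum, inner_sum, map_smul, inner_smul_right, inner_incl_bvec, mul_ite,
    mul_one, mul_zero, Finset.sum_ite_eq, Finset.HasAntidiagonal.mem_antidiagonal]

/-- Passing to the adjoint gives the coordinates of `Δ(J_-) w` without truncated indices. -/
lemma inner_coprodJminus (μ₁ μ₂ ε₂ : ℝ) (w : FinSpan ⊗[ℂ] FinSpan) (n m : ℕ) :
    ⟪inclLinear (bvec n ⊗ₜ[ℂ] bvec m), inclLinear (coprodJminus μ₁ μ₂ ε₂ w)⟫_ℂ
      = ((ε₂ * (-1) ^ m * √(muNumber (n + 1) μ₁) : ℝ) : ℂ)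
          * ⟪inclLinear (bvec (n + 1) ⊗ₜ[ℂ] bvec m), inclLinear w⟫_ℂ
        + ((√(muNumber (m + 1) μ₂) : ℝ) : ℂ)
          * ⟪inclLinear (bvec n ⊗ₜ[ℂ] bvec (m + 1)), inclLinear w⟫_ℂ := by
  rw [← inner_coprodJplus, coprodJplus_bvec, map_add, map_smul, map_smul, inner_add_left,
    inner_smul_left, inner_smul_left, Complex.conj_ofReal, Complex.conj_ofReal]

lemma coprodJminus_cgVec {μ₁ μ₂ ε : ℝ} (h₁ : 0 < μ₁) (h₂ : 0 < μ₂) (hε : ε ^ 2 = 1) (j : ℕ) :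
    coprodJminus μ₁ μ₂ ε (cgVec μ₁ μ₂ ε j) = 0 := by
  refine ext_of_coord fun n m => ?_
  rw [inner_coprodJminus, inner_cgVec, inner_cgVec, map_zero, inner_zero_right,
    show n + 1 + m = n + (m + 1) by ring]
  split_ifs
  · rw [← Complex.ofReal_mul, ← Complex.ofReal_mul, ← Complex.ofReal_add, cgCoeff_succ h₁ h₂ hε,
      Complex.ofReal_zero]
  · simp

lemma coprodJ0_cgVec (μ₁ μ₂ ε : ℝ) (j : ℕ) : coprodJ0 μ₁ μ₂ (cgVec μ₁ μ₂ ε j)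
    = ((mu12 μ₁ μ₂ j + 1 / 2 : ℝ) : ℂ) • cgVec μ₁ μ₂ ε j := by
  rw [cgVec, map_sum, Finset.smul_sum]
  refine Finset.sum_congr rfl fun p hp => ?_
  rw [Finset.HasAntidiagonal.mem_antidiagonal] at hp
  rw [map_smul, coprodJ0_bvec, hp, smul_comm]
  rw [mu12, show μ₁ + μ₂ + (j : ℝ) + 1 / 2 + 1 / 2 = j + μ₁ + μ₂ + 1 by ring]

lemma coprodR_cgVec (μ₁ μ₂ ε₁ ε₂ ε : ℝ) (j : ℕ) : coprodR ε₁ ε₂ (cgVec μ₁ μ₂ ε j)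
    = (eps12 ε₁ ε₂ j : ℂ) • cgVec μ₁ μ₂ ε j := by
  rw [cgVec, map_sum, Finset.smul_sum]
  refine Finset.sum_congr rfl fun p hp => ?_
  rw [Finset.HasAntidiagonal.mem_antidiagonal] at hp
  rw [map_smul, coprodR_bvec, hp, smul_comm, eps12]

lemma inner_cgVec_cgVec {μ₁ μ₂ ε : ℝ} (h₁ : 0 < μ₁) (h₂ : 0 < μ₂) (hε : ε ^ 2 = 1) (j j' : ℕ) :
    ⟪inclLinear (cgVec μ₁ μ₂ ε j), inclLinear (cgVec μ₁ μ₂ ε j')⟫_ℂ = if j = j' then 1 else 0 := by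
  rw [cgVec, map_sum, sum_inner]
  have : ∀ p ∈ Finset.HasAntidiagonal.antidiagonal j,
      ⟪inclLinear ((cgCoeff μ₁ μ₂ ε p : ℂ) • (bvec p.1 ⊗ₜ[ℂ] bvec p.2)),
        inclLinear (cgVec μ₁ μ₂ ε j')⟫_ℂ
      = if j = j' then ((cgCoeff μ₁ μ₂ ε p ^ 2 : ℝ) : ℂ) else 0 := fun p hp => by
    rw [Finset.HasAntidiagonal.mem_antidiagonal] at hp
    rw [map_smul, inner_smul_left, inner_cgVec, hp, Complex.conj_ofReal, mul_ite, mul_zero,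
      ← Complex.ofReal_mul, sq]
  rw [Finset.sum_congr rfl this]
  split_ifs with h
  · rw [← Complex.ofReal_sum, sum_cgCoeff_sq h₁ h₂ hε, Complex.ofReal_one]
  · simp

/-- The coupled basis. -/
def coupled (μ₁ μ₂ ε : ℝ) (j : ℕ) : ℕ → FinSpan ⊗[ℂ] FinSpan
  | 0 => cgVec μ₁ μ₂ ε j
  | N + 1 => (((√(muNumber (N + 1) (mu12 μ₁ μ₂ j)))⁻¹ : ℝ) : ℂ)
      • coprodJplus μ₁ μ₂ ε (coupled μ₁ μ₂ ε j N)

lemma mu12_pos {μ₁ μ₂ : ℝ} (h₁ : 0 < μ₁) (h₂ : 0 < μ₂) (j : ℕ) : 0 < mu12 μ₁ μ₂ j := by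
  unfold mu12
  positivity

lemma coprodJplus_coupled {μ₁ μ₂ : ℝ} (ε : ℝ) (h₁ : 0 < μ₁) (h₂ : 0 < μ₂) (j N : ℕ) :
    coprodJplus μ₁ μ₂ ε (coupled μ₁ μ₂ ε j N)
      = ((√(muNumber (N + 1) (mu12 μ₁ μ₂ j)) : ℝ) : ℂ) • coupled μ₁ μ₂ ε j (N + 1) := by
  have := (Real.sqrt_pos.2 (muNumber_succ_pos N (mu12_pos h₁ h₂ j))).ne'
  rw [coupled, smul_smul, ← Complex.ofReal_mul, mul_inv_cancel₀ this, Complex.ofReal_one, one_smul]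

lemma coprodJ0_coupled (μ₁ μ₂ ε : ℝ) (j N : ℕ) : coprodJ0 μ₁ μ₂ (coupled μ₁ μ₂ ε j N)
    = (((N : ℝ) + mu12 μ₁ μ₂ j + 1 / 2 : ℝ) : ℂ) • coupled μ₁ μ₂ ε j N := by
  induction N with
  | zero => rw [coupled, coprodJ0_cgVec, Nat.cast_zero, zero_add]
  | succ N ih =>
    rw [coupled, map_smul, coprodJ0_coprodJplus, ih, map_smul, smul_add_self, smul_comm]
    congr 2
    push_cast
    ring

lemma coprodR_coupled (μ₁ μ₂ ε₁ ε₂ : ℝ) (j N : ℕ) : coprodR ε₁ ε₂ (coupled μ₁ μ₂ ε₂ j N)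
    = ((eps12 ε₁ ε₂ j * (-1) ^ N : ℝ) : ℂ) • coupled μ₁ μ₂ ε₂ j N := by
  induction N with
  | zero => rw [coupled, coprodR_cgVec, pow_zero, mul_one]
  | succ N ih =>
    have h := coprodR_coprodJplus μ₁ μ₂ ε₁ ε₂ (coupled μ₁ μ₂ ε₂ j N)
    rw [ih, map_smul, ← zero_smul ℂ (coprodJplus _ _ _ _)] at h
    rw [coupled, map_smul, eq_sub_smul_of_add_smul_eq h, smul_comm]
    congr 2
    push_cast
    ring

/-- By the anticommutator `J_- J_+ e_N = (2 (N + μ₁₂ + 1/2) - [N]) e_N = [N + 1] e_N`, all numbers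
taken at `μ₁₂`. -/
lemma coprodJminus_coupled {μ₁ μ₂ ε : ℝ} (h₁ : 0 < μ₁) (h₂ : 0 < μ₂) (hε : ε ^ 2 = 1) (j N : ℕ) :
    coprodJminus μ₁ μ₂ ε (coupled μ₁ μ₂ ε j N)
      = ((√(muNumber N (mu12 μ₁ μ₂ j)) : ℝ) : ℂ) • coupled μ₁ μ₂ ε j (N - 1) := by
  induction N with
  | zero =>
    rw [coupled, coprodJminus_cgVec h₁ h₂ hε, muNumber_zero, Real.sqrt_zero, Complex.ofReal_zero,
      zero_smul]
  | succ N ih =>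
    have hμ := mu12_pos h₁ h₂ j
    have hJ : coprodJplus μ₁ μ₂ ε (coprodJminus μ₁ μ₂ ε (coupled μ₁ μ₂ ε j N))
        = ((muNumber N (mu12 μ₁ μ₂ j) : ℝ) : ℂ) • coupled μ₁ μ₂ ε j N := by
      rw [ih, map_smul]
      cases N with
      | zero => simp [muNumber_zero]
      | succ N =>
        rw [Nat.add_sub_cancel, coprodJplus_coupled ε h₁ h₂, smul_smul, ← Complex.ofReal_mul,
          Real.mul_self_sqrt (muNumber_nonneg _ hμ)]
    have h := coprodJminus_coprodJplus h₁ h₂ hε (coupled μ₁ μ₂ ε j N)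
    rw [hJ, coprodJ0_coupled, smul_smul] at h
    have h' : coprodJminus μ₁ μ₂ ε (coprodJplus μ₁ μ₂ ε (coupled μ₁ μ₂ ε j N))
        = ((muNumber (N + 1) (mu12 μ₁ μ₂ j) : ℝ) : ℂ) • coupled μ₁ μ₂ ε j N := by
      rw [eq_sub_smul_of_add_smul_eq h]
      congr 1
      rw [show muNumber (N + 1) (mu12 μ₁ μ₂ j) = 2 * (N + mu12 μ₁ μ₂ j + 1 / 2)
        - muNumber N (mu12 μ₁ μ₂ j) by linarith [muNumber_add_succ N (mu12 μ₁ μ₂ j)]]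
      push_cast
      ring
    have hp := muNumber_succ_pos N hμ
    rw [Nat.add_sub_cancel, coupled, map_smul, h', smul_smul, ← Complex.ofReal_mul]
    congr 2
    have := (Real.sqrt_pos.2 hp).ne'
    field_simp
    rw [Real.sq_sqrt hp.le]

/-- Moving `J_+` across as `J_-` lowers both indices together until one vector has lowest weight; if
the other has not, the product is zero. -/
lemma inner_coupled {μ₁ μ₂ ε : ℝ} (h₁ : 0 < μ₁) (h₂ : 0 < μ₂) (hε : ε ^ 2 = 1)
    (j N j' N' : ℕ) : ⟪inclLinear (coupled μ₁ μ₂ ε j N), inclLinear (coupled μ₁ μ₂ ε j' N')⟫_ℂ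
      = if (j, N) = (j', N') then 1 else 0 := by
  have hz : ∀ j N j', ⟪inclLinear (coupled μ₁ μ₂ ε j (N + 1)),
      inclLinear (coupled μ₁ μ₂ ε j' 0)⟫_ℂ = 0 := fun j N j' => by
    rw [coupled.eq_2, map_smul, inner_smul_left, inner_coprodJplus, coupled,
      coprodJminus_cgVec h₁ h₂ hε, map_zero, inner_zero_right, mul_zero]
  induction N generalizing N' with
  | zero =>
    cases N' with
    | zero => simp [coupled, inner_cgVec_cgVec h₁ h₂ hε]
    | succ N' => rw [← inner_conj_symm, hz]; simp
  | succ N ih =>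
    cases N' with
    | zero => rw [hz]; simp
    | succ N' =>
      have hp := Real.sqrt_pos.2 (muNumber_succ_pos N (mu12_pos h₁ h₂ j))
      rw [coupled, map_smul, inner_smul_left, inner_coprodJplus, coprodJminus_coupled h₁ h₂ hε,
        map_smul, inner_smul_right, Nat.add_sub_cancel, ih, Complex.conj_ofReal]
      by_cases h : (j, N) = (j', N')
      · obtain ⟨rfl, rfl⟩ := Prod.mk.inj h
        rw [if_pos rfl, if_pos rfl, mul_one, ← Complex.ofReal_mul, inv_mul_cancel₀ hp.ne',
          Complex.ofReal_one]
      · rw [if_neg h, if_neg (by simpa using h), mul_zero, mul_zero]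

lemma mem_of_add_mem {M : Type*} [AddCommMonoid M] [Module ℂ M] {S : Submodule ℂ M} {x y : M}
    (h : x + y ∈ S) (hy : y ∈ S) : x ∈ S := by
  have : x = (x + y) + (-1 : ℂ) • y := by module
  rw [this]
  exact S.add_mem h (S.smul_mem _ hy)

lemma cgVec_mem_span (μ₁ μ₂ ε : ℝ) (j : ℕ) : cgVec μ₁ μ₂ ε j
    ∈ Submodule.span ℂ (Set.range fun p : ℕ × ℕ => coupled μ₁ μ₂ ε p.1 p.2) :=
  Submodule.subset_span ⟨(j, 0), rfl⟩

lemma coprodJplus_mem_span {μ₁ μ₂ ε : ℝ} (h₁ : 0 < μ₁) (h₂ : 0 < μ₂) {v : FinSpan ⊗[ℂ] FinSpan}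
    (hv : v ∈ Submodule.span ℂ (Set.range fun p : ℕ × ℕ => coupled μ₁ μ₂ ε p.1 p.2)) :
    coprodJplus μ₁ μ₂ ε v
      ∈ Submodule.span ℂ (Set.range fun p : ℕ × ℕ => coupled μ₁ μ₂ ε p.1 p.2) := by
  induction hv using Submodule.span_induction with
  | mem v hv =>
    obtain ⟨p, rfl⟩ := hv
    simp only [coprodJplus_coupled ε h₁ h₂]
    exact Submodule.smul_mem _ _ (Submodule.subset_span ⟨(p.1, p.2 + 1), rfl⟩)
  | zero => rw [map_zero]; exact Submodule.zero_mem _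
  | add v w _ _ hv hw => rw [map_add]; exact Submodule.add_mem _ hv hw
  | smul a v _ hv => rw [map_smul]; exact Submodule.smul_mem _ _ hv

/-- Modulo the span, the images under `J_+` of lower-degree vectors make all `e_n ⊗ e_m` with `n + m
= d` proportional, with ratios given by the Clebsch–Gordan coefficients `a`. The lowest weight
vector then gives `0` modulo the span as a multiple of `e_0 ⊗ e_d` by `∑ a² ≠ 0`. -/
lemma bvec_mem_span {μ₁ μ₂ ε : ℝ} (h₁ : 0 < μ₁) (h₂ : 0 < μ₂) (hε : ε ^ 2 = 1) (d : ℕ) :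
    ∀ n m, n + m = d → bvec n ⊗ₜ[ℂ] bvec m
      ∈ Submodule.span ℂ (Set.range fun p : ℕ × ℕ => coupled μ₁ μ₂ ε p.1 p.2) := by
  set S := Submodule.span ℂ (Set.range fun p : ℕ × ℕ => coupled μ₁ μ₂ ε p.1 p.2)
  induction d using Nat.strong_induction_on with
  | _ d ih =>
  set a : ℕ × ℕ → ℂ := fun p => (cgCoeff μ₁ μ₂ ε p : ℂ)
  have ha : ∀ p, a p ≠ 0 := fun p => Complex.ofReal_ne_zero.2 (cgCoeff_ne_zero h₁ h₂ hε p)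
  have key : ∀ n m, n + m = d → a (0, d) • (bvec n ⊗ₜ[ℂ] bvec m)
      + (-a (n, m)) • (bvec 0 ⊗ₜ[ℂ] bvec d) ∈ S := by
    intro n
    induction n with
    | zero =>
      intro m hm
      rw [zero_add] at hm
      subst hm
      rw [← add_smul, add_neg_cancel, zero_smul]
      exact S.zero_mem
    | succ n ihn =>
      intro m hm
      have hJ := coprodJplus_mem_span h₁ h₂ (ih (n + m) (by omega) n m rfl)
      rw [coprodJplus_bvec] at hJ
      have hI := ihn (m + 1) (by omega)
      set α : ℝ := ε * (-1) ^ m * √(muNumber (n + 1) μ₁)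
      have hα : (α : ℂ) ≠ 0 := by
        have hε0 : ε ≠ 0 := fun h0 => by simp [h0] at hε
        have := (Real.sqrt_pos.2 (muNumber_succ_pos n h₁)).ne'
        exact Complex.ofReal_ne_zero.2 (by positivity)
      have hrec : (α : ℂ) * (cgCoeff μ₁ μ₂ ε (n + 1, m) : ℂ)
          + ((√(muNumber (m + 1) μ₂) : ℝ) : ℂ) * (cgCoeff μ₁ μ₂ ε (n, m + 1) : ℂ) = 0 := by
        have h : α * cgCoeff μ₁ μ₂ ε (n + 1, m) + √(muNumber (m + 1) μ₂) * cgCoeff μ₁ μ₂ ε (n, m + 1)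
          = 0 := cgCoeff_succ h₁ h₂ hε n m
        exact_mod_cast h
      have hrec' : -a (n + 1, m) = (α : ℂ)⁻¹ * (((√(muNumber (m + 1) μ₂) : ℝ) : ℂ) * a (n, m + 1)) := by
        rw [eq_inv_mul_iff_mul_eq₀ hα]
        simp only [a]
        linear_combination -hrec
      have : a (0, d) • (bvec (n + 1) ⊗ₜ[ℂ] bvec m)
          + (-a (n + 1, m)) • (bvec 0 ⊗ₜ[ℂ] bvec d)
          = ((α : ℂ)⁻¹ * a (0, d)) • ((α : ℂ) • (bvec (n + 1) ⊗ₜ[ℂ] bvec m)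
            + ((√(muNumber (m + 1) μ₂) : ℝ) : ℂ) • (bvec n ⊗ₜ[ℂ] bvec (m + 1)))
          + (-(α : ℂ)⁻¹ * ((√(muNumber (m + 1) μ₂) : ℝ) : ℂ))
            • (a (0, d) • (bvec n ⊗ₜ[ℂ] bvec (m + 1))
              + (-a (n, m + 1)) • (bvec 0 ⊗ₜ[ℂ] bvec d)) := by
        rw [hrec']
        match_scalars
        · field_simp
        · ring
        · ring
      rw [this]
      exact S.add_mem (S.smul_mem _ hJ) (S.smul_mem _ hI)
  have h0 : bvec 0 ⊗ₜ[ℂ] bvec d ∈ S := by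
    -- Weighting the congruences by `a p` assembles the lowest weight vector on one side and `∑ a² =
    -- 1` on the other.
    have hsum : ∑ p ∈ Finset.HasAntidiagonal.antidiagonal d, a p • (a (0, d)
        • (bvec p.1 ⊗ₜ[ℂ] bvec p.2) + (-a p) • (bvec 0 ⊗ₜ[ℂ] bvec d)) ∈ S :=
      S.sum_mem fun p hp => S.smul_mem _
        (key p.1 p.2 (Finset.HasAntidiagonal.mem_antidiagonal.1 hp))
    have hsq : ∑ p ∈ Finset.HasAntidiagonal.antidiagonal d, a p * -a p = -1 := by
      have := congrArg (fun x : ℝ => (x : ℂ)) (sum_cgCoeff_sq h₁ h₂ hε d)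
      push_cast at this
      simp only [mul_neg, Finset.sum_neg_distrib, ← sq, a, this]
    have he : ∑ p ∈ Finset.HasAntidiagonal.antidiagonal d, a p • (a (0, d)
        • (bvec p.1 ⊗ₜ[ℂ] bvec p.2) + (-a p) • (bvec 0 ⊗ₜ[ℂ] bvec d))
        = (-1 : ℂ) • (bvec 0 ⊗ₜ[ℂ] bvec d) + a (0, d) • cgVec μ₁ μ₂ ε d := by
      simp only [smul_add, Finset.sum_add_distrib]
      rw [add_comm]
      congr 1
      · simp only [smul_smul]
        rw [← Finset.sum_smul, hsq]
      · rw [cgVec, Finset.smul_sum]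
        exact Finset.sum_congr rfl fun p _ => smul_comm _ _ _
    rw [he] at hsum
    have h := S.smul_mem (-1 : ℂ)
      (mem_of_add_mem hsum (S.smul_mem _ (cgVec_mem_span μ₁ μ₂ ε d)))
    rwa [smul_smul, neg_one_mul, neg_neg, one_smul] at h
  intro n m hnm
  have h := S.smul_mem (a (0, d))⁻¹ (mem_of_add_mem (key n m hnm) (S.smul_mem _ h0))
  rwa [smul_smul, inv_mul_cancel₀ (ha _), one_smul] at h

lemma span_coupled {μ₁ μ₂ ε : ℝ} (h₁ : 0 < μ₁) (h₂ : 0 < μ₂) (hε : ε ^ 2 = 1) :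
    Submodule.span ℂ (Set.range fun p : ℕ × ℕ => coupled μ₁ μ₂ ε p.1 p.2) = ⊤ := by
  rw [Submodule.eq_top_iff']
  intro v
  induction v using tensor_induction with
  | h0 => exact Submodule.zero_mem _
  | hadd v w hv hw => exact Submodule.add_mem _ hv hw
  | hsmul a v hv => exact Submodule.smul_mem _ _ hv
  | hb n m => exact bvec_mem_span h₁ h₂ hε (n + m) n m rfl

lemma isCoupledBasis_coupled {μ₁ μ₂ ε₁ ε₂ : ℝ} (h₁ : 0 < μ₁) (h₂ : 0 < μ₂) (hε₂ : ε₂ ^ 2 = 1) :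
    IsCoupledBasis μ₁ μ₂ ε₁ ε₂ (coupled μ₁ μ₂ ε₂) where
  orthonormal := by
    rw [orthonormal_iff_ite]
    intro p q
    simp only [incl_eq]
    exact inner_coupled h₁ h₂ hε₂ p.1 p.2 q.1 q.2
  complete := by
    have : (Set.range fun p : ℕ × ℕ => incl (coupled μ₁ μ₂ ε₂ p.1 p.2))
        = inclLinear '' Set.range fun p : ℕ × ℕ => coupled μ₁ μ₂ ε₂ p.1 p.2 := by
      rw [← Set.range_comp]
      rfl
    rw [this, Submodule.span_image, span_coupled h₁ h₂ hε₂, Submodule.map_top,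
      Submodule.eq_top_iff']
    exact fun x => denseRange_inclLinear x
  map_J0 := coprodJ0_coupled μ₁ μ₂ ε₂
  map_R := coprodR_coupled μ₁ μ₂ ε₁ ε₂
  map_Jplus := coprodJplus_coupled ε₂ h₁ h₂
  map_Jminus := coprodJminus_coupled h₁ h₂ hε₂
  phase := fun j => by
    obtain ⟨r, hr, h⟩ := cgCoeff_zero μ₁ μ₂ ε₂ j h₁ h₂
    refine ⟨r, hr, ?_⟩
    rw [incl_eq, incl_eq, coupled, inner_cgVec, if_pos (zero_add j), h]

/-! ### Uniqueness of the coupled basis. -/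

lemma inner_coprodJ0 (μ₁ μ₂ : ℝ) (w : FinSpan ⊗[ℂ] FinSpan) (n m : ℕ) :
    ⟪inclLinear (bvec n ⊗ₜ[ℂ] bvec m), inclLinear (coprodJ0 μ₁ μ₂ w)⟫_ℂ
      = (((n + m : ℕ) + μ₁ + μ₂ + 1 : ℝ) : ℂ)
        * ⟪inclLinear (bvec n ⊗ₜ[ℂ] bvec m), inclLinear w⟫_ℂ := by
  induction w using tensor_induction with
  | h0 => simp
  | hadd v v' h h' => simp only [map_add, inner_add_right, h, h', mul_add]
  | hsmul a v h => simp only [map_smul, inner_smul_right, h, mul_left_comm]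
  | hb n' m' =>
    rw [coprodJ0_bvec, map_smul, inner_smul_right, inner_incl_bvec]
    split_ifs with h
    · obtain ⟨rfl, rfl⟩ := Prod.mk.inj h
      rfl
    · simp

/-- The `J_0` eigenvalue confines the support to `n + m = j`; there the two-term recursion
determines every coordinate from that of `e_0 ⊗ e_j`. -/
lemma exists_eq_smul_cgVec {μ₁ μ₂ ε : ℝ} (h₁ : 0 < μ₁) (h₂ : 0 < μ₂) (hε : ε ^ 2 = 1) {j : ℕ}
    {w : FinSpan ⊗[ℂ] FinSpan}
    (hJ0 : coprodJ0 μ₁ μ₂ w = ((mu12 μ₁ μ₂ j + 1 / 2 : ℝ) : ℂ) • w)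
    (hJm : coprodJminus μ₁ μ₂ ε w = 0) : ∃ z : ℂ, w = z • cgVec μ₁ μ₂ ε j := by
  have ha : ∀ p, (cgCoeff μ₁ μ₂ ε p : ℂ) ≠ 0 := fun p =>
    Complex.ofReal_ne_zero.2 (cgCoeff_ne_zero h₁ h₂ hε p)
  set z : ℂ := ⟪inclLinear (bvec 0 ⊗ₜ[ℂ] bvec j), inclLinear w⟫_ℂ / (cgCoeff μ₁ μ₂ ε (0, j) : ℂ)
    with hz
  have key : ∀ n m, n + m = j → ⟪inclLinear (bvec n ⊗ₜ[ℂ] bvec m), inclLinear w⟫_ℂ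
      = z * (cgCoeff μ₁ μ₂ ε (n, m) : ℂ) := by
    intro n
    induction n with
    | zero =>
      intro m hm
      rw [zero_add] at hm
      rw [hz, hm, div_mul_cancel₀ _ (ha _)]
    | succ n ih =>
      intro m hm
      have h := inner_coprodJminus μ₁ μ₂ ε w n m
      rw [hJm, map_zero, inner_zero_right, ih (m + 1) (by omega)] at h
      set α : ℝ := ε * (-1) ^ m * √(muNumber (n + 1) μ₁)
      have hα : (α : ℂ) ≠ 0 := by
        have hε0 : ε ≠ 0 := fun h0 => by simp [h0] at hε
        have := (Real.sqrt_pos.2 (muNumber_succ_pos n h₁)).ne'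
        exact Complex.ofReal_ne_zero.2 (by positivity)
      have hrec : (α : ℂ) * (cgCoeff μ₁ μ₂ ε (n + 1, m) : ℂ)
          + ((√(muNumber (m + 1) μ₂) : ℝ) : ℂ) * (cgCoeff μ₁ μ₂ ε (n, m + 1) : ℂ) = 0 := by
        have h : α * cgCoeff μ₁ μ₂ ε (n + 1, m) + √(muNumber (m + 1) μ₂) * cgCoeff μ₁ μ₂ ε (n, m + 1)
          = 0 := cgCoeff_succ h₁ h₂ hε n m
        exact_mod_cast h
      apply mul_left_cancel₀ hα
      linear_combination -h - z * hrec
  refine ⟨z, ext_of_coord fun n m => ?_⟩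
  rw [map_smul, inner_smul_right, inner_cgVec]
  split_ifs with h
  · exact key n m h
  · have h0 := inner_coprodJ0 μ₁ μ₂ w n m
    rw [hJ0, map_smul, inner_smul_right] at h0
    have hd : ((j : ℂ) - ((n + m : ℕ) : ℂ)) ≠ 0 := by
      rw [sub_ne_zero]
      exact_mod_cast Ne.symm h
    rw [mul_zero]
    refine (mul_eq_zero.1 (?_ : ((j : ℂ) - ((n + m : ℕ) : ℂ)) * _ = 0)).resolve_left hd
    rw [mu12] at h0
    push_cast at h0 ⊢
    linear_combination h0

lemma IsCoupledBasis.eq_coupled {μ₁ μ₂ ε₁ ε₂ : ℝ} (h₁ : 0 < μ₁) (h₂ : 0 < μ₂)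
    (hε₂ : ε₂ ^ 2 = 1) {e : ℕ → ℕ → FinSpan ⊗[ℂ] FinSpan}
    (he : IsCoupledBasis μ₁ μ₂ ε₁ ε₂ e) : e = coupled μ₁ μ₂ ε₂ := by
  funext j N
  induction N with
  | zero =>
    have hJ0 := he.map_J0 j 0
    have hJm := he.map_Jminus j 0
    rw [Nat.cast_zero, zero_add] at hJ0
    rw [muNumber_zero, Real.sqrt_zero, Complex.ofReal_zero, zero_smul] at hJm
    obtain ⟨z, hz⟩ := exists_eq_smul_cgVec h₁ h₂ hε₂ hJ0 hJm
    have hnorm : ‖z‖ = 1 := by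
      have h := he.orthonormal.1 (j, 0)
      have h' : ‖inclLinear (cgVec μ₁ μ₂ ε₂ j)‖ = 1 :=
        (isCoupledBasis_coupled (ε₁ := ε₁) h₁ h₂ hε₂).orthonormal.1 (j, 0)
      simpa [incl_eq, hz, norm_smul, h'] using h
    obtain ⟨r, hr, hr'⟩ := he.phase j
    obtain ⟨s, hs, hs'⟩ := cgCoeff_zero μ₁ μ₂ ε₂ j h₁ h₂
    rw [incl_eq, incl_eq, hz, map_smul, inner_smul_right, inner_cgVec, if_pos (zero_add j), hs']
      at hr'
    -- The phase condition makes `z` a positive real; its norm is `1`, so `z = 1`.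
    have hzr : z = ((r / s : ℝ) : ℂ) := by
      have hs0 : (s : ℂ) ≠ 0 := Complex.ofReal_ne_zero.2 hs.ne'
      have hp : ((-1 : ℂ) ^ (j * (j + 1) / 2)) ≠ 0 := by simp
      push_cast at hr' ⊢
      rw [eq_div_iff hs0]
      apply mul_left_cancel₀ hp
      linear_combination hr'
    have hz1 : z = 1 := by
      rw [hzr, Complex.norm_real, Real.norm_of_nonneg (by positivity)] at hnorm
      rw [hzr, hnorm, Complex.ofReal_one]
    rw [hz, hz1, one_smul, coupled]
  | succ N ih =>
    have h := he.map_Jplus j N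
    rw [ih, coprodJplus_coupled ε₂ h₁ h₂] at h
    have hp := (Real.sqrt_pos.2 (muNumber_succ_pos N (mu12_pos h₁ h₂ j))).ne'
    have h' := congrArg (fun v => (((√(muNumber (N + 1) (mu12 μ₁ μ₂ j)) : ℝ) : ℂ))⁻¹ • v) h
    simp only [smul_smul, inv_mul_cancel₀ (Complex.ofReal_ne_zero.2 hp), one_smul] at h'
    exact h'.symm

/-! ## The unitary map -/

/-- The Hilbert basis `e_n ⊗ e_m` of `ℓ² ⊗ ℓ²`. -/
def tensorHilbertBasis : HilbertBasis (ℕ × ℕ) ℂ Ell2Tensor :=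
  HilbertBasis.mk (v := fun q : ℕ × ℕ => inclLinear (tensorBasis q))
    (by
      rw [orthonormal_iff_ite]
      intro p q
      simp only [tensorBasis_apply]
      exact inner_incl_bvec _ _ _ _)
    (by
      have : (Set.range fun q : ℕ × ℕ => inclLinear (tensorBasis q))
          = inclLinear '' Set.range tensorBasis := by
        rw [← Set.range_comp]
        rfl
      rw [this, Submodule.span_image, tensorBasis.span_eq, Submodule.map_top]
      exact fun x _ => denseRange_inclLinear x)

lemma tensorHilbertBasis_apply (q : ℕ × ℕ) :
    tensorHilbertBasis q = inclLinear (bvec q.1 ⊗ₜ[ℂ] bvec q.2) := by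
  rw [tensorHilbertBasis, HilbertBasis.coe_mk, tensorBasis_apply]

lemma memLp_chihara₂ {μ₁ μ₂ ε₁ ε₂ : ℝ} (c : ℝ) (h₁ : 0 < μ₁) (h₂ : 0 < μ₂)
    (hε₁ : ε₁ ^ 2 = 1) (hε₂ : ε₂ ^ 2 = 1) (q : ℕ × ℕ) :
    MemLp (fun p => (chihara₂ μ₁ μ₂ ε₁ ε₂ c q p : ℂ)) 2 (measG μ₁ μ₂ ε₁ ε₂ c) :=
  ((expGrowth_chihara₂ μ₁ μ₂ ε₁ ε₂ c q).memLp_measG c h₁ h₂ hε₁ hε₂).ofReal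

/-- The Hilbert basis of products of Chihara polynomials. -/
def chiharaHilbertBasis {μ₁ μ₂ ε₁ ε₂ : ℝ} (c : ℝ) (h₁ : 0 < μ₁) (h₂ : 0 < μ₂)
    (hε₁ : ε₁ ^ 2 = 1) (hε₂ : ε₂ ^ 2 = 1) :
    HilbertBasis (ℕ × ℕ) ℂ (Lp ℂ 2 (measG μ₁ μ₂ ε₁ ε₂ c)) :=
  HilbertBasis.mkOfOrthogonalEqBot
    (v := fun q => (memLp_chihara₂ c h₁ h₂ hε₁ hε₂ q).toLp)
    (by
      rw [orthonormal_iff_ite]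
      intro q r
      rw [L2.inner_def]
      have : (fun p => ⟪(memLp_chihara₂ c h₁ h₂ hε₁ hε₂ q).toLp _ p,
          (memLp_chihara₂ c h₁ h₂ hε₁ hε₂ r).toLp _ p⟫_ℂ)
          =ᵐ[measG μ₁ μ₂ ε₁ ε₂ c] fun p =>
            ((chihara₂ μ₁ μ₂ ε₁ ε₂ c q p * chihara₂ μ₁ μ₂ ε₁ ε₂ c r p : ℝ) : ℂ) := by
        filter_upwards [(memLp_chihara₂ c h₁ h₂ hε₁ hε₂ q).coeFn_toLp,
          (memLp_chihara₂ c h₁ h₂ hε₁ hε₂ r).coeFn_toLp] with p hq hr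
        rw [hq, hr, RCLike.inner_apply, Complex.conj_ofReal, mul_comm, Complex.ofReal_mul]
      rw [integral_congr_ae this, integral_complex_ofReal,
        integral_chihara₂_mul c h₁ h₂ hε₁ hε₂]
      split_ifs <;> simp)
    (by
      rw [Submodule.eq_bot_iff]
      intro f hf
      have hf2 := Lp.memLp f
      have hint : ∀ q, ∫ p, (chihara₂ μ₁ μ₂ ε₁ ε₂ c q p : ℂ) * f p ∂measG μ₁ μ₂ ε₁ ε₂ c = 0 := by
        intro q
        have h := (Submodule.mem_orthogonal _ _).1 hf _ (Submodule.subset_span ⟨q, rfl⟩)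
        rw [L2.inner_def] at h
        rw [← h]
        refine integral_congr_ae ?_
        filter_upwards [(memLp_chihara₂ c h₁ h₂ hε₁ hε₂ q).coeFn_toLp] with p hq
        rw [hq, RCLike.inner_apply, Complex.conj_ofReal, mul_comm]
      have hi : ∀ q, Integrable (fun p => (chihara₂ μ₁ μ₂ ε₁ ε₂ c q p : ℂ) * f p)
          (measG μ₁ μ₂ ε₁ ε₂ c) := fun q =>
        (memLp_chihara₂ c h₁ h₂ hε₁ hε₂ q).integrable_mul hf2
      -- The polynomials are real, so orthogonality passes to the real and imaginary parts
      -- separately.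
      have hre := ae_eq_zero_of_integral_chihara₂_eq_zero c h₁ h₂ hε₁ hε₂ hf2.re fun q => by
        have h := integral_re (𝕜 := ℂ) (hi q)
        rw [hint q] at h
        simpa using h
      have him := ae_eq_zero_of_integral_chihara₂_eq_zero c h₁ h₂ hε₁ hε₂ hf2.im fun q => by
        have h := integral_im (𝕜 := ℂ) (hi q)
        rw [hint q] at h
        simpa using h
      rw [Lp.eq_zero_iff_ae_eq_zero]
      filter_upwards [hre, him] with p hp hp'
      exact Complex.ext hp hp')

/-- The value at `p` of the function associated with a finite linear combination of the
`e_n ⊗ e_m`. -/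
def tensorEval (μ₁ μ₂ ε₁ ε₂ c : ℝ) (p : ℝ × ℝ) : FinSpan ⊗[ℂ] FinSpan →ₗ[ℂ] ℂ :=
  tensorBasis.constr ℂ fun q => (chihara₂ μ₁ μ₂ ε₁ ε₂ c q p : ℂ)

lemma tensorEval_bvec (μ₁ μ₂ ε₁ ε₂ c : ℝ) (p : ℝ × ℝ) (n m : ℕ) :
    tensorEval μ₁ μ₂ ε₁ ε₂ c p (bvec n ⊗ₜ bvec m) = (chihara₂ μ₁ μ₂ ε₁ ε₂ c (n, m) p : ℂ) := by
  rw [← tensorBasis_apply (n, m), tensorEval, Module.Basis.constr_basis]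

lemma IsUpsilon.ae_eq {μ₁ μ₂ ε₁ ε₂ c : ℝ}
    {Υ : Ell2Tensor ≃ₗᵢ[ℂ] Lp ℂ 2 (measG μ₁ μ₂ ε₁ ε₂ c)} (h : IsUpsilon μ₁ μ₂ ε₁ ε₂ c Υ)
    (v : FinSpan ⊗[ℂ] FinSpan) : (Υ (incl v) : ℝ × ℝ → ℂ)
      =ᵐ[measG μ₁ μ₂ ε₁ ε₂ c] fun p => tensorEval μ₁ μ₂ ε₁ ε₂ c p v := by
  induction v using tensor_induction with
  | h0 =>
    rw [incl_eq, map_zero, map_zero]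
    filter_upwards [Lp.coeFn_zero ℂ 2 (measG μ₁ μ₂ ε₁ ε₂ c)] with p hp
    rw [hp, map_zero, Pi.zero_apply]
  | hadd v w hv hw =>
    rw [incl_eq, map_add, map_add]
    filter_upwards [hv, hw, Lp.coeFn_add (Υ (inclLinear v)) (Υ (inclLinear w))] with p hp hp' hs
    rw [hs, Pi.add_apply, map_add, ← hp, ← hp']
    rfl
  | hsmul a v hv =>
    rw [incl_eq, map_smul, map_smul]
    filter_upwards [hv, Lp.coeFn_smul a (Υ (inclLinear v))] with p hp hs
    rw [hs, Pi.smul_apply, map_smul, ← hp]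
    rfl
  | hb n m =>
    filter_upwards [h n m] with p hp
    rw [hp, tensorEval_bvec, chihara₂]

lemma existsUnique_isUpsilon {μ₁ μ₂ ε₁ ε₂ : ℝ} (c : ℝ) (h₁ : 0 < μ₁) (h₂ : 0 < μ₂)
    (hε₁ : ε₁ ^ 2 = 1) (hε₂ : ε₂ ^ 2 = 1) :
    ∃! Υ : Ell2Tensor ≃ₗᵢ[ℂ] Lp ℂ 2 (measG μ₁ μ₂ ε₁ ε₂ c), IsUpsilon μ₁ μ₂ ε₁ ε₂ c Υ := by
  refine ⟨tensorHilbertBasis.repr.trans (chiharaHilbertBasis c h₁ h₂ hε₁ hε₂).repr.symm,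
    fun n m => ?_, fun Υ hΥ => ?_⟩
  · rw [incl_eq, ← tensorHilbertBasis_apply (n, m), LinearIsometryEquiv.trans_apply,
      HilbertBasis.repr_self, HilbertBasis.repr_symm_single, chiharaHilbertBasis,
      HilbertBasis.coe_mkOfOrthogonalEqBot]
    exact (memLp_chihara₂ c h₁ h₂ hε₁ hε₂ (n, m)).coeFn_toLp
  · refine LinearIsometryEquiv.coe_injective (denseRange_inclLinear.equalizer Υ.continuous
      (LinearIsometryEquiv.continuous _) (funext fun v => ?_))
    simp only [Function.comp_apply]
    refine LinearMap.congr_fun (f := Υ.toLinearEquiv.toLinearMap ∘ₗ inclLinear)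
      (g := (tensorHilbertBasis.repr.trans
        (chiharaHilbertBasis c h₁ h₂ hε₁ hε₂).repr.symm).toLinearEquiv.toLinearMap ∘ₗ inclLinear)
      (tensor_linearMap_ext fun n m => ?_) v
    change Υ (inclLinear (bvec n ⊗ₜ bvec m)) = (chiharaHilbertBasis c h₁ h₂ hε₁ hε₂).repr.symm
      (tensorHilbertBasis.repr (inclLinear (bvec n ⊗ₜ bvec m)))
    rw [← tensorHilbertBasis_apply (n, m),
      HilbertBasis.repr_self, HilbertBasis.repr_symm_single, chiharaHilbertBasis,
      HilbertBasis.coe_mkOfOrthogonalEqBot, tensorHilbertBasis_apply]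
    refine Lp.ext ((hΥ n m).trans ?_)
    exact (memLp_chihara₂ c h₁ h₂ hε₁ hε₂ (n, m)).coeFn_toLp.symm

/-! ## The coupled basis as functions -/

/-- The coproduct of `J_+ + J_- + cR` becomes multiplication by `λ₂`. -/
lemma tensorEval_eq_snd_mul {μ₁ μ₂ : ℝ} (h₁ : 0 < μ₁) (h₂ : 0 < μ₂) (ε₁ ε₂ c : ℝ) (p : ℝ × ℝ)
    (v : FinSpan ⊗[ℂ] FinSpan) :
    tensorEval μ₁ μ₂ ε₁ ε₂ c p (coprodJplus μ₁ μ₂ ε₂ v)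
      + tensorEval μ₁ μ₂ ε₁ ε₂ c p (coprodJminus μ₁ μ₂ ε₂ v)
      + c * tensorEval μ₁ μ₂ ε₁ ε₂ c p (coprodR ε₁ ε₂ v)
      = p.2 * tensorEval μ₁ μ₂ ε₁ ε₂ c p v := by
  induction v using tensor_induction with
  | h0 => simp
  | hadd v w hv hw => simp only [map_add]; linear_combination hv + hw
  | hsmul a v hv => simp only [map_smul, smul_eq_mul]; linear_combination a * hv
  | hb n m =>
    rw [coprodJplus_bvec, coprodJminus_bvec, coprodR_bvec]
    simp only [map_add, map_smul, smul_eq_mul, tensorEval_bvec]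
    have h := congrArg (fun x : ℝ => (x : ℂ)) (mul_chihara₂_snd h₁ h₂ ε₁ ε₂ c n m p)
    push_cast at h ⊢
    rw [h]
    ring

/-- Both sides satisfy the same three-term recurrence in `N` with nonzero leading coefficient, and
they agree at `N = 0`. -/
lemma tensorEval_coupled {μ₁ μ₂ ε₁ ε₂ : ℝ} (h₁ : 0 < μ₁) (h₂ : 0 < μ₂) (hε₂ : ε₂ ^ 2 = 1)
    (c : ℝ) (p : ℝ × ℝ) (j N : ℕ) :
    tensorEval μ₁ μ₂ ε₁ ε₂ c p (coupled μ₁ μ₂ ε₂ j N)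
      = (chihara (mu12 μ₁ μ₂ j) (c * eps12 ε₁ ε₂ j) p.2 N : ℂ)
        * tensorEval μ₁ μ₂ ε₁ ε₂ c p (coupled μ₁ μ₂ ε₂ j 0) := by
  have hμ := mu12_pos h₁ h₂ j
  have hrec : ∀ N, ((√(muNumber (N + 1) (mu12 μ₁ μ₂ j)) : ℝ) : ℂ)
      * tensorEval μ₁ μ₂ ε₁ ε₂ c p (coupled μ₁ μ₂ ε₂ j (N + 1))
      + ((√(muNumber N (mu12 μ₁ μ₂ j)) : ℝ) : ℂ)
        * tensorEval μ₁ μ₂ ε₁ ε₂ c p (coupled μ₁ μ₂ ε₂ j (N - 1))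
      + c * ((eps12 ε₁ ε₂ j * (-1) ^ N : ℝ) : ℂ)
        * tensorEval μ₁ μ₂ ε₁ ε₂ c p (coupled μ₁ μ₂ ε₂ j N)
      = p.2 * tensorEval μ₁ μ₂ ε₁ ε₂ c p (coupled μ₁ μ₂ ε₂ j N) := fun N => by
    rw [← tensorEval_eq_snd_mul h₁ h₂, coprodJplus_coupled ε₂ h₁ h₂,
      coprodJminus_coupled h₁ h₂ hε₂, coprodR_coupled, map_smul, map_smul, map_smul, smul_eq_mul,
      smul_eq_mul, smul_eq_mul, mul_assoc]
  have hch : ∀ N, (p.2 : ℂ) * (chihara (mu12 μ₁ μ₂ j) (c * eps12 ε₁ ε₂ j) p.2 N : ℂ)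
      = ((√(muNumber (N + 1) (mu12 μ₁ μ₂ j)) : ℝ) : ℂ)
        * (chihara (mu12 μ₁ μ₂ j) (c * eps12 ε₁ ε₂ j) p.2 (N + 1) : ℂ)
      + c * ((eps12 ε₁ ε₂ j * (-1) ^ N : ℝ) : ℂ)
        * (chihara (mu12 μ₁ μ₂ j) (c * eps12 ε₁ ε₂ j) p.2 N : ℂ)
      + ((√(muNumber N (mu12 μ₁ μ₂ j)) : ℝ) : ℂ)
        * (chihara (mu12 μ₁ μ₂ j) (c * eps12 ε₁ ε₂ j) p.2 (N - 1) : ℂ) := fun N => by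
    have := congrArg (fun x : ℝ => (x : ℂ)) (mul_chihara hμ (c * eps12 ε₁ ε₂ j) p.2 N)
    push_cast at this ⊢
    rw [this]
    ring
  induction N using Nat.strong_induction_on with
  | _ N ih =>
  cases N with
  | zero => simp [chihara]
  | succ N =>
    have hp : ((√(muNumber (N + 1) (mu12 μ₁ μ₂ j)) : ℝ) : ℂ) ≠ 0 :=
      Complex.ofReal_ne_zero.2 (Real.sqrt_pos.2 (muNumber_succ_pos N hμ)).ne'
    have h := hrec N
    rw [ih N (Nat.lt_succ_self N), ih (N - 1) (by omega)] at h
    apply mul_left_cancel₀ hp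
    linear_combination h + tensorEval μ₁ μ₂ ε₁ ε₂ c p (coupled μ₁ μ₂ ε₂ j 0) * hch N

/-- The denominators `√[n]_μ!` of the coefficients cancel the normalization of the Chihara
polynomials, leaving the divided polynomials. -/
lemma tensorEval_cgVec {μ₁ μ₂ : ℝ} (h₁ : 0 < μ₁) (h₂ : 0 < μ₂) (ε₁ ε₂ c : ℝ) (p : ℝ × ℝ) (j : ℕ) :
    tensorEval μ₁ μ₂ ε₁ ε₂ c p (cgVec μ₁ μ₂ ε₂ j)
      = ((lowSum μ₁ μ₂ ε₂ (c * ε₁) p.1 p.2 j / √(cgNorm μ₁ μ₂ j) : ℝ) : ℂ) := by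
  rw [cgVec, map_sum, lowSum, Finset.sum_div, Complex.ofReal_sum]
  refine Finset.sum_congr rfl fun q hq => ?_
  rw [Finset.HasAntidiagonal.mem_antidiagonal] at hq
  rw [map_smul, smul_eq_mul, tensorEval_bvec, ← Complex.ofReal_mul]
  congr 1
  have h₁' := Real.sqrt_pos.2 (muFact_pos h₁ q.1)
  have h₂' := Real.sqrt_pos.2 (muFact_pos h₂ q.2)
  have h₃' := Real.sqrt_pos.2 (cgNorm_pos h₁ h₂ j)
  rw [cgCoeff, hq, chihara₂, chihara_eq_divChihara h₁, chihara_eq_divChihara h₂]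
  field_simp

lemma ae_mem_regionG (μ₁ μ₂ ε₁ ε₂ c : ℝ) :
    ∀ᵐ p ∂measG μ₁ μ₂ ε₁ ε₂ c, p ∈ regionG c := by
  have hm : MeasurableSet (regionG c) :=
    (measurableSet_lt measurable_const (measurable_fst.norm)).inter
      (measurableSet_lt measurable_fst.norm measurable_snd.norm)
  exact (withDensity_absolutelyContinuous _ _).ae_le (ae_restrict_mem hm)

end OspConvolution

end

open OspConvolution

theorem proposition3 (μ₁ μ₂ ε₁ ε₂ c : ℝ) (hμ₁ : 0 < μ₁) (hμ₂ : 0 < μ₂)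
    (hε₁ : ε₁ = 1 ∨ ε₁ = -1) (hε₂ : ε₂ = 1 ∨ ε₂ = -1) :
    (∃! e : ℕ → ℕ → FinSpan ⊗[ℂ] FinSpan, IsCoupledBasis μ₁ μ₂ ε₁ ε₂ e) ∧
    (∃! Υ : Ell2Tensor ≃ₗᵢ[ℂ] Lp ℂ 2 (measG μ₁ μ₂ ε₁ ε₂ c), IsUpsilon μ₁ μ₂ ε₁ ε₂ c Υ) ∧
    ∀ (e : ℕ → ℕ → FinSpan ⊗[ℂ] FinSpan)
      (Υ : Ell2Tensor ≃ₗᵢ[ℂ] Lp ℂ 2 (measG μ₁ μ₂ ε₁ ε₂ c)),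
      IsCoupledBasis μ₁ μ₂ ε₁ ε₂ e → IsUpsilon μ₁ μ₂ ε₁ ε₂ c Υ →
      (∀ j N : ℕ, (Υ (incl (e j N)) : ℝ × ℝ → ℂ) =ᵐ[measG μ₁ μ₂ ε₁ ε₂ c] fun p =>
        ((chihara (mu12 μ₁ μ₂ j) (c * eps12 ε₁ ε₂ j) p.2 N : ℝ) : ℂ)
          * (Υ (incl (e j 0)) : ℝ × ℝ → ℂ) p) ∧
      (∀ j : ℕ, (Υ (incl (e j 0)) : ℝ × ℝ → ℂ) =ᵐ[measG μ₁ μ₂ ε₁ ε₂ c] fun p =>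
        ((Real.sign p.2 ^ j * normK μ₁ μ₂ ε₁ ε₂ c j p.2
          * bigJacobi j (ε₂ * p.1 / p.2) (2 * μ₂) (2 * μ₁) (-(c * ε₁ * ε₂) / p.2) : ℝ) : ℂ)) := by
  replace hε₁ : ε₁ ^ 2 = 1 := by rcases hε₁ with rfl | rfl <;> norm_num
  replace hε₂ : ε₂ ^ 2 = 1 := by rcases hε₂ with rfl | rfl <;> norm_num
  refine ⟨⟨coupled μ₁ μ₂ ε₂, isCoupledBasis_coupled hμ₁ hμ₂ hε₂,
    fun e he => he.eq_coupled hμ₁ hμ₂ hε₂⟩, existsUnique_isUpsilon c hμ₁ hμ₂ hε₁ hε₂,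
    fun e Υ he hΥ => ?_⟩
  obtain rfl := he.eq_coupled hμ₁ hμ₂ hε₂
  refine ⟨fun j N => ?_, fun j => ?_⟩
  · filter_upwards [hΥ.ae_eq (coupled μ₁ μ₂ ε₂ j N), hΥ.ae_eq (coupled μ₁ μ₂ ε₂ j 0)] with p hp hp'
    rw [hp, hp', tensorEval_coupled hμ₁ hμ₂ hε₂]
  · filter_upwards [hΥ.ae_eq (coupled μ₁ μ₂ ε₂ j 0), ae_mem_regionG μ₁ μ₂ ε₁ ε₂ c] with p hp hG
    rw [hp, coupled, tensorEval_cgVec hμ₁ hμ₂]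
    congr 1
    rcases Nat.even_or_odd' j with ⟨m, rfl | rfl⟩
    · exact lowSum_eq_bigJacobi_even hμ₁ hμ₂ hε₁ hε₂ hG.1 hG.2 m
    · exact lowSum_eq_bigJacobi_odd hμ₁ hμ₂ hε₁ hε₂ hG.1 hG.2 m
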